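/- **Corollary (equivalence with duality under $\varphi_K$).** Let $K\subset\mathbb R^2$ be a convex body (compact, convex, with non-empty interior) whose boundary is a simple closed regular curve of class $C^2$. Notation: * For $0<\delta<\mathrm{Vol}_2(K)$ and a unit vector $\xi$, let $H_\xi$ be the line orthogonal to $\xi$ such that the part of $K$ on the side of $H_\xi$ to which $\xi$ points has area $\delta$. $\Pi_\delta(K)$ is the envelope of the lines $H_\xi$ (the curve of flotation), and $\Gamma_\delta(K)$ is the set of the centroids of the parts of area $\delta$ cut off by the lines $H_\xi$. * For $\hat\delta>0$, $\Pi^{\hat\delta}(K)$ is the set of points $p$ for which $\mathrm{conv}(K\cup\{p\})\setminus K$ has area $\hat\delta$ (the curve of illumination), and $\Gamma^{\hat\delta}(K)$ is the set of the centroids of these regions. * A set $A$ is homothetic to a set $B$ with ratio $\lambda$ if, for some point $o$, the homothety with center $o$ and ratio $\lambda$ maps $A$ onto $B$. * For a line $\ell$ that meets the interior of $K$, its pole $\varphi_K(\ell)$ is the point (possibly at infinity) where the tangent lines of $K$ at the two points of $\ell\cap\partial K$ intersect. $\Pi_\delta(K)$ and $\Pi^{\hat\delta}(K)$ are dual with respect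 to $\varphi_K$ if $\{\varphi_K(H_\xi) : |\xi|=1\}=\Pi^{\hat\delta}(K)$, i.e. the poles of the tangent lines $H_\xi$ of $\Pi_\delta(K)$ are exactly the points of $\Pi^{\hat\delta}(K)$. Let $0<\delta\le\frac12\mathrm{Vol}_2(K)$, $\hat\delta>0$ and $\lambda,\hat\lambda>0$ satisfy $$\frac1{\hat\delta\hat\lambda}=\frac2{\delta\lambda}\qquad\text{and}\qquad\frac1{\hat\lambda}+\frac2\lambda=3.$$ Then the following are equivalent: 1. $\Pi_\delta(K)$ is homothetic to $\Gamma_\delta(K)$ with ratio $\lambda$; 2. $\Pi^{\hat\delta}(K)$ is homothetic to $\Gamma^{\hat\delta}(K)$ with ratio $\hat\lambda$; 3. $\Pi_\delta(K)$ and $\Pi^{\hat\delta}(K)$ are dual with respect to $\varphi_K$. -/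

import Mathlib

open MeasureTheory

noncomputable section

/-- The Euclidean plane. -/
abbrev Plane : Type := EuclideanSpace ℝ (Fin 2)

/-- The boundary of `K` is a simple closed regular curve of class `C^2`. -/
def HasC2Boundary (K : Set Plane) : Prop :=
  ∃ (γ : ℝ → Plane) (L : ℝ), 0 < L ∧ ContDiff ℝ 2 γ ∧ Function.Periodic γ L ∧
    (∀ s, deriv γ s ≠ 0) ∧ Set.InjOn γ (Set.Ico 0 L) ∧ Set.range γ = frontier K

/-- The unit vector `ξ(θ) = (cos θ, sin θ)`. -/
def unitVec (θ : ℝ) : Plane := !₂[Real.cos θ, Real.sin θ]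

/-- The derivative `ξ'(θ) = (-sin θ, cos θ)` of `unitVec`. -/
def unitVecPerp (θ : ℝ) : Plane := !₂[-Real.sin θ, Real.cos θ]

/-- The line `{q : ⟨q, ξ(θ)⟩ = t}`. -/
def lineAt (θ t : ℝ) : Set Plane := {q | inner ℝ q (unitVec θ) = t}

/-- The part of `K` cut off by the line `lineAt θ t`, on the side to which `ξ(θ)` points. -/
def cap (K : Set Plane) (θ t : ℝ) : Set Plane := K ∩ {q | t ≤ inner ℝ q (unitVec θ)}

/-- `lineAt θ t` is the water line with normal `ξ(θ)`: it cuts off from `K` the area `δ`. -/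
def IsWaterLine (K : Set Plane) (δ θ t : ℝ) : Prop :=
  volume (cap K θ t) = ENNReal.ofReal δ

/-- The envelope of the family of lines `⟨q, ξ(θ)⟩ = h(θ)`, `θ ∈ ℝ`: the locus of the
characteristic points, which satisfy this equation and its derivative in `θ`. -/
def lineEnvelope (h : ℝ → ℝ) : Set Plane :=
  {q | ∃ θ, inner ℝ q (unitVec θ) = h θ ∧ HasDerivAt h (inner ℝ q (unitVecPerp θ)) θ}

/-- The curve of flotation `Π_δ(K)`: the envelope of the water lines. -/
def flotationCurve (K : Set Plane) (δ : ℝ) : Set Plane :=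
  {q | ∃ h : ℝ → ℝ, (∀ θ, IsWaterLine K δ θ (h θ)) ∧ q ∈ lineEnvelope h}

/-- The centroid of a set of positive finite area. -/
def areaCentroid (S : Set Plane) : Plane := ⨍ q in S, q ∂volume

/-- The curve of buoyancy `Γ_δ(K)`: the locus of the centroids of the parts of area `δ`
cut off by the water lines. -/
def buoyancyCurve (K : Set Plane) (δ : ℝ) : Set Plane :=
  {b | ∃ θ t, IsWaterLine K δ θ t ∧ b = areaCentroid (cap K θ t)}

/-- The silhouette cone `conv(K ∪ {p}) \ K`. -/
def silhouetteCone (K : Set Plane) (p : Plane) : Set Plane :=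
  convexHull ℝ (K ∪ {p}) \ K

/-- The curve of illumination `Π^δ(K)`: the apexes of the silhouette cones of area `δ`. -/
def illuminationCurve (K : Set Plane) (δ : ℝ) : Set Plane :=
  {p | volume (silhouetteCone K p) = ENNReal.ofReal δ}

/-- The centroid curve `Γ^δ(K)`: the locus of the centroids of the silhouette cones with apex
on the curve of illumination. -/
def illuminationCentroidCurve (K : Set Plane) (δ : ℝ) : Set Plane :=
  {b | ∃ p ∈ illuminationCurve K δ, b = areaCentroid (silhouetteCone K p)}

/-- `A` is homothetic to `B` with ratio `r`: some homothety of ratio `r` maps `A` onto `B`. -/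
def IsHomotheticWithRatio (A B : Set Plane) (r : ℝ) : Prop :=
  ∃ c : Plane, AffineMap.homothety c r '' A = B

/-- `p` lies on a line through `x` that supports `K`. For `x` in the boundary of a convex body
with `C^1` boundary, this line is unique: it is the tangent line at `x`. -/
def MemTangentLine (K : Set Plane) (x p : Plane) : Prop :=
  ∃ n : Plane, n ≠ 0 ∧ (∀ q ∈ K, inner ℝ q n ≤ inner ℝ x n) ∧ inner ℝ p n = inner ℝ x n

/-- `p` is the pole `φ_K(ℓ)` of the line `ℓ`, and `ℓ` the polar of `p`: the line `ℓ` meets the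
interior of `K`, and the tangent lines of `K` at the two points where `ℓ` crosses the boundary
of `K` intersect at `p`. (If these tangent lines are parallel, the pole is at infinity and no
point `p` of the plane qualifies.) -/
def IsPole (K ℓ : Set Plane) (p : Plane) : Prop :=
  (ℓ ∩ interior K).Nonempty ∧
    ∃ x ∈ ℓ ∩ frontier K, ∃ y ∈ ℓ ∩ frontier K, x ≠ y ∧
      MemTangentLine K x p ∧ MemTangentLine K y p

/-- `Π_δ(K)` and `Π^δ'(K)` are dual with respect to `φ_K`: the poles of the tangent lines of
`Π_δ(K)` (the water lines) are exactly the points of `Π^δ'(K)`. -/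
def AreDual (K : Set Plane) (δ δ' : ℝ) : Prop :=
  (∀ θ t, IsWaterLine K δ θ t → ∃ p ∈ illuminationCurve K δ', IsPole K (lineAt θ t) p) ∧
    ∀ p ∈ illuminationCurve K δ', ∃ θ t, IsWaterLine K δ θ t ∧ IsPole K (lineAt θ t) p

end

noncomputable section

open scoped InnerProductSpace Topology

/-! ### Moving frames of the plane -/

/-! Write `ξ`, `ξ'` for the moving frame. The water line with normal `ξ(θ)` carries a chord from `Y`
to `X` of length `l` with midpoint `m`, and cuts off a cap with centroid `b`. Since the area of the
cap is constant, the line touches its envelope at `m` (Dupin), and `b' = l³/(12δ) ξ'`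
(`hasDerivAt_capCentroid`). Also `m' = ρ ξ'`, where the tangents of `K` at `X` and `Y` determine
`ρ`: if they meet at `p`, at height `u` above the chord, then `4ρu = l²` (`exists_speed`). So the
triangle `pXY` has area `T = l³/(8ρ)`, and `b' = r m'` says precisely that `T = 3δr/2`. The two
relations between the parameters amount to `3δr/2 = 3δ'r' = δ + δ'`. As the silhouette cone of `p`
is the triangle minus the cap, `b' = r m'` holds for all `θ` exactly if all poles have cone area
`δ'`. This is 1 ⇔ 3.

For 3 ⇒ 2, take first moments: the cone centroid `g` satisfies `δ' g = T (p + 2m)/3 - δ b`. Insert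
`b = c + r (m - c)`; the terms in `m` cancel because `δr = 2δ'r'`, and `g = c + r' (p - c)` remains
(`coneCentroid_eq_of_contact`).

For 2 ⇒ 3, the cone area is a convex function of the apex whose subgradient is half the contact
chord, turned by a right angle (`IsContact.subgradient`). Hence the curve of illumination bounds a
convex set, with supporting line at `p` parallel to the chord. When the apex moves along the curve,
the first moment changes to first order by `T/3` times the displacement, so `g = c + r' (p - c)`
forces `T = 3δ'r' = δ + δ'` (`triangle_area_of_frequently_ne`). At a corner of the curve the apex
rests while the direction turns; there one interpolates between the extreme contact chords
(`IsContact.interpolate`). The cap under the chord then has area `δ`, so the chord lies on a water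
line and `p` is its pole.

Homothety is a statement about sets, and must be turned into one about corresponding points. For
cones, the highest apex in a direction also has the highest centroid (`IsContact.moment_lt`). For
caps, the curve of flotation might have singular points; their images are negligible by a
one-dimensional Sard argument (`capCentroid_eq_or`), and `δ ≤ Vol/2` rules out matching a centroid
with the opposite chord.

Smoothness of `K` enters only through the uniqueness of normals. -/

lemma inner_plane (p q : Plane) : ⟪p, q⟫_ℝ = p 0 * q 0 + p 1 * q 1 := by
  rw [PiLp.inner_apply, Fin.sum_univ_two]
  simp only [RCLike.inner_apply, conj_trivial]
  ring

lemma inner_unitVec (q : Plane) (θ : ℝ) :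
    ⟪q, unitVec θ⟫_ℝ = q 0 * Real.cos θ + q 1 * Real.sin θ := by
  rw [inner_plane]; simp [unitVec]

lemma inner_unitVecPerp (q : Plane) (θ : ℝ) :
    ⟪q, unitVecPerp θ⟫_ℝ = -(q 0 * Real.sin θ) + q 1 * Real.cos θ := by
  rw [inner_plane]; simp [unitVecPerp]

/-- The point with coordinates `u`, `s` in the frame `unitVec θ`, `unitVecPerp θ`. -/
def framePt (θ u s : ℝ) : Plane := u • unitVec θ + s • unitVecPerp θ

lemma framePt_zero (θ u s : ℝ) : framePt θ u s 0 = u * Real.cos θ - s * Real.sin θ := by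
  simp [framePt, unitVec, unitVecPerp]; ring

lemma framePt_one (θ u s : ℝ) : framePt θ u s 1 = u * Real.sin θ + s * Real.cos θ := by
  simp [framePt, unitVec, unitVecPerp]

@[simp] lemma inner_framePt_unitVec (θ u s : ℝ) : ⟪framePt θ u s, unitVec θ⟫_ℝ = u := by
  rw [inner_unitVec, framePt_zero, framePt_one]
  linear_combination u * Real.sin_sq_add_cos_sq θ

@[simp] lemma inner_framePt_unitVecPerp (θ u s : ℝ) :
    ⟪framePt θ u s, unitVecPerp θ⟫_ℝ = s := by
  rw [inner_unitVecPerp, framePt_zero, framePt_one]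
  linear_combination s * Real.sin_sq_add_cos_sq θ

lemma plane_ext {p q : Plane} (h0 : p 0 = q 0) (h1 : p 1 = q 1) : p = q := by
  ext i; fin_cases i <;> assumption

lemma framePt_inner (θ : ℝ) (q : Plane) :
    framePt θ ⟪q, unitVec θ⟫_ℝ ⟪q, unitVecPerp θ⟫_ℝ = q := by
  apply plane_ext
  · rw [framePt_zero, inner_unitVec, inner_unitVecPerp]
    linear_combination q 0 * Real.sin_sq_add_cos_sq θ
  · rw [framePt_one, inner_unitVec, inner_unitVecPerp]
    linear_combination q 1 * Real.sin_sq_add_cos_sq θ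

lemma frame_ext (θ : ℝ) {p q : Plane} (h : ⟪p, unitVec θ⟫_ℝ = ⟪q, unitVec θ⟫_ℝ)
    (h' : ⟪p, unitVecPerp θ⟫_ℝ = ⟪q, unitVecPerp θ⟫_ℝ) : p = q := by
  rw [← framePt_inner θ p, ← framePt_inner θ q, h, h']

lemma inner_frame (θ : ℝ) (p q : Plane) :
    ⟪p, q⟫_ℝ = ⟪p, unitVec θ⟫_ℝ * ⟪q, unitVec θ⟫_ℝ
      + ⟪p, unitVecPerp θ⟫_ℝ * ⟪q, unitVecPerp θ⟫_ℝ := by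
  simp only [inner_unitVec, inner_unitVecPerp]
  rw [inner_plane]
  linear_combination -(p 0 * q 0 + p 1 * q 1) * Real.sin_sq_add_cos_sq θ

lemma inner_framePt (θ u s : ℝ) (e : Plane) :
    ⟪framePt θ u s, e⟫_ℝ = u * ⟪unitVec θ, e⟫_ℝ + s * ⟪unitVecPerp θ, e⟫_ℝ := by
  rw [framePt, inner_add_left, real_inner_smul_left, real_inner_smul_left]

@[simp] lemma inner_unitVec_self (θ : ℝ) : ⟪unitVec θ, unitVec θ⟫_ℝ = 1 := by
  rw [inner_unitVec]; simp [unitVec]; linear_combination Real.sin_sq_add_cos_sq θ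

@[simp] lemma inner_unitVecPerp_self (θ : ℝ) : ⟪unitVecPerp θ, unitVecPerp θ⟫_ℝ = 1 := by
  rw [inner_unitVecPerp]; simp [unitVecPerp]; linear_combination Real.sin_sq_add_cos_sq θ

@[simp] lemma inner_unitVec_unitVecPerp (θ : ℝ) : ⟪unitVec θ, unitVecPerp θ⟫_ℝ = 0 := by
  rw [inner_unitVecPerp]; simp [unitVec]; ring

@[simp] lemma inner_unitVecPerp_unitVec (θ : ℝ) : ⟪unitVecPerp θ, unitVec θ⟫_ℝ = 0 := by
  rw [inner_unitVec]; simp [unitVecPerp]; ring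

lemma inner_unitVecPerp_unitVec' (φ θ : ℝ) :
    ⟪unitVecPerp φ, unitVec θ⟫_ℝ = Real.sin (θ - φ) := by
  rw [inner_unitVec, Real.sin_sub]; simp [unitVecPerp]; ring

@[simp] lemma norm_unitVec (θ : ℝ) : ‖unitVec θ‖ = 1 := by
  rw [← sq_eq_sq₀ (norm_nonneg _) zero_le_one, ← real_inner_self_eq_norm_sq, inner_unitVec_self,
    one_pow]

@[simp] lemma norm_unitVecPerp (θ : ℝ) : ‖unitVecPerp θ‖ = 1 := by
  rw [← sq_eq_sq₀ (norm_nonneg _) zero_le_one, ← real_inner_self_eq_norm_sq,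
    inner_unitVecPerp_self, one_pow]

lemma unitVec_add_pi (θ : ℝ) : unitVec (θ + Real.pi) = -unitVec θ := by
  apply plane_ext <;> simp [unitVec]

lemma unitVecPerp_add_pi (θ : ℝ) : unitVecPerp (θ + Real.pi) = -unitVecPerp θ := by
  apply plane_ext <;> simp [unitVecPerp]

lemma norm_sq_frame (θ : ℝ) (p : Plane) :
    ‖p‖ ^ 2 = ⟪p, unitVec θ⟫_ℝ ^ 2 + ⟪p, unitVecPerp θ⟫_ℝ ^ 2 := by
  rw [← real_inner_self_eq_norm_sq, inner_frame θ]; ring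

lemma abs_inner_unitVec_le (θ : ℝ) (p : Plane) : |⟪p, unitVec θ⟫_ℝ| ≤ ‖p‖ := by
  simpa [norm_unitVec] using abs_real_inner_le_norm p (unitVec θ)

lemma abs_inner_unitVecPerp_le (θ : ℝ) (p : Plane) : |⟪p, unitVecPerp θ⟫_ℝ| ≤ ‖p‖ := by
  simpa [norm_unitVecPerp] using abs_real_inner_le_norm p (unitVecPerp θ)

lemma norm_le_frame (θ : ℝ) (p : Plane) :
    ‖p‖ ≤ |⟪p, unitVec θ⟫_ℝ| + |⟪p, unitVecPerp θ⟫_ℝ| := by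
  apply abs_le_of_sq_le_sq' _ (by positivity) |>.2
  rw [norm_sq_frame θ, ← sq_abs ⟪p, unitVec θ⟫_ℝ, ← sq_abs ⟪p, unitVecPerp θ⟫_ℝ]
  nlinarith [abs_nonneg ⟪p, unitVec θ⟫_ℝ, abs_nonneg ⟪p, unitVecPerp θ⟫_ℝ]

lemma hasDerivAt_plane {f : ℝ → Plane} {f' : Plane} {θ : ℝ}
    (h0 : HasDerivAt (fun φ => f φ 0) (f' 0) θ) (h1 : HasDerivAt (fun φ => f φ 1) (f' 1) θ) :
    HasDerivAt f f' θ := by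
  have key : ∀ q : Plane, q = q 0 • unitVec 0 + q 1 • unitVecPerp 0 := fun q => by
    apply plane_ext <;> simp [unitVec, unitVecPerp]
  rw [key f', funext fun φ => key (f φ)]
  exact (h0.smul_const _).add (h1.smul_const _)

lemma hasDerivAt_unitVec (θ : ℝ) : HasDerivAt unitVec (unitVecPerp θ) θ := by
  apply hasDerivAt_plane
  · simpa [unitVec, unitVecPerp] using Real.hasDerivAt_cos θ
  · simpa [unitVec, unitVecPerp] using Real.hasDerivAt_sin θ

lemma hasDerivAt_unitVecPerp (θ : ℝ) : HasDerivAt unitVecPerp (-unitVec θ) θ := by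
  apply hasDerivAt_plane
  · simpa [unitVec, unitVecPerp] using (Real.hasDerivAt_sin θ).fun_neg
  · simpa [unitVec, unitVecPerp] using Real.hasDerivAt_cos θ

lemma continuous_unitVec : Continuous unitVec :=
  continuous_iff_continuousAt.2 fun θ => (hasDerivAt_unitVec θ).continuousAt

lemma continuous_unitVecPerp : Continuous unitVecPerp :=
  continuous_iff_continuousAt.2 fun θ => (hasDerivAt_unitVecPerp θ).continuousAt

lemma norm_unitVec_sub_le (φ θ : ℝ) : ‖unitVec φ - unitVec θ‖ ≤ |φ - θ| := by
  have h := Convex.norm_image_sub_le_of_norm_hasDerivWithin_le (𝕜 := ℝ) (f := unitVec)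
    (f' := unitVecPerp) (C := 1) (s := Set.univ) (x := θ) (y := φ)
    (fun x _ => (hasDerivAt_unitVec x).hasDerivWithinAt) (fun x _ => (norm_unitVecPerp x).le)
    convex_univ trivial trivial
  simpa using h

/-- Every nonzero vector is a positive multiple of some `unitVecPerp θ`. -/
lemma exists_eq_smul_unitVecPerp {v : Plane} (hv : v ≠ 0) :
    ∃ θ l : ℝ, 0 < l ∧ v = l • unitVecPerp θ := by
  -- `v = l • (-sin θ, cos θ)` means `v 1 - i v 0 = l e^{iθ}`, so `θ` and `l` are argument and
  -- modulus of this number.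
  set z : ℂ := ⟨v 1, -v 0⟩ with hz
  have hz0 : z ≠ 0 := by
    intro h
    apply hv
    have h1 := congrArg Complex.re h
    have h2 := congrArg Complex.im h
    simp only [hz, Complex.zero_re, Complex.zero_im, neg_eq_zero] at h1 h2
    exact plane_ext (by simpa using h2) (by simpa using h1)
  refine ⟨z.arg, ‖z‖, norm_pos_iff.2 hz0, ?_⟩
  have h1 := Complex.norm_mul_cos_arg z
  have h2 := Complex.norm_mul_sin_arg z
  apply plane_ext
  · simp only [unitVecPerp, PiLp.smul_apply, smul_eq_mul]
    change v 0 = ‖z‖ * -Real.sin z.arg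
    simp only [hz] at h2 ⊢
    linarith
  · simp only [unitVecPerp, PiLp.smul_apply, smul_eq_mul]
    change v 1 = ‖z‖ * Real.cos z.arg
    simp only [hz] at h1 ⊢
    linarith

lemma continuous_framePt (θ : ℝ) : Continuous fun z : ℝ × ℝ => framePt θ z.1 z.2 := by
  unfold framePt; fun_prop

/-- The frame coordinates as an isometry onto the standard plane. -/
lemma measurePreserving_framePt (θ : ℝ) :
    MeasurePreserving (fun z : ℝ × ℝ => framePt θ z.1 z.2) volume volume := by
  have hon : Orthonormal ℝ ![unitVec θ, unitVecPerp θ] := by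
    rw [orthonormal_iff_ite]
    intro i j
    fin_cases i <;> fin_cases j <;> simp
  let b : OrthonormalBasis (Fin 2) ℝ Plane :=
    (basisOfOrthonormalOfCardEqFinrank hon (by simp)).toOrthonormalBasis (by simp [hon])
  have hb0 : b 0 = unitVec θ := by simp [b]
  have hb1 : b 1 = unitVecPerp θ := by simp [b]
  have h1 := b.measurePreserving_repr_symm
  have h2 := (PiLp.volume_preserving_toLp (Fin 2))
  have h3 := (volume_preserving_finTwoArrow ℝ).symm
  have h := h1.comp (h2.comp h3)
  convert h using 1
  funext z
  simp only [Function.comp]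
  rw [← b.sum_repr (b.repr.symm _), Fin.sum_univ_two, hb0, hb1]
  simp [framePt]

/-- The part of `S` on the line of height `u`, in the coordinate along the line. -/
def slice (θ : ℝ) (S : Set Plane) (u : ℝ) : Set ℝ := {s | framePt θ u s ∈ S}

lemma framePt_measurableEmbedding (θ : ℝ) :
    MeasurableEmbedding (fun z : ℝ × ℝ => framePt θ z.1 z.2) := by
  apply (continuous_framePt θ).measurableEmbedding
  intro z w h
  simp only at h
  have h1 := congrArg (fun q => ⟪q, unitVec θ⟫_ℝ) h
  have h2 := congrArg (fun q => ⟪q, unitVecPerp θ⟫_ℝ) h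
  simp only [inner_framePt_unitVec, inner_framePt_unitVecPerp] at h1 h2
  exact Prod.ext h1 h2

lemma integral_frame (θ : ℝ) {S : Set Plane} (hS : MeasurableSet S) {f : Plane → ℝ}
    (hf : IntegrableOn f S) :
    ∫ q in S, f q = ∫ u, ∫ s in slice θ S u, f (framePt θ u s) := by
  have hm := measurePreserving_framePt θ
  have he := framePt_measurableEmbedding θ
  rw [← integral_indicator hS, ← hm.integral_comp he, Measure.volume_eq_prod, integral_prod]
  · refine integral_congr_ae (Filter.Eventually.of_forall fun u => ?_)
    simp only
    rw [← integral_indicator]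
    · rfl
    · exact hS.preimage ((continuous_framePt θ).comp (Continuous.prodMk_right u)).measurable
  · have := (hm.integrable_comp_emb he).2 ((integrable_indicator_iff hS).2 hf)
    exact this

lemma integral_frame_swap (θ : ℝ) {S : Set Plane} (hS : MeasurableSet S) {f : Plane → ℝ}
    (hf : IntegrableOn f S) :
    ∫ q in S, f q = ∫ s, ∫ u, S.indicator f (framePt θ u s) := by
  have hm := measurePreserving_framePt θ
  have he := framePt_measurableEmbedding θ
  rw [← integral_indicator hS, ← hm.integral_comp he, Measure.volume_eq_prod, integral_prod_symm]
  have := (hm.integrable_comp_emb he).2 ((integrable_indicator_iff hS).2 hf)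
  exact this
/-! ### Triangles -/

/-- The determinant of two plane vectors. -/
def cross (a b : Plane) : ℝ := a 0 * b 1 - a 1 * b 0

lemma cross_frame (θ : ℝ) (a b : Plane) :
    cross a b = ⟪a, unitVec θ⟫_ℝ * ⟪b, unitVecPerp θ⟫_ℝ
      - ⟪a, unitVecPerp θ⟫_ℝ * ⟪b, unitVec θ⟫_ℝ := by
  simp only [inner_unitVec, inner_unitVecPerp]
  rw [cross]
  linear_combination -(a 0 * b 1 - a 1 * b 0) * Real.sin_sq_add_cos_sq θ

lemma cross_smul_unitVecPerp (a : Plane) (l θ : ℝ) :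
    cross a (l • unitVecPerp θ) = l * ⟪a, unitVec θ⟫_ℝ := by
  rw [cross_frame θ, real_inner_smul_left, real_inner_smul_left]; simp; ring

lemma continuous_cross : Continuous fun z : Plane × Plane => cross z.1 z.2 := by
  unfold cross; fun_prop

lemma Continuous.cross {X : Type*} [TopologicalSpace X] {f g : X → Plane} (hf : Continuous f)
    (hg : Continuous g) : Continuous fun z => cross (f z) (g z) :=
  continuous_cross.comp (hf.prodMk hg)

/-- The closed triangle with vertices `p`, `x`, `y`. -/
def tri (p x y : Plane) : Set Plane := convexHull ℝ {p, x, y}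

/-- By Cramer's rule the two cross products, divided by `cross (x - p) (y - p)`, are the barycentric
weights of `q` at `y` and at `x`; the last inequality is nonnegativity of the weight at `p`. -/
lemma mem_tri_iff {p x y : Plane} (h : 0 < cross (x - p) (y - p)) (q : Plane) :
    q ∈ tri p x y ↔ 0 ≤ cross (x - p) (q - p) ∧ 0 ≤ cross (q - p) (y - p) ∧
      cross (x - p) (q - p) + cross (q - p) (y - p) ≤ cross (x - p) (y - p) := by
  constructor
  · intro hq
    have hc : Convex ℝ {q : Plane | 0 ≤ cross (x - p) (q - p) ∧ 0 ≤ cross (q - p) (y - p) ∧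
        cross (x - p) (q - p) + cross (q - p) (y - p) ≤ cross (x - p) (y - p)} := by
      rintro a ⟨ha1, ha2, ha3⟩ b ⟨hb1, hb2, hb3⟩ s t hs ht hst
      obtain rfl : t = 1 - s := by linarith
      have e1 : cross (x - p) (s • a + (1 - s) • b - p)
          = s * cross (x - p) (a - p) + (1 - s) * cross (x - p) (b - p) := by
        simp [cross]; ring
      have e2 : cross (s • a + (1 - s) • b - p) (y - p)
          = s * cross (a - p) (y - p) + (1 - s) * cross (b - p) (y - p) := by
        simp [cross]; ring
      refine ⟨?_, ?_, ?_⟩ <;> simp only [e1, e2]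
      · positivity
      · positivity
      · nlinarith
    refine convexHull_min ?_ hc hq
    have e0 : ∀ a : Plane, cross a (p - p) = 0 := fun a => by simp [cross]
    have e0' : ∀ a : Plane, cross (p - p) a = 0 := fun a => by simp [cross]
    have e1 : ∀ a : Plane, cross a a = 0 := fun a => by simp [cross]; ring
    rintro z (rfl | rfl | rfl)
    · simp only [Set.mem_ofPred_eq, e0, e0']; simp [h.le]
    · simp only [Set.mem_ofPred_eq, e1]; simp [h.le]
    · simp only [Set.mem_ofPred_eq, e1]; simp [h.le]
  · rintro ⟨h1, h2, h3⟩
    set D := cross (x - p) (y - p) with hD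
    set γ := cross (x - p) (q - p) / D with hγ
    set β := cross (q - p) (y - p) / D with hβ
    have hq : q = (1 - β - γ) • p + β • x + γ • y := by
      have hD0 : D ≠ 0 := h.ne'
      apply plane_ext
      · simp only [PiLp.add_apply, PiLp.smul_apply, smul_eq_mul, hγ, hβ]
        field_simp
        simp only [hD, cross, PiLp.sub_apply]; ring
      · simp only [PiLp.add_apply, PiLp.smul_apply, smul_eq_mul, hγ, hβ]
        field_simp
        simp only [hD, cross, PiLp.sub_apply]; ring
    have hγ0 : 0 ≤ γ := by positivity
    have hβ0 : 0 ≤ β := by positivity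
    have hα0 : 0 ≤ 1 - β - γ := by
      have : β + γ ≤ 1 := by
        rw [hβ, hγ, ← add_div, div_le_one h]; linarith
      linarith
    rw [tri, convexHull_insert (by simp), convexHull_pair, convexJoin_singleton_left]
    rw [Set.mem_iUnion₂]
    -- If both weights vanish then `q = p`, and any point of the opposite side will do.
    rcases eq_or_lt_of_le (add_nonneg hβ0 hγ0) with h0 | h0
    · refine ⟨x, left_mem_segment _ _ _, ?_⟩
      have : β = 0 := by linarith
      have hγ' : γ = 0 := by linarith
      rw [hq, ‹β = 0›, hγ']; simp [left_mem_segment]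
    · refine ⟨(β / (β + γ)) • x + (γ / (β + γ)) • y, ⟨_, _, by positivity, by positivity,
        by field_simp, rfl⟩, 1 - β - γ, β + γ, hα0, h0.le, by ring, ?_⟩
      rw [hq, smul_add, smul_smul, smul_smul, mul_div_cancel₀ _ h0.ne', mul_div_cancel₀ _ h0.ne',
        add_assoc]

lemma isCompact_tri (p x y : Plane) : IsCompact (tri p x y) :=
  Set.Finite.isCompact_convexHull ℝ (by simp)

lemma convex_tri (p x y : Plane) : Convex ℝ (tri p x y) := convex_convexHull ℝ _

lemma setIntegral_Icc_affine {lo hi : ℝ} (h : lo ≤ hi) (A γ : ℝ) :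
    ∫ s in Set.Icc lo hi, (A + γ * s) = (hi - lo) * (A + γ * ((lo + hi) / 2)) := by
  rw [integral_Icc_eq_integral_Ioc, ← intervalIntegral.integral_of_le h,
    intervalIntegral.integral_add (by simp)
    (by apply Continuous.intervalIntegrable; fun_prop), intervalIntegral.integral_const_mul]
  simp; ring

/-- The slices of a triangle in a frame in which one side is a level line. -/
lemma slice_tri {p x y : Plane} {θ l : ℝ} (h : 0 < cross (x - p) (y - p))
    (hxy : x - y = l • unitVecPerp θ) (hl : 0 < l) :
    0 < ⟪p, unitVec θ⟫_ℝ - ⟪x, unitVec θ⟫_ℝ ∧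
    cross (x - p) (y - p) = l * (⟪p, unitVec θ⟫_ℝ - ⟪x, unitVec θ⟫_ℝ) ∧
    ∀ u, slice θ (tri p x y) u =
      if u ∈ Set.Icc ⟪x, unitVec θ⟫_ℝ ⟪p, unitVec θ⟫_ℝ then
        Set.Icc
          (⟪p, unitVecPerp θ⟫_ℝ - (⟪p, unitVecPerp θ⟫_ℝ - ⟪y, unitVecPerp θ⟫_ℝ)
            * ((⟪p, unitVec θ⟫_ℝ - u) / (⟪p, unitVec θ⟫_ℝ - ⟪x, unitVec θ⟫_ℝ)))
          (⟪p, unitVecPerp θ⟫_ℝ - (⟪p, unitVecPerp θ⟫_ℝ - ⟪x, unitVecPerp θ⟫_ℝ)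
            * ((⟪p, unitVec θ⟫_ℝ - u) / (⟪p, unitVec θ⟫_ℝ - ⟪x, unitVec θ⟫_ℝ)))
      else ∅ := by
  have hux : ⟪x, unitVec θ⟫_ℝ = ⟪y, unitVec θ⟫_ℝ := by
    have := congrArg (fun v => ⟪v, unitVec θ⟫_ℝ) hxy
    simp only [inner_sub_left, real_inner_smul_left] at this; simp at this; linarith
  have hsx : ⟪x, unitVecPerp θ⟫_ℝ - ⟪y, unitVecPerp θ⟫_ℝ = l := by
    have := congrArg (fun v => ⟪v, unitVecPerp θ⟫_ℝ) hxy
    simp only [inner_sub_left, real_inner_smul_left] at this; simpa using this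
  have hD : cross (x - p) (y - p) = l * (⟪p, unitVec θ⟫_ℝ - ⟪x, unitVec θ⟫_ℝ) := by
    rw [cross_frame θ]; simp only [inner_sub_left]; rw [← hux, ← hsx]; ring
  have hd : 0 < ⟪p, unitVec θ⟫_ℝ - ⟪x, unitVec θ⟫_ℝ := by
    rw [hD] at h; exact (pos_iff_pos_of_mul_pos h).1 hl
  refine ⟨hd, hD, fun u => ?_⟩
  ext s
  rw [slice, Set.mem_ofPred_eq, mem_tri_iff h, hD, cross_frame θ, cross_frame θ]
  simp only [inner_sub_left, inner_framePt_unitVec, inner_framePt_unitVecPerp]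
  rw [← hux]
  set a := ⟪p, unitVec θ⟫_ℝ
  set b := ⟪x, unitVec θ⟫_ℝ
  set c := ⟪p, unitVecPerp θ⟫_ℝ
  set m := ⟪x, unitVecPerp θ⟫_ℝ
  have hn : ⟪y, unitVecPerp θ⟫_ℝ = m - l := by linarith
  rw [hn]
  have e3 : (b - a) * (s - c) - (m - c) * (u - a) + ((u - a) * (m - l - c) - (s - c) * (b - a))
      = l * (a - u) := by ring
  have e1 : 0 ≤ (b - a) * (s - c) - (m - c) * (u - a) ↔ s ≤ c - (c - m) * ((a - u) / (a - b)) := by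
    rw [← mul_div_assoc, le_sub_comm (a := s), div_le_iff₀ hd]
    constructor <;> intro h <;> linarith
  have e2 : 0 ≤ (u - a) * (m - l - c) - (s - c) * (b - a) ↔
      c - (c - (m - l)) * ((a - u) / (a - b)) ≤ s := by
    rw [← mul_div_assoc, sub_le_comm, le_div_iff₀ hd]
    constructor <;> intro h <;> linarith
  rw [e3, e1, e2]
  split_ifs with hu
  · rw [Set.mem_Icc]
    constructor
    · rintro ⟨h1, h2, -⟩; exact ⟨h2, h1⟩
    · rintro ⟨h2, h1⟩
      exact ⟨h1, h2, by have := hu.1; gcongr⟩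
  · simp only [Set.mem_empty_iff_false, iff_false]
    rintro ⟨h1, h2, h3⟩
    apply hu
    constructor
    · have := le_of_mul_le_mul_left h3 hl
      linarith
    · have h4 := h2.trans h1
      have h5 : 0 ≤ l * ((a - u) / (a - b)) := by linarith
      have h6 := nonneg_of_mul_nonneg_right h5 hl
      have h7 : 0 ≤ a - u := by
        by_contra hneg
        have := div_neg_of_neg_of_pos (not_le.1 hneg) hd
        linarith
      linarith

/-- An affine function integrates to the area times its value at the centroid. Keeping `c` and `e`
together gives the area, the first moments and weighted mixtures from one computation. -/
lemma tri_integral {p x y : Plane} (h : 0 < cross (x - p) (y - p)) (c : ℝ) (e : Plane) :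
    ∫ q in tri p x y, (c + ⟪q, e⟫_ℝ) =
      cross (x - p) (y - p) / 2 * (c + ⟪p + x + y, e⟫_ℝ / 3) := by
  have hne : x - y ≠ 0 := by
    intro h0
    rw [sub_eq_zero] at h0
    rw [h0, cross] at h
    linarith
  obtain ⟨θ, l, hl, hxy⟩ := exists_eq_smul_unitVecPerp hne
  obtain ⟨hd, hD, hs⟩ := slice_tri h hxy hl
  have hux : ⟪x, unitVec θ⟫_ℝ = ⟪y, unitVec θ⟫_ℝ := by
    have := congrArg (fun v => ⟪v, unitVec θ⟫_ℝ) hxy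
    simp only [inner_sub_left, real_inner_smul_left] at this; simp at this; linarith
  have hsx : ⟪y, unitVecPerp θ⟫_ℝ = ⟪x, unitVecPerp θ⟫_ℝ - l := by
    have := congrArg (fun v => ⟪v, unitVecPerp θ⟫_ℝ) hxy
    simp only [inner_sub_left, real_inner_smul_left] at this; simp at this; linarith
  have hint : IntegrableOn (fun q : Plane => c + ⟪q, e⟫_ℝ) (tri p x y) :=
    (by fun_prop : Continuous fun q : Plane => c + ⟪q, e⟫_ℝ).continuousOn.integrableOn_compact
      (isCompact_tri _ _ _)
  rw [integral_frame θ (isCompact_tri _ _ _).measurableSet hint, hD, inner_add_left,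
    inner_add_left, inner_frame θ p e, inner_frame θ x e, inner_frame θ y e]
  simp only [hs, inner_framePt]
  rw [← hux, hsx, real_inner_comm e (unitVec θ), real_inner_comm e (unitVecPerp θ)]
  set a := ⟪p, unitVec θ⟫_ℝ
  set b := ⟪x, unitVec θ⟫_ℝ
  set k := ⟪p, unitVecPerp θ⟫_ℝ
  set m := ⟪x, unitVecPerp θ⟫_ℝ
  set e0 := ⟪e, unitVec θ⟫_ℝ
  set e1 := ⟪e, unitVecPerp θ⟫_ℝ
  have hba : b ≤ a := by linarith
  have hin : ∀ u, (∫ s in (if u ∈ Set.Icc b a then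
        Set.Icc (k - (k - (m - l)) * ((a - u) / (a - b))) (k - (k - m) * ((a - u) / (a - b)))
      else ∅), (c + (u * e0 + s * e1))) = (Set.Icc b a).indicator (fun u =>
        l * ((a - u) / (a - b)) *
          (c + u * e0 + e1 * (k - (k - m + l / 2) * ((a - u) / (a - b))))) u := by
    intro u
    split_ifs with hu
    · rw [Set.indicator_of_mem hu]
      have h0 : 0 ≤ (a - u) / (a - b) := div_nonneg (by linarith [hu.2]) hd.le
      have hle : k - (k - (m - l)) * ((a - u) / (a - b)) ≤ k - (k - m) * ((a - u) / (a - b)) := by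
        nlinarith
      have := setIntegral_Icc_affine hle (c + u * e0) e1
      rw [show (fun s => c + (u * e0 + s * e1)) = fun s => c + u * e0 + e1 * s from by
        funext s; ring, this]
      ring
    · rw [Set.indicator_of_notMem hu]; simp
  simp only [hin]
  rw [integral_indicator measurableSet_Icc, integral_Icc_eq_integral_Ioc,
    ← intervalIntegral.integral_of_le hba]
  set d := a - b with hdd
  -- The antiderivative is found by writing both factors of the integrand as polynomials in `a - u`,
  -- the distance from the apex level.
  have hF : ∀ u ∈ Set.uIcc b a, HasDerivAt (fun u =>
      -(l / d) * (c + a * e0 + e1 * k) * ((a - u) ^ 2 / 2)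
        + (l / d) * (e0 + e1 * (k - m + l / 2) / d) * ((a - u) ^ 3 / 3))
      (l * ((a - u) / d) * (c + u * e0 + e1 * (k - (k - m + l / 2) * ((a - u) / d)))) u := by
    intro u _
    have h1 : HasDerivAt (fun u => a - u) (-1) u := by simpa using (hasDerivAt_id u).const_sub a
    have := (((h1.pow 2).div_const 2).const_mul (-(l / d) * (c + a * e0 + e1 * k))).add
      (((h1.pow 3).div_const 3).const_mul ((l / d) * (e0 + e1 * (k - m + l / 2) / d)))
    refine this.congr_deriv ?_
    field_simp
    ring
  rw [intervalIntegral.integral_eq_sub_of_hasDerivAt hF (by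
    apply Continuous.intervalIntegrable; fun_prop)]
  have : b = a - d := by rw [hdd]; ring
  rw [this]
  field_simp
  ring

lemma tri_volume {p x y : Plane} (h : 0 < cross (x - p) (y - p)) :
    volume.real (tri p x y) = cross (x - p) (y - p) / 2 := by
  have := tri_integral h 1 0
  simpa using this
/-! ### Silhouette cones -/

/-- Rotation of a vector by a right angle. -/
def perp (v : Plane) : Plane := !₂[-v 1, v 0]

lemma cross_eq_inner (v w : Plane) : cross v w = ⟪w, perp v⟫_ℝ := by
  rw [inner_plane, cross]; simp [perp]; ring

lemma perp_ne_zero {v : Plane} (hv : v ≠ 0) : perp v ≠ 0 := by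
  intro h
  apply hv
  have h0 := congrArg (fun w : Plane => w 0) h
  have h1 := congrArg (fun w : Plane => w 1) h
  simp [perp] at h0 h1
  exact plane_ext (by simpa using h1) (by simpa using h0)

lemma exists_inner_gt_of_mem_interior {K : Set Plane} {z n : Plane} (hz : z ∈ interior K)
    (hn : n ≠ 0) : ∃ k ∈ K, ⟪z, n⟫_ℝ < ⟪k, n⟫_ℝ := by
  have hc : Filter.Tendsto (fun ε : ℝ => z + ε • n) (𝓝[>] 0) (𝓝 z) := by
    have : Filter.Tendsto (fun ε : ℝ => z + ε • n) (𝓝 0) (𝓝 (z + (0 : ℝ) • n)) :=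
      (by fun_prop : Continuous fun ε : ℝ => z + ε • n).tendsto 0
    rw [zero_smul, add_zero] at this
    exact this.mono_left nhdsWithin_le_nhds
  obtain ⟨ε, h1, h2⟩ := ((hc.eventually (mem_interior_iff_mem_nhds.1 hz)).and
    self_mem_nhdsWithin).exists
  refine ⟨_, h1, ?_⟩
  rw [inner_add_left, real_inner_smul_left]
  have : 0 < ⟪n, n⟫_ℝ := real_inner_self_pos.2 hn
  have h2' : 0 < ε := h2
  linarith [mul_pos h2' this]

/-- `x` and `y` are contact points of the two supporting lines of `K` through `p`; seen from `p`,
the body lies counterclockwise of `x` and clockwise of `y`. -/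
structure IsContact (K : Set Plane) (p x y : Plane) : Prop where
  left_mem : x ∈ K
  right_mem : y ∈ K
  left_nonneg : ∀ k ∈ K, 0 ≤ cross (x - p) (k - p)
  right_nonpos : ∀ k ∈ K, cross (y - p) (k - p) ≤ 0
  pos : 0 < cross (x - p) (y - p)

lemma cross_swap (a b : Plane) : cross a b = -cross b a := by
  unfold cross; ring

lemma cross_same (a : Plane) : cross a a = 0 := by unfold cross; ring

/-- Strict positivity is automatic outside `K`. If `x - p` and `y - p` were parallel, either they
point in opposite directions and `p` lies on the segment from `x` to `y`, hence in `K`, or they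
point in the same direction and the two sign conditions confine `K` to a line, leaving no interior.
-/
lemma IsContact.of_ne {K : Set Plane} {p x y : Plane} (hconv : Convex ℝ K)
    (hint : (interior K).Nonempty) (hp : p ∉ K) (hx : x ∈ K) (hy : y ∈ K)
    (hl : ∀ k ∈ K, 0 ≤ cross (x - p) (k - p)) (hr : ∀ k ∈ K, cross (y - p) (k - p) ≤ 0) :
    IsContact K p x y := by
  refine ⟨hx, hy, hl, hr, lt_of_le_of_ne (hl y hy) fun h0 => ?_⟩
  obtain ⟨z, hz⟩ := hint
  have hxp : x - p ≠ 0 := sub_ne_zero.2 fun h => hp (h ▸ hx)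
  have hyp : y - p ≠ 0 := sub_ne_zero.2 fun h => hp (h ▸ hy)
  have hX : 0 < ⟪x - p, x - p⟫_ℝ := real_inner_self_pos.2 hxp
  have hY : 0 < ⟪y - p, y - p⟫_ℝ := real_inner_self_pos.2 hyp
  have key : ∀ k : Plane, ⟪x - p, x - p⟫_ℝ * cross (y - p) (k - p)
      = ⟪x - p, y - p⟫_ℝ * cross (x - p) (k - p) := by
    intro k
    have : cross (x - p) (y - p) = 0 := h0.symm
    simp only [inner_plane, cross] at this ⊢
    linear_combination ((x - p) 0 * (k - p) 0 + (x - p) 1 * (k - p) 1) * -this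
  have hL : (x - p : Plane) = (⟪x - p, y - p⟫_ℝ / ⟪y - p, y - p⟫_ℝ) • (y - p) := by
    have h : cross (x - p) (y - p) = 0 := h0.symm
    have hY0 := hY.ne'
    apply plane_ext
    · rw [PiLp.smul_apply, smul_eq_mul, div_mul_eq_mul_div, eq_div_iff hY0]
      simp only [inner_plane, cross] at h ⊢
      linear_combination (y - p) 1 * h
    · rw [PiLp.smul_apply, smul_eq_mul, div_mul_eq_mul_div, eq_div_iff hY0]
      simp only [inner_plane, cross] at h ⊢
      linear_combination -(y - p) 0 * h
  rcases lt_or_ge ⟪x - p, y - p⟫_ℝ 0 with hneg | hnn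
  · apply hp
    set c := ⟪x - p, y - p⟫_ℝ / ⟪y - p, y - p⟫_ℝ with hc
    have hc0 : c < 0 := div_neg_of_neg_of_pos hneg hY
    have hp' : p = (1 / (1 - c)) • x + (-c / (1 - c)) • y := by
      have h1 : (1 - c) ≠ 0 := by linarith
      have hx' : x = p + c • (y - p) := by rw [← hL]; abel
      rw [hx']
      apply plane_ext <;> simp <;> field_simp <;> ring
    rw [hp']
    exact hconv hx hy (div_nonneg zero_le_one (by linarith))
      (div_nonneg (by linarith) (by linarith)) (by field_simp [show (1 - c) ≠ 0 by linarith]; ring)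
  · have hzero : ∀ k ∈ K, cross (x - p) (k - p) = 0 := by
      intro k hk
      rcases eq_or_lt_of_le hnn with h | h
      · exfalso
        rw [← h, zero_div, zero_smul] at hL
        exact hxp hL
      · have h1 := key k
        have h2 := hl k hk
        have h3 := hr k hk
        nlinarith
    obtain ⟨k, hk, hlt⟩ := exists_inner_gt_of_mem_interior hz (perp_ne_zero hxp)
    have h1 := hzero k hk
    have h2 := hzero z (interior_subset hz)
    rw [cross_eq_inner, inner_sub_left] at h1 h2
    linarith

/-- A functional `e` separates `p` from `K`. The quotient `cross e (k - p) / ⟪k - p, e⟫` is, up to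
scale, monotone in the angle under which `k` is seen from `p`, so its extrema on the compact set `K`
are the contact points. -/
lemma exists_isContact {K : Set Plane} (hconv : Convex ℝ K) (hcomp : IsCompact K)
    (hint : (interior K).Nonempty) {p : Plane} (hp : p ∉ K) : ∃ x y, IsContact K p x y := by
  obtain ⟨f, a, hfa, hfb⟩ := geometric_hahn_banach_point_closed hconv hcomp.isClosed hp
  set e : Plane := (InnerProductSpace.toDual ℝ Plane).symm f with he
  have hf : ∀ v, f v = ⟪v, e⟫_ℝ := fun v => by
    rw [he, real_inner_comm, InnerProductSpace.toDual_symm_apply]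
  have hpos : ∀ k ∈ K, 0 < ⟪k - p, e⟫_ℝ := fun k hk => by
    rw [inner_sub_left, ← hf, ← hf]; linarith [hfb k hk]
  have hne : K.Nonempty := hint.mono interior_subset
  have hcont : ContinuousOn (fun k => cross e (k - p) / ⟪k - p, e⟫_ℝ) K := by
    apply ContinuousOn.div
    · exact (continuous_const.cross (by fun_prop)).continuousOn
    · fun_prop
    · exact fun k hk => (hpos k hk).ne'
  have key : ∀ a b : Plane, ⟪a, e⟫_ℝ * cross e b - cross e a * ⟪b, e⟫_ℝ
      = ⟪e, e⟫_ℝ * cross a b := by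
    intro a b
    simp only [inner_plane, cross]; ring
  have he0 : e ≠ 0 := by
    rintro h
    obtain ⟨k, hk⟩ := hne
    have := hpos k hk
    rw [h, inner_zero_right] at this
    exact lt_irrefl _ this
  have hee : 0 < ⟪e, e⟫_ℝ := real_inner_self_pos.2 he0
  obtain ⟨x, hx, hxm⟩ := hcomp.exists_isMinOn hne hcont
  obtain ⟨y, hy, hym⟩ := hcomp.exists_isMaxOn hne hcont
  refine ⟨x, y, IsContact.of_ne hconv hint hp hx hy (fun k hk => ?_) (fun k hk => ?_)⟩
  · have h := isMinOn_iff.1 hxm k hk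
    rw [div_le_div_iff₀ (hpos x hx) (hpos k hk)] at h
    have h2 := key (x - p) (k - p)
    refine (mul_nonneg_iff_of_pos_left hee).1 ?_
    linarith
  · have h := isMaxOn_iff.1 hym k hk
    rw [div_le_div_iff₀ (hpos k hk) (hpos y hy)] at h
    have h2 := key (y - p) (k - p)
    refine nonpos_of_mul_nonpos_right (?_ : ⟪e, e⟫_ℝ * _ ≤ 0) hee
    linarith

/-! ### Chords in horizontal position: silhouette cones as triangles minus caps. -/

section Dir

variable {K : Set Plane} {p x y : Plane} {θ l : ℝ}

lemma height_eq_of_dir (hxy : x - y = l • unitVecPerp θ) :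
    ⟪y, unitVec θ⟫_ℝ = ⟪x, unitVec θ⟫_ℝ := by
  have := congrArg (fun v => ⟪v, unitVec θ⟫_ℝ) hxy
  simp only [inner_sub_left, real_inner_smul_left] at this; simp at this; linarith

lemma width_eq_of_dir (hxy : x - y = l • unitVecPerp θ) :
    ⟪y, unitVecPerp θ⟫_ℝ = ⟪x, unitVecPerp θ⟫_ℝ - l := by
  have := congrArg (fun v => ⟪v, unitVecPerp θ⟫_ℝ) hxy
  simp only [inner_sub_left, real_inner_smul_left] at this; simp at this; linarith

/-- The barycentric weight at `p` is proportional to the height above the side `xy`. This lets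
triangles be compared with caps. -/
lemma cross_height (hxy : x - y = l • unitVecPerp θ) (q : Plane) :
    cross (x - p) (y - p) - cross (x - p) (q - p) - cross (q - p) (y - p)
      = l * (⟪q, unitVec θ⟫_ℝ - ⟪x, unitVec θ⟫_ℝ) := by
  rw [cross_frame θ, cross_frame θ, cross_frame θ]
  simp only [inner_sub_left, height_eq_of_dir hxy, width_eq_of_dir hxy]
  ring

lemma cross_apex (hxy : x - y = l • unitVecPerp θ) :
    cross (x - p) (y - p) = l * (⟪p, unitVec θ⟫_ℝ - ⟪x, unitVec θ⟫_ℝ) := by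
  have := cross_height (p := p) hxy p
  simpa [cross] using this

lemma mem_tri_iff_height (h : 0 < cross (x - p) (y - p)) (hxy : x - y = l • unitVecPerp θ)
    (hl : 0 < l) (q : Plane) :
    q ∈ tri p x y ↔ 0 ≤ cross (x - p) (q - p) ∧ 0 ≤ cross (q - p) (y - p) ∧
      ⟪x, unitVec θ⟫_ℝ ≤ ⟪q, unitVec θ⟫_ℝ := by
  have := cross_height (p := p) hxy q
  rw [mem_tri_iff h]
  refine and_congr Iff.rfl (and_congr Iff.rfl ⟨fun h => ?_, fun h => ?_⟩)
  · have h2 : 0 ≤ l * (⟪q, unitVec θ⟫_ℝ - ⟪x, unitVec θ⟫_ℝ) := by linarith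
    linarith [nonneg_of_mul_nonneg_right h2 hl]
  · have : 0 ≤ l * (⟪q, unitVec θ⟫_ℝ - ⟪x, unitVec θ⟫_ℝ) := mul_nonneg hl.le (by linarith)
    linarith

lemma IsContact.exists_dir (hc : IsContact K p x y) :
    ∃ θ l : ℝ, 0 < l ∧ x - y = l • unitVecPerp θ := by
  apply exists_eq_smul_unitVecPerp
  intro h
  have := hc.pos
  rw [sub_eq_zero.1 h, cross_same] at this
  exact lt_irrefl _ this

lemma IsContact.height_lt (hc : IsContact K p x y) (hxy : x - y = l • unitVecPerp θ)
    (hl : 0 < l) : ⟪x, unitVec θ⟫_ℝ < ⟪p, unitVec θ⟫_ℝ := by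
  have := hc.pos
  rw [cross_apex hxy] at this
  linarith [(pos_iff_pos_of_mul_pos this).1 hl]

/-- `K` lies in the angle at `p` spanned by the contact rays, and the triangle is the part of this
angle above the chord. -/
lemma IsContact.cap_subset (hc : IsContact K p x y) (hxy : x - y = l • unitVecPerp θ)
    (hl : 0 < l) : cap K θ ⟪x, unitVec θ⟫_ℝ ⊆ tri p x y := by
  rintro k ⟨hk, hu⟩
  rw [mem_tri_iff_height hc.pos hxy hl]
  refine ⟨hc.left_nonneg k hk, ?_, hu⟩
  rw [cross_swap]
  linarith [hc.right_nonpos k hk]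

lemma tri_subset_halfPlane (h : 0 < cross (x - p) (y - p)) (hxy : x - y = l • unitVecPerp θ)
    (hl : 0 < l) : tri p x y ⊆ {q | ⟪x, unitVec θ⟫_ℝ ≤ ⟪q, unitVec θ⟫_ℝ} := fun q hq =>
  ((mem_tri_iff_height h hxy hl q).1 hq).2.2

lemma tri_subset_hull (hx : x ∈ K) (hy : y ∈ K) : tri p x y ⊆ convexHull ℝ (K ∪ {p}) := by
  apply convexHull_mono
  rintro z (rfl | rfl | rfl)
  · exact Or.inr rfl
  · exact Or.inl hx
  · exact Or.inl hy

/-- The hull consists of the segments from `p` to points `k` of `K`. If `k` is above the chord, it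
is in the triangle, and so is the segment. Otherwise the segment crosses the chord: up to the
crossing it stays in the triangle, beyond it in `K`. -/
lemma IsContact.convex_union (hc : IsContact K p x y) (hconv : Convex ℝ K) :
    convexHull ℝ (K ∪ {p}) = K ∪ tri p x y := by
  obtain ⟨θ, l, hl, hxy⟩ := hc.exists_dir
  apply Set.Subset.antisymm
  · rw [Set.union_singleton, convexHull_insert ⟨x, hc.left_mem⟩, hconv.convexHull_eq,
      convexJoin_singleton_left]
    intro q hq
    obtain ⟨k, hk, hq⟩ := Set.mem_iUnion₂.1 hq
    have hpt : p ∈ tri p x y := subset_convexHull ℝ _ (by simp)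
    have hut := hc.height_lt hxy hl
    rcases le_or_gt ⟪x, unitVec θ⟫_ℝ ⟪k, unitVec θ⟫_ℝ with hku | hku
    · exact Or.inr ((convex_tri p x y).segment_subset hpt (hc.cap_subset hxy hl ⟨hk, hku⟩) hq)
    · obtain ⟨a, b, ha, hb, hab, rfl⟩ := hq
      obtain rfl : a = 1 - b := by linarith
      have hc1 : ∀ b : ℝ, cross (x - p) ((1 - b) • p + b • k - p) = b * cross (x - p) (k - p) := by
        intro b; simp [cross]; ring
      have hc2 : ∀ b : ℝ, cross ((1 - b) • p + b • k - p) (y - p) = b * cross (k - p) (y - p) := by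
        intro b; simp [cross]; ring
      have h1 := hc.left_nonneg k hk
      have h2 : 0 ≤ cross (k - p) (y - p) := by
        rw [cross_swap]; linarith [hc.right_nonpos k hk]
      have hmem : ∀ b : ℝ, 0 ≤ b →
          ⟪x, unitVec θ⟫_ℝ ≤ ⟪(1 - b) • p + b • k, unitVec θ⟫_ℝ →
          (1 - b) • p + b • k ∈ tri p x y := fun b hb hh => by
        rw [mem_tri_iff_height hc.pos hxy hl, hc1, hc2]
        exact ⟨mul_nonneg hb h1, mul_nonneg hb h2, hh⟩
      by_cases hu : ⟪x, unitVec θ⟫_ℝ ≤ ⟪(1 - b) • p + b • k, unitVec θ⟫_ℝ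
      · exact Or.inr (hmem b hb hu)
      · left
        push Not at hu
        set U := ⟪p, unitVec θ⟫_ℝ with hU
        set t := ⟪x, unitVec θ⟫_ℝ with ht
        set v := ⟪k, unitVec θ⟫_ℝ with hv
        have hub : ∀ b : ℝ, ⟪(1 - b) • p + b • k, unitVec θ⟫_ℝ = (1 - b) * U + b * v := by
          intro b; rw [inner_add_left, real_inner_smul_left, real_inner_smul_left]
        rw [hub] at hu
        -- Parameter at which the segment from `p` to `k` reaches the level of the chord.
        set c := (U - t) / (U - v) with hcdef
        have hUv : 0 < U - v := by linarith
        have hcb : c ≤ b := by rw [hcdef, div_le_iff₀ hUv]; linarith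
        have hc0 : 0 ≤ c := div_nonneg (by linarith) hUv.le
        have hcu : (1 - c) * U + c * v = t := by
          rw [hcdef]; field_simp; ring
        have hz : (1 - c) • p + c • k ∈ tri p x y := hmem c hc0 (by rw [hub, hcu])
        set z := (1 - c) • p + c • k with hzdef
        have hzK : z ∈ K := by
          have hD := hc.pos
          have hz' := (mem_tri_iff hc.pos z).1 hz
          have hh := cross_height (p := p) hxy z
          rw [hub, hcu, sub_self, mul_zero] at hh
          set D := cross (x - p) (y - p) with hDdef
          -- At the level of the chord the weight at `p` is zero, so `z` is a convex combination of
          -- `x` and `y`.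
          have hzeq : z = (cross (z - p) (y - p) / D) • x + (cross (x - p) (z - p) / D) • y := by
            have hD0 := hD.ne'
            apply plane_ext
            · simp only [PiLp.add_apply, PiLp.smul_apply, smul_eq_mul]
              field_simp
              simp only [hDdef, cross, PiLp.sub_apply] at hh ⊢
              linear_combination p 0 * hh
            · simp only [PiLp.add_apply, PiLp.smul_apply, smul_eq_mul]
              field_simp
              simp only [hDdef, cross, PiLp.sub_apply] at hh ⊢
              linear_combination p 1 * hh
          rw [hzeq]
          exact hconv hc.left_mem hc.right_mem (div_nonneg hz'.2.1 hD.le)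
            (div_nonneg hz'.1 hD.le) (by rw [← add_div, div_eq_one_iff_eq hD.ne']; linarith)
        rcases eq_or_lt_of_le hb with hb0 | hb0
        · have : c = 0 := le_antisymm (by linarith) hc0
          rw [this] at hcu
          linarith
        have hc1' : c < 1 := by rw [hcdef, div_lt_one hUv]; linarith
        have : (1 - b) • p + b • k
            = ((1 - b) / (1 - c)) • z + ((b - c) / (1 - c)) • k := by
          have h1c : (1 - c) ≠ 0 := by linarith
          rw [hzdef]
          apply plane_ext <;> simp <;> field_simp <;> ring
        rw [this]
        refine hconv hzK hk (div_nonneg ha (by linarith)) (div_nonneg (by linarith)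
          (by linarith)) ?_
        rw [← add_div, div_eq_one_iff_eq (by linarith)]; ring
  · exact Set.union_subset ((Set.subset_union_left).trans (subset_convexHull ℝ _))
      (tri_subset_hull hc.left_mem hc.right_mem)

lemma IsContact.silhouetteCone_eq (hc : IsContact K p x y) (hconv : Convex ℝ K)
    (hxy : x - y = l • unitVecPerp θ) (hl : 0 < l) :
    silhouetteCone K p = tri p x y \ cap K θ ⟪x, unitVec θ⟫_ℝ := by
  rw [silhouetteCone, hc.convex_union hconv]
  ext q
  constructor
  · rintro ⟨h | h, hn⟩
    · exact absurd h hn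
    · exact ⟨h, fun hq => hn hq.1⟩
  · rintro ⟨h, hn⟩
    exact ⟨Or.inr h, fun hq => hn ⟨hq, tri_subset_halfPlane hc.pos hxy hl h⟩⟩

lemma isCompact_cap (hcomp : IsCompact K) (θ t : ℝ) : IsCompact (cap K θ t) :=
  hcomp.inter_right (isClosed_le continuous_const (by fun_prop))

lemma IsContact.integral_silhouetteCone (hc : IsContact K p x y) (hconv : Convex ℝ K)
    (hcomp : IsCompact K) (hxy : x - y = l • unitVecPerp θ) (hl : 0 < l) {f : Plane → ℝ}
    (hf : Continuous f) :
    ∫ q in silhouetteCone K p, f q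
      = (∫ q in tri p x y, f q) - ∫ q in cap K θ ⟪x, unitVec θ⟫_ℝ, f q := by
  rw [hc.silhouetteCone_eq hconv hxy hl,
    setIntegral_sdiff (isCompact_cap hcomp _ _).measurableSet
      (hf.continuousOn.integrableOn_compact (isCompact_tri _ _ _)) (hc.cap_subset hxy hl)]

lemma IsContact.volume_silhouetteCone (hc : IsContact K p x y) (hconv : Convex ℝ K)
    (hcomp : IsCompact K) (hxy : x - y = l • unitVecPerp θ) (hl : 0 < l) :
    volume.real (silhouetteCone K p)
      = cross (x - p) (y - p) / 2 - volume.real (cap K θ ⟪x, unitVec θ⟫_ℝ) := by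
  have := hc.integral_silhouetteCone hconv hcomp hxy hl (f := fun _ => 1) continuous_const
  simpa [tri_volume hc.pos] using this

lemma isBounded_silhouetteCone (hcomp : IsCompact K) (q : Plane) :
    Bornology.IsBounded (silhouetteCone K q) :=
  ((isBounded_convexHull.2 (hcomp.isBounded.union Bornology.isBounded_singleton))).subset
    Set.sdiff_subset

lemma volume_silhouetteCone_ne_top (hcomp : IsCompact K) (q : Plane) :
    volume (silhouetteCone K q) ≠ ⊤ := (isBounded_silhouetteCone hcomp q).measure_lt_top.ne

lemma integrableOn_silhouetteCone (hcomp : IsCompact K) (q : Plane) {f : Plane → ℝ}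
    (hf : Continuous f) : IntegrableOn f (silhouetteCone K q) :=
  (hf.continuousOn.integrableOn_compact
    (isBounded_silhouetteCone hcomp q).isCompact_closure).mono_set subset_closure

lemma silhouetteCone_of_mem (hconv : Convex ℝ K) (hp : p ∈ K) : silhouetteCone K p = ∅ := by
  rw [silhouetteCone, Set.union_singleton, Set.insert_eq_of_mem hp, hconv.convexHull_eq,
    Set.sdiff_self]

lemma measurableSet_silhouetteCone (hcomp : IsCompact K) (hconv : Convex ℝ K)
    (hint : (interior K).Nonempty) (p : Plane) : MeasurableSet (silhouetteCone K p) := by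
  by_cases hp : p ∈ K
  · rw [silhouetteCone_of_mem hconv hp]; exact MeasurableSet.empty
  · obtain ⟨x, y, hc⟩ := exists_isContact hconv hcomp hint hp
    obtain ⟨θ, l, hl, hxy⟩ := hc.exists_dir
    rw [hc.silhouetteCone_eq hconv hxy hl]
    exact (isCompact_tri _ _ _).measurableSet.diff (isCompact_cap hcomp _ _).measurableSet

/-- Comparison of a silhouette cone with the triangle over a fixed chord. -/
lemma le_integral_silhouetteCone (hcomp : IsCompact K) (hconv : Convex ℝ K)
    (hint : (interior K).Nonempty) {q : Plane} (hx : x ∈ K) (hy : y ∈ K)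
    (hxy : x - y = l • unitVecPerp θ) (hl : 0 < l)
    (hq : ⟪x, unitVec θ⟫_ℝ < ⟪q, unitVec θ⟫_ℝ) {f : Plane → ℝ} (hf : Continuous f)
    (hf0 : ∀ z ∈ convexHull ℝ (K ∪ {q}), 0 ≤ f z) :
    (∫ z in tri q x y, f z) - (∫ z in cap K θ ⟪x, unitVec θ⟫_ℝ, f z)
      ≤ ∫ z in silhouetteCone K q, f z := by
  have hD : 0 < cross (x - q) (y - q) := by
    rw [cross_apex hxy]; exact mul_pos hl (by linarith)
  set C := cap K θ ⟪x, unitVec θ⟫_ℝ with hC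
  have hCm := (isCompact_cap hcomp θ ⟪x, unitVec θ⟫_ℝ).measurableSet
  have hTm := (isCompact_tri q x y).measurableSet
  have hTi : IntegrableOn f (tri q x y) := hf.continuousOn.integrableOn_compact
    (isCompact_tri _ _ _)
  have hCi : IntegrableOn f C := hf.continuousOn.integrableOn_compact (isCompact_cap hcomp _ _)
  have hsub : tri q x y \ C ⊆ silhouetteCone K q := by
    rintro z ⟨h1, h2⟩
    exact ⟨tri_subset_hull hx hy h1, fun hk => h2 ⟨hk, tri_subset_halfPlane hD hxy hl h1⟩⟩
  have h1 : ∫ z in tri q x y \ C, f z ≤ ∫ z in silhouetteCone K q, f z := by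
    apply setIntegral_mono_set (integrableOn_silhouetteCone hcomp q hf)
    · filter_upwards [ae_restrict_mem (measurableSet_silhouetteCone hcomp hconv hint q)] with z hz
      exact hf0 z hz.1
    · exact hsub.eventuallyLE
  have h2 := integral_inter_add_sdiff (f := f) (s := tri q x y) hCm hTi
  have h3 : ∫ z in tri q x y ∩ C, f z ≤ ∫ z in C, f z := by
    apply setIntegral_mono_set hCi
    · filter_upwards [ae_restrict_mem hCm] with z hz
      exact hf0 z (subset_convexHull ℝ _ (Or.inl hz.1))
    · exact Set.inter_subset_right.eventuallyLE
  linarith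

end Dir
/-! ### Smooth convex bodies -/

/-- The outer normal direction of `K` at each boundary point is unique. -/
def HasUniqueNormals (K : Set Plane) : Prop :=
  ∀ x ∈ K, ∀ n m : Plane, n ≠ 0 → m ≠ 0 → (∀ q ∈ K, ⟪q, n⟫_ℝ ≤ ⟪x, n⟫_ℝ) →
    (∀ q ∈ K, ⟪q, m⟫_ℝ ≤ ⟪x, m⟫_ℝ) → ∃ c : ℝ, 0 < c ∧ m = c • n

lemma inner_lt_of_mem_interior {K : Set Plane} {x z n : Plane} (hz : z ∈ interior K) (hn : n ≠ 0)
    (h : ∀ q ∈ K, ⟪q, n⟫_ℝ ≤ ⟪x, n⟫_ℝ) : ⟪z, n⟫_ℝ < ⟪x, n⟫_ℝ := by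
  obtain ⟨k, hk, hlt⟩ := exists_inner_gt_of_mem_interior hz hn
  exact hlt.trans_le (h k hk)

lemma eq_smul_perp {v n : Plane} (hv : v ≠ 0) (h : ⟪v, n⟫_ℝ = 0) :
    ∃ a : ℝ, n = a • perp v := by
  have hvv : ⟪v, v⟫_ℝ ≠ 0 := (real_inner_self_pos.2 hv).ne'
  refine ⟨cross v n / ⟪v, v⟫_ℝ, ?_⟩
  apply plane_ext
  · simp only [PiLp.smul_apply, smul_eq_mul, perp, cross]
    field_simp
    simp only [inner_plane] at h ⊢
    simp
    linear_combination v 0 * h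
  · simp only [PiLp.smul_apply, smul_eq_mul, perp, cross]
    field_simp
    simp only [inner_plane] at h ⊢
    simp
    linear_combination v 1 * h

/-- At a boundary point `γ s` with outer normal `n` the function `⟪γ t, n⟫` is maximal at `s`, so
`n` is orthogonal to `γ' s ≠ 0`. Any two normals are thus multiples of one vector, and an interior
point shows that the factors have the same sign. -/
lemma HasC2Boundary.hasUniqueNormals {K : Set Plane} (hK : HasC2Boundary K)
    (hcl : IsClosed K) (hint : (interior K).Nonempty) : HasUniqueNormals K := by
  obtain ⟨γ, L, hL, hγ, hper, hreg, hinj, hrange⟩ := hK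
  intro x hx n m hn hm hxn hxm
  obtain ⟨z, hz⟩ := hint
  have hxf : x ∈ frontier K := by
    rw [hcl.frontier_eq]
    exact ⟨hx, fun hi => lt_irrefl _ (inner_lt_of_mem_interior hi hn hxn)⟩
  rw [← hrange] at hxf
  obtain ⟨s, rfl⟩ := hxf
  have hmem : ∀ s, γ s ∈ K := fun s => by
    have : γ s ∈ frontier K := hrange ▸ Set.mem_range_self s
    exact hcl.frontier_subset this
  have hd : HasDerivAt γ (deriv γ s) s :=
    (hγ.differentiable (by norm_num) s).hasDerivAt
  have horth : ∀ n : Plane, (∀ q ∈ K, ⟪q, n⟫_ℝ ≤ ⟪γ s, n⟫_ℝ) → ⟪deriv γ s, n⟫_ℝ = 0 := by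
    intro n h
    have h1 : HasDerivAt (fun t => ⟪γ t, n⟫_ℝ) (⟪γ s, (0 : Plane)⟫_ℝ + ⟪deriv γ s, n⟫_ℝ) s :=
      hd.inner ℝ (hasDerivAt_const s n)
    have h2 : IsLocalMax (fun t => ⟪γ t, n⟫_ℝ) s :=
      Filter.Eventually.of_forall fun t => h _ (hmem t)
    have := h2.hasDerivAt_eq_zero h1
    simpa using this
  obtain ⟨a, rfl⟩ := eq_smul_perp (hreg s) (horth n hxn)
  obtain ⟨b, rfl⟩ := eq_smul_perp (hreg s) (horth m hxm)
  have hzn := inner_lt_of_mem_interior hz hn hxn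
  have hzm := inner_lt_of_mem_interior hz hm hxm
  have ha : a ≠ 0 := by rintro rfl; simp at hn
  simp only [real_inner_smul_right] at hzn hzm
  refine ⟨b / a, ?_, by rw [smul_smul, div_mul_cancel₀ _ ha]⟩
  set A := ⟪z, perp (deriv γ s)⟫_ℝ
  set B := ⟪γ s, perp (deriv γ s)⟫_ℝ
  have h1 : 0 < a * (B - A) := by linarith
  have h2 : 0 < b * (B - A) := by linarith
  have h3 : B - A ≠ 0 := by rintro h; rw [h] at h1; simp at h1
  rw [show b / a = (b * (B - A)) / (a * (B - A)) by field_simp]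
  exact div_pos h2 h1

/-! ### The area of the silhouette cone -/

/-- The area of the silhouette cone with apex `p`. -/
def coneArea (K : Set Plane) (p : Plane) : ℝ := volume.real (silhouetteCone K p)

lemma mem_illuminationCurve_iff {K : Set Plane} (hcomp : IsCompact K) {d : ℝ} (hd : 0 < d)
    {p : Plane} : p ∈ illuminationCurve K d ↔ coneArea K p = d := by
  rw [coneArea, Measure.real, illuminationCurve, Set.mem_ofPred_eq]
  constructor
  · intro h; rw [h, ENNReal.toReal_ofReal hd.le]
  · intro h; rw [← h, ENNReal.ofReal_toReal (volume_silhouetteCone_ne_top hcomp p)]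

lemma coneArea_nonneg (K : Set Plane) (p : Plane) : 0 ≤ coneArea K p := measureReal_nonneg

lemma coneArea_of_mem {K : Set Plane} (hconv : Convex ℝ K) {p : Plane} (hp : p ∈ K) :
    coneArea K p = 0 := by
  rw [coneArea, silhouetteCone_of_mem hconv hp]; simp

section Area

variable {K : Set Plane} {p x y : Plane} {θ l : ℝ}

/-- For a fixed chord the left side is affine in the apex `q`, and it equals the cone area when the
chord joins contact points of `q` (`IsContact.coneArea_eq`). This makes it a supporting function. -/
lemma triangle_sub_cap_le_coneArea (hcomp : IsCompact K) (hconv : Convex ℝ K)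
    (hint : (interior K).Nonempty) (hx : x ∈ K) (hy : y ∈ K)
    (hxy : x - y = l • unitVecPerp θ) (hl : 0 < l) (q : Plane) :
    l / 2 * (⟪q, unitVec θ⟫_ℝ - ⟪x, unitVec θ⟫_ℝ) - volume.real (cap K θ ⟪x, unitVec θ⟫_ℝ)
      ≤ coneArea K q := by
  rcases lt_or_ge ⟪x, unitVec θ⟫_ℝ ⟪q, unitVec θ⟫_ℝ with h | h
  · have hD : 0 < cross (x - q) (y - q) := by
      rw [cross_apex hxy]; exact mul_pos hl (by linarith)
    have := le_integral_silhouetteCone hcomp hconv hint hx hy hxy hl h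
      (f := fun _ => 1) continuous_const (fun _ _ => zero_le_one)
    simp only [integral_const, smul_eq_mul, mul_one, measureReal_restrict_apply_univ,
      tri_volume hD] at this
    rw [cross_apex hxy] at this
    rw [coneArea]; linarith
  · have h1 := coneArea_nonneg K q
    have h2 : 0 ≤ volume.real (cap K θ ⟪x, unitVec θ⟫_ℝ) := measureReal_nonneg
    nlinarith

lemma IsContact.coneArea_eq (hc : IsContact K p x y) (hconv : Convex ℝ K)
    (hcomp : IsCompact K) (hxy : x - y = l • unitVecPerp θ) (hl : 0 < l) :
    coneArea K p = l / 2 * (⟪p, unitVec θ⟫_ℝ - ⟪x, unitVec θ⟫_ℝ)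
      - volume.real (cap K θ ⟪x, unitVec θ⟫_ℝ) := by
  rw [coneArea, hc.volume_silhouetteCone hconv hcomp hxy hl, cross_apex hxy]; ring

lemma IsContact.subgradient (hc : IsContact K p x y) (hconv : Convex ℝ K)
    (hcomp : IsCompact K) (hint : (interior K).Nonempty) (hxy : x - y = l • unitVecPerp θ)
    (hl : 0 < l) (q : Plane) :
    coneArea K p + l / 2 * (⟪q, unitVec θ⟫_ℝ - ⟪p, unitVec θ⟫_ℝ) ≤ coneArea K q := by
  have h1 := triangle_sub_cap_le_coneArea hcomp hconv hint hc.left_mem hc.right_mem hxy hl q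
  have h2 := hc.coneArea_eq hconv hcomp hxy hl
  linarith

lemma IsContact.subgradient_cross (hc : IsContact K p x y) (hconv : Convex ℝ K)
    (hcomp : IsCompact K) (hint : (interior K).Nonempty) (q : Plane) :
    coneArea K p + cross (q - p) (x - y) / 2 ≤ coneArea K q := by
  obtain ⟨θ, l, hl, hxy⟩ := hc.exists_dir
  have := hc.subgradient hconv hcomp hint hxy hl q
  rw [hxy, cross_smul_unitVecPerp, inner_sub_left]
  linarith

/-- Outside `K` the function has an affine minorant touching it at each point; on `K` it takes its
minimal value zero. -/
lemma convexOn_coneArea (hconv : Convex ℝ K) (hcomp : IsCompact K)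
    (hint : (interior K).Nonempty) : ConvexOn ℝ Set.univ (coneArea K) := by
  refine ⟨convex_univ, fun a _ b _ s t hs ht hst => ?_⟩
  simp only [smul_eq_mul]
  by_cases hz : s • a + t • b ∈ K
  · rw [coneArea_of_mem hconv hz]
    have := coneArea_nonneg K a
    have := coneArea_nonneg K b
    positivity
  · obtain ⟨x, y, hc⟩ := exists_isContact hconv hcomp hint hz
    obtain ⟨θ, l, hl, hxy⟩ := hc.exists_dir
    have h1 := hc.subgradient hconv hcomp hint hxy hl a
    have h2 := hc.subgradient hconv hcomp hint hxy hl b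
    simp only [inner_add_left, real_inner_smul_left] at h1 h2
    have h3 := mul_le_mul_of_nonneg_left h1 hs
    have h4 := mul_le_mul_of_nonneg_left h2 ht
    obtain rfl : t = 1 - s := by linarith
    nlinarith

lemma continuous_coneArea (hconv : Convex ℝ K) (hcomp : IsCompact K)
    (hint : (interior K).Nonempty) : Continuous (coneArea K) := by
  rw [← continuousOn_univ]
  exact (convexOn_coneArea hconv hcomp hint).continuousOn isOpen_univ

/-- Around an interior point `z` there is a chord of fixed length `ε` orthogonal to `q - z`. The
triangle over it with apex `q` has area `ε/2 * ‖q - z‖`, and at most the area of `K` is lost. -/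
lemma exists_bound_of_coneArea_le (hconv : Convex ℝ K) (hcomp : IsCompact K)
    (hint : (interior K).Nonempty) (d : ℝ) : ∃ R : ℝ, ∀ q, coneArea K q ≤ d → ‖q‖ ≤ R := by
  obtain ⟨z, hz⟩ := hint
  obtain ⟨ε, hε, hball⟩ := Metric.isOpen_iff.1 isOpen_interior z hz
  refine ⟨(d + volume.real K) / (ε / 2) + ‖z‖ + 1, fun q hq => ?_⟩
  have hA : 0 ≤ volume.real K := measureReal_nonneg
  have hd : 0 ≤ d := (coneArea_nonneg K q).trans hq
  by_cases hqz : q = z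
  · rw [hqz]
    have : 0 ≤ (d + volume.real K) / (ε / 2) := by positivity
    linarith
  have hv : q - z ≠ 0 := sub_ne_zero.2 hqz
  obtain ⟨θ, l, hl, hθ⟩ := exists_eq_smul_unitVecPerp (perp_ne_zero hv)
  have hl1 : ⟪q - z, unitVecPerp θ⟫_ℝ = 0 := by
    have : ⟪q - z, perp (q - z)⟫_ℝ = 0 := by rw [← cross_eq_inner, cross_same]
    rw [hθ, real_inner_smul_right] at this
    exact (mul_eq_zero.1 this).resolve_left hl.ne'
  have hl2 : 0 < ⟪q - z, unitVec θ⟫_ℝ := by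
    have h1 : cross (q - z) (perp (q - z)) = ⟪q - z, q - z⟫_ℝ := by
      rw [inner_plane, cross]; simp [perp]; ring
    rw [hθ, cross_smul_unitVecPerp] at h1
    have : 0 < l * ⟪q - z, unitVec θ⟫_ℝ := by rw [h1]; exact real_inner_self_pos.2 hv
    exact (pos_iff_pos_of_mul_pos this).1 hl
  have hnorm : ‖q - z‖ ≤ ⟪q - z, unitVec θ⟫_ℝ := by
    have := norm_le_frame θ (q - z)
    rwa [hl1, abs_zero, add_zero, abs_of_pos hl2] at this
  have hmem : ∀ s : ℝ, |s| ≤ ε / 2 → z + s • unitVecPerp θ ∈ K := fun s hs => by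
    apply interior_subset
    apply hball
    rw [Metric.mem_ball, dist_eq_norm, add_sub_cancel_left, norm_smul, norm_unitVecPerp, mul_one,
      Real.norm_eq_abs]
    linarith
  have h := triangle_sub_cap_le_coneArea hcomp hconv ⟨z, hz⟩
    (hmem (ε / 2) (by rw [abs_of_pos (by linarith)])) (hmem (-(ε / 2)) (by
      rw [abs_neg, abs_of_pos (by linarith)])) (l := ε) (θ := θ) (by module) hε q
  have hcap : volume.real (cap K θ ⟪z + (ε / 2) • unitVecPerp θ, unitVec θ⟫_ℝ)
      ≤ volume.real K := measureReal_mono Set.inter_subset_left hcomp.measure_lt_top.ne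
  have hu : ⟪z + (ε / 2) • unitVecPerp θ, unitVec θ⟫_ℝ = ⟪z, unitVec θ⟫_ℝ := by
    rw [inner_add_left, real_inner_smul_left]; simp
  rw [hu] at h hcap
  rw [inner_sub_left] at hnorm
  have h5 : ‖q - z‖ ≤ (d + volume.real K) / (ε / 2) := by
    rw [le_div_iff₀ (by positivity)]
    nlinarith
  have h6 : ‖q‖ ≤ ‖q - z‖ + ‖z‖ := by
    calc ‖q‖ = ‖(q - z) + z‖ := by rw [sub_add_cancel]
      _ ≤ _ := norm_add_le _ _
  linarith

lemma isCompact_coneArea_le (hconv : Convex ℝ K) (hcomp : IsCompact K)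
    (hint : (interior K).Nonempty) (d : ℝ) : IsCompact {q | coneArea K q ≤ d} := by
  obtain ⟨R, hR⟩ := exists_bound_of_coneArea_le hconv hcomp hint d
  refine Metric.isCompact_of_isClosed_isBounded
    (isClosed_le (continuous_coneArea hconv hcomp hint) continuous_const) ?_
  refine (Metric.isBounded_closedBall (x := (0 : Plane)) (r := R)).subset fun q hq => ?_
  rw [mem_closedBall_zero_iff]
  exact hR q hq

/-- A point on a segment, near a point outside of a closed set. -/
lemma exists_mem_segment_below (hcl : IsClosed K) {k q : Plane} (hk : ⟪k, unitVec θ⟫_ℝ < l)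
    (hq : l < ⟪q, unitVec θ⟫_ℝ)
    (hz : ∀ a b : ℝ, 0 < a → 0 < b → a + b = 1 → ⟪a • k + b • q, unitVec θ⟫_ℝ = l →
      a • k + b • q ∉ K) :
    ∃ w ∈ segment ℝ k q, ⟪w, unitVec θ⟫_ℝ < l ∧ w ∉ K := by
  set u := ⟪k, unitVec θ⟫_ℝ
  set v := ⟪q, unitVec θ⟫_ℝ
  set b0 := (l - u) / (v - u) with hb0
  have hb : 0 < b0 := div_pos (by linarith) (by linarith)
  have hb1 : b0 < 1 := by rw [hb0, div_lt_one (by linarith)]; linarith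
  have hh : ∀ b : ℝ, ⟪(1 - b) • k + b • q, unitVec θ⟫_ℝ = (1 - b) * u + b * v := fun b => by
    rw [inner_add_left, real_inner_smul_left, real_inner_smul_left]
  have hz0 := hz (1 - b0) b0 (by linarith) hb (by ring) (by
    rw [hh, hb0]; have : v - u ≠ 0 := by linarith
    field_simp; ring)
  have hcont : Continuous fun b : ℝ => (1 - b) • k + b • q := by fun_prop
  have hev : ∀ᶠ b in 𝓝[<] b0, (1 - b) • k + b • q ∈ Kᶜ ∧ 0 < b ∧ b < b0 := by
    refine ((hcont.tendsto b0).eventually (hcl.isOpen_compl.mem_nhds hz0)).filter_mono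
      nhdsWithin_le_nhds |>.and ?_
    exact ((lt_mem_nhds hb).filter_mono nhdsWithin_le_nhds).and self_mem_nhdsWithin
  obtain ⟨b, h1, h2, h3⟩ := hev.exists
  refine ⟨_, ⟨1 - b, b, by linarith, h2.le, by ring, rfl⟩, ?_, h1⟩
  rw [hh]
  have : b0 * (v - u) = l - u := by rw [hb0]; field_simp [show v - u ≠ 0 by linarith]
  nlinarith

/-- Moving the apex parallel to the chord keeps the area of the triangle over it. But normals are
unique, so one of the lines from `q` through `x` or `y` is no longer tangent and cuts into `K`. The
hull of `K` and `q` then has an additional open piece outside `K` and below the chord. -/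
lemma IsContact.coneArea_lt_of_height_eq (hc : IsContact K p x y) (hK : HasUniqueNormals K)
    (hconv : Convex ℝ K) (hcomp : IsCompact K) (hint : (interior K).Nonempty)
    (hxy : x - y = l • unitVecPerp θ) (hl : 0 < l) {q : Plane}
    (hq : ⟪q, unitVec θ⟫_ℝ = ⟪p, unitVec θ⟫_ℝ) (hne : q ≠ p) : coneArea K p < coneArea K q := by
  set t := ⟪x, unitVec θ⟫_ℝ with ht
  set a := ⟪p, unitVec θ⟫_ℝ with ha
  have hta : t < a := hc.height_lt hxy hl
  have hyt : ⟪y, unitVec θ⟫_ℝ = t := height_eq_of_dir hxy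
  set σ := ⟪q - p, unitVecPerp θ⟫_ℝ with hσ
  have hσ0 : σ ≠ 0 := by
    intro h
    apply hne
    apply frame_ext θ hq
    rw [hσ, inner_sub_left] at h
    linarith
  have hxq : ∀ k, cross (x - q) (k - q) = cross (x - p) (k - p)
      + σ * (⟪k, unitVec θ⟫_ℝ - t) := by
    intro k
    rw [cross_frame θ, cross_frame θ, hσ]
    simp only [inner_sub_left, hq]
    rw [← ha, ← ht]; ring
  have hyq : ∀ k, cross (k - q) (y - q) = cross (k - p) (y - p)
      - σ * (⟪k, unitVec θ⟫_ℝ - t) := by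
    intro k
    rw [cross_frame θ, cross_frame θ, hσ]
    simp only [inner_sub_left, hq, hyt]
    rw [← ha]; ring
  have hside : ∀ k ∈ K, 0 ≤ cross (x - p) (k - p) ∧ 0 ≤ cross (k - p) (y - p) := fun k hk =>
    ⟨hc.left_nonneg k hk, by rw [cross_swap]; linarith [hc.right_nonpos k hk]⟩
  have hparallel : ∀ z : Plane, ⟪z, unitVec θ⟫_ℝ = t → ∀ c : ℝ,
      perp (z - q) = c • perp (z - p) → False := by
    intro z hz c h
    have h' : z - q = c • (z - p) := by
      have h0 := congrArg (fun w : Plane => w 0) h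
      have h1 := congrArg (fun w : Plane => w 1) h
      simp [perp] at h0 h1
      apply plane_ext <;> simp <;> linarith
    have h1 := congrArg (fun w => ⟪w, unitVec θ⟫_ℝ) h'
    simp only [real_inner_smul_left, inner_sub_left, hz, hq, ← ha] at h1
    have hc1 : c = 1 := by
      have : (c - 1) * (t - a) = 0 := by linarith
      rcases mul_eq_zero.1 this with h | h <;> linarith
    rw [hc1, one_smul] at h'
    exact hne (sub_right_injective h')
  have hnz : ∀ z q : Plane, ⟪z, unitVec θ⟫_ℝ = t → ⟪q, unitVec θ⟫_ℝ = a → perp (z - q) ≠ 0 := by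
    intro z q hz hq
    apply perp_ne_zero
    rw [sub_ne_zero]
    rintro rfl
    linarith
  -- If the apex moves towards the side of `y`, the supporting condition fails at `y`, otherwise at
  -- `x`. A point `k` of `K` violating it lies below the chord, and the segment from `k` to `q`
  -- crosses the chord level outside `K`; slightly below this crossing it is still outside.
  obtain ⟨w, hwseg, hwt, hwK⟩ : ∃ w ∈ convexHull ℝ (K ∪ {q}), ⟪w, unitVec θ⟫_ℝ < t ∧ w ∉ K := by
    have hseg : ∀ k ∈ K, segment ℝ k q ⊆ convexHull ℝ (K ∪ {q}) := fun k hk =>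
      (convex_convexHull ℝ _).segment_subset (subset_convexHull ℝ _ (Or.inl hk))
        (subset_convexHull ℝ _ (Or.inr rfl))
    rcases lt_or_gt_of_ne hσ0 with hneg | hpos
    · obtain ⟨k, hk, hlt⟩ : ∃ k ∈ K, cross (k - q) (y - q) < 0 := by
        by_contra! hcon
        obtain ⟨c, -, hcc⟩ := hK y hc.right_mem (perp (y - p)) (perp (y - q))
          (hnz _ _ hyt ha.symm) (hnz _ _ hyt hq) (fun k hk => by
            have := (hside k hk).2
            rw [cross_swap, cross_eq_inner, inner_sub_left] at this
            have h2 : cross (y - p) (y - p) = 0 := cross_same _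
            rw [cross_eq_inner, inner_sub_left] at h2
            linarith) (fun k hk => by
            have := hcon k hk
            rw [cross_swap, cross_eq_inner, inner_sub_left] at this
            have h2 : cross (y - q) (y - q) = 0 := cross_same _
            rw [cross_eq_inner, inner_sub_left] at h2
            linarith)
        exact hparallel y hyt c hcc
      have hkt : ⟪k, unitVec θ⟫_ℝ < t := by
        by_contra! hcon
        rw [hyq] at hlt
        nlinarith [(hside k hk).2]
      obtain ⟨w, hw, h1, h2⟩ := exists_mem_segment_below hcomp.isClosed hkt (hq ▸ hta) (q := q) (by
        intro s r hs hr hsr hzt hzK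
        have h1 := hyq (s • k + r • q)
        rw [hzt, sub_self, mul_zero, sub_zero] at h1
        have h2 := (hside _ hzK).2
        rw [← h1] at h2
        obtain rfl : r = 1 - s := by linarith
        have : cross (s • k + (1 - s) • q - q) (y - q) = s * cross (k - q) (y - q) := by
          simp [cross]; ring
        rw [this] at h2
        nlinarith)
      exact ⟨w, hseg k hk hw, h1, h2⟩
    · obtain ⟨k, hk, hlt⟩ : ∃ k ∈ K, cross (x - q) (k - q) < 0 := by
        by_contra! hcon
        obtain ⟨c, -, hcc⟩ := hK x hc.left_mem (-perp (x - p)) (-perp (x - q))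
          (neg_ne_zero.2 (hnz _ _ rfl ha.symm)) (neg_ne_zero.2 (hnz _ _ rfl hq)) (fun k hk => by
            have := (hside k hk).1
            rw [cross_eq_inner, inner_sub_left] at this
            have h2 : cross (x - p) (x - p) = 0 := cross_same _
            rw [cross_eq_inner, inner_sub_left] at h2
            rw [inner_neg_right, inner_neg_right]
            linarith) (fun k hk => by
            have := hcon k hk
            rw [cross_eq_inner, inner_sub_left] at this
            have h2 : cross (x - q) (x - q) = 0 := cross_same _
            rw [cross_eq_inner, inner_sub_left] at h2
            rw [inner_neg_right, inner_neg_right]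
            linarith)
        rw [smul_neg, neg_inj] at hcc
        exact hparallel x rfl c hcc
      have hkt : ⟪k, unitVec θ⟫_ℝ < t := by
        by_contra! hcon
        rw [hxq] at hlt
        nlinarith [(hside k hk).1]
      obtain ⟨w, hw, h1, h2⟩ := exists_mem_segment_below hcomp.isClosed hkt (hq ▸ hta) (q := q) (by
        intro s r hs hr hsr hzt hzK
        have h1 := hxq (s • k + r • q)
        rw [hzt, sub_self, mul_zero, add_zero] at h1
        have h2 := (hside _ hzK).1
        rw [← h1] at h2
        obtain rfl : r = 1 - s := by linarith
        have : cross (x - q) (s • k + (1 - s) • q - q) = s * cross (x - q) (k - q) := by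
          simp [cross]; ring
        rw [this] at h2
        nlinarith)
      exact ⟨w, hseg k hk hw, h1, h2⟩
  have hopen : IsOpen ({z | ⟪z, unitVec θ⟫_ℝ < t} ∩ Kᶜ) :=
    (isOpen_lt (by fun_prop) continuous_const).inter hcomp.isClosed.isOpen_compl
  set H := convexHull ℝ (K ∪ {q}) with hH
  have hHc : Convex ℝ H := convex_convexHull ℝ _
  have hKH : K ⊆ H := Set.subset_union_left.trans (subset_convexHull ℝ _)
  have hHint : (interior H).Nonempty := hint.mono (interior_mono hKH)
  -- A single point `w` contributes no area. As the convex set `H` lies in the closure of its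
  -- interior, an open neighbourhood of `w` outside `K` meets the interior of `H` in a nonempty open
  -- set.
  have hwcl : w ∈ closure (interior H) := by
    rw [hHc.closure_interior_eq_closure_of_nonempty_interior hHint]
    exact subset_closure hwseg
  set N := ({z | ⟪z, unitVec θ⟫_ℝ < t} ∩ Kᶜ) ∩ interior H with hN
  have hNne : N.Nonempty := mem_closure_iff.1 hwcl _ hopen ⟨hwt, hwK⟩
  have hNo : IsOpen N := hopen.inter isOpen_interior
  have hNpos : 0 < volume N := hNo.measure_pos volume hNne
  have hD : 0 < cross (x - q) (y - q) := by
    rw [cross_apex hxy, hq]; exact mul_pos hl (by linarith)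
  set C := cap K θ t with hC
  have hCm : MeasurableSet C := (isCompact_cap hcomp θ t).measurableSet
  have hTm := (isCompact_tri q x y).measurableSet
  have hNsub : N ⊆ silhouetteCone K q := fun z hz => ⟨interior_subset hz.2, hz.1.2⟩
  have hTsub : tri q x y \ C ⊆ silhouetteCone K q := by
    rintro z ⟨h1, h2⟩
    exact ⟨tri_subset_hull hc.left_mem hc.right_mem h1,
      fun hk => h2 ⟨hk, tri_subset_halfPlane hD hxy hl h1⟩⟩
  have hdisj : Disjoint (tri q x y \ C) N := by
    rw [Set.disjoint_left]
    rintro z ⟨h1, -⟩ h2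
    have h3 := tri_subset_halfPlane hD hxy hl h1
    have h4 : ⟪z, unitVec θ⟫_ℝ < t := h2.1.1
    exact absurd h3 (not_le.2 h4)
  have hfin := volume_silhouetteCone_ne_top hcomp q
  have hTfin : volume (tri q x y) ≠ ⊤ := (isCompact_tri q x y).measure_lt_top.ne
  have h1 : volume.real (tri q x y \ C) + volume.real N ≤ coneArea K q := by
    rw [← measureReal_union hdisj hNo.measurableSet
      (measure_ne_top_of_subset Set.sdiff_subset hTfin) (measure_ne_top_of_subset hNsub hfin)]
    exact measureReal_mono (Set.union_subset hTsub hNsub) hfin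
  have h2 : 0 < volume.real N :=
    ENNReal.toReal_pos hNpos.ne' (measure_ne_top_of_subset hNsub hfin)
  have h3 : volume.real (tri q x y) ≤ volume.real (tri q x y \ C) + volume.real C := by
    have hCf : volume C ≠ ⊤ := (isCompact_cap hcomp θ t).measure_lt_top.ne
    have := measureReal_union_le (μ := volume) (tri q x y \ C) C
    refine le_trans (measureReal_mono ?_ ?_) this
    · intro z hz; by_cases h : z ∈ C
      · exact Or.inr h
      · exact Or.inl ⟨hz, h⟩
    · exact measure_union_ne_top (measure_ne_top_of_subset Set.sdiff_subset hTfin) hCf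
  have h4 := hc.coneArea_eq hconv hcomp hxy hl
  rw [tri_volume hD, cross_apex hxy, hq] at h3
  linarith

/-- A point of the illumination curve is the unique highest point of the curve in the direction
normal to its polar chord. -/
lemma IsContact.height_lt_of_ne (hc : IsContact K p x y) (hK : HasUniqueNormals K)
    (hconv : Convex ℝ K) (hcomp : IsCompact K) (hint : (interior K).Nonempty)
    (hxy : x - y = l • unitVecPerp θ) (hl : 0 < l) {q : Plane}
    (hq : coneArea K q ≤ coneArea K p) (hne : q ≠ p) :
    ⟪q, unitVec θ⟫_ℝ < ⟪p, unitVec θ⟫_ℝ := by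
  have h1 := hc.subgradient hconv hcomp hint hxy hl q
  rcases lt_trichotomy ⟪q, unitVec θ⟫_ℝ ⟪p, unitVec θ⟫_ℝ with h | h | h
  · exact h
  · exact absurd (hc.coneArea_lt_of_height_eq hK hconv hcomp hint hxy hl h hne) (not_lt.2 hq)
  · nlinarith

end Area
/-! ### First moments of silhouette cones -/

section Moment

variable {K : Set Plane} {p x y : Plane} {θ l : ℝ}

lemma continuous_framePt_right (θ u : ℝ) : Continuous fun s => framePt θ u s :=
  (continuous_framePt θ).comp (Continuous.prodMk_right u)

lemma isCompact_slice {C : Set Plane} (hC : IsCompact C) (θ u : ℝ) : IsCompact (slice θ C u) := by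
  obtain ⟨R, hR⟩ := hC.isBounded.exists_norm_le
  refine Metric.isCompact_of_isClosed_isBounded
    (hC.isClosed.preimage (continuous_framePt_right θ u)) ?_
  refine (Metric.isBounded_closedBall (x := (0 : ℝ)) (r := R)).subset fun s hs => ?_
  rw [mem_closedBall_zero_iff, Real.norm_eq_abs]
  have := abs_inner_unitVecPerp_le θ (framePt θ u s)
  rw [inner_framePt_unitVecPerp] at this
  exact this.trans (hR _ hs)

lemma framePt_combo (θ u s u' s' a b : ℝ) :
    a • framePt θ u s + b • framePt θ u' s' = framePt θ (a * u + b * u') (a * s + b * s') := by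
  unfold framePt; module

lemma convex_slice {C : Set Plane} (hC : Convex ℝ C) (θ u : ℝ) : Convex ℝ (slice θ C u) := by
  intro s hs s' hs' a b ha hb hab
  have := hC hs hs' ha hb hab
  rw [framePt_combo, ← add_mul, hab, one_mul] at this
  exact this

lemma exists_slice_eq_Icc {C : Set Plane} (hC : IsCompact C) (hconv : Convex ℝ C) (θ u : ℝ)
    (hne : (slice θ C u).Nonempty) : ∃ a b, a ≤ b ∧ slice θ C u = Set.Icc a b := by
  have h1 := isCompact_slice hC θ u
  have h2 : IsConnected (slice θ C u) := ⟨hne, (convex_slice hconv θ u).isPreconnected⟩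
  have h3 := eq_Icc_of_connected_compact h2 h1
  refine ⟨_, _, ?_, h3⟩
  rw [h3] at hne
  exact Set.nonempty_Icc.1 hne

/-- Integrals of functions of the height, by slices. -/
lemma integral_height {C : Set Plane} (hC : IsCompact C) (θ : ℝ) {φ : ℝ → ℝ}
    (hφ : Continuous φ) :
    Integrable (fun u => φ u * volume.real (slice θ C u)) ∧
    ∫ q in C, φ ⟪q, unitVec θ⟫_ℝ = ∫ u, φ u * volume.real (slice θ C u) := by
  have hint : IntegrableOn (fun q : Plane => φ ⟪q, unitVec θ⟫_ℝ) C :=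
    (hφ.comp (by fun_prop)).continuousOn.integrableOn_compact hC
  have h1 := integral_frame θ hC.measurableSet hint
  have h2 : ∀ u, ∫ s in slice θ C u, φ ⟪framePt θ u s, unitVec θ⟫_ℝ
      = φ u * volume.real (slice θ C u) := fun u => by
    simp [mul_comm]
  refine ⟨?_, by rw [h1]; simp only [h2]⟩
  have hm := measurePreserving_framePt θ
  have he := framePt_measurableEmbedding θ
  have h3 := ((hm.integrable_comp_emb he).2 ((integrable_indicator_iff hC.measurableSet).2 hint))
  rw [Measure.volume_eq_prod] at h3
  refine h3.integral_prod_left.congr (Filter.Eventually.of_forall fun u => ?_)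
  simp only [Function.comp]
  rw [← h2 u, ← integral_indicator (isCompact_slice hC θ u).measurableSet]
  rfl

lemma isCompact_hull (hconv : Convex ℝ K) (hcomp : IsCompact K) (hint : (interior K).Nonempty)
    (p : Plane) : IsCompact (convexHull ℝ (K ∪ {p})) := by
  by_cases hp : p ∈ K
  · rwa [Set.union_singleton, Set.insert_eq_of_mem hp, hconv.convexHull_eq]
  · obtain ⟨x, y, hc⟩ := exists_isContact hconv hcomp hint hp
    rw [hc.convex_union hconv]
    exact hcomp.union (isCompact_tri _ _ _)

lemma integral_hull (hconv : Convex ℝ K) (hcomp : IsCompact K) (hint : (interior K).Nonempty)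
    (p : Plane) {f : Plane → ℝ} (hf : Continuous f) :
    ∫ q in convexHull ℝ (K ∪ {p}), f q = (∫ q in K, f q) + ∫ q in silhouetteCone K p, f q := by
  have hi : IntegrableOn f (convexHull ℝ (K ∪ {p})) :=
    hf.continuousOn.integrableOn_compact (isCompact_hull hconv hcomp hint p)
  have h := integral_inter_add_sdiff hcomp.measurableSet hi
  rw [← h, Set.inter_eq_right.2 (Set.subset_union_left.trans (subset_convexHull ℝ _))]
  rfl

lemma volume_slice_tri (h : 0 < cross (x - p) (y - p)) (hxy : x - y = l • unitVecPerp θ)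
    (hl : 0 < l) {u : ℝ} (hu : u ∈ Set.Icc ⟪x, unitVec θ⟫_ℝ ⟪p, unitVec θ⟫_ℝ) :
    volume.real (slice θ (tri p x y) u)
      = l * ((⟪p, unitVec θ⟫_ℝ - u) / (⟪p, unitVec θ⟫_ℝ - ⟪x, unitVec θ⟫_ℝ)) := by
  obtain ⟨hd, -, hs⟩ := slice_tri h hxy hl
  have h0 : 0 ≤ (⟪p, unitVec θ⟫_ℝ - u) / (⟪p, unitVec θ⟫_ℝ - ⟪x, unitVec θ⟫_ℝ) :=
    div_nonneg (by linarith [hu.2]) hd.le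
  have hw := width_eq_of_dir hxy
  rw [hs, if_pos hu, Real.volume_real_Icc_of_le, hw]
  · ring
  · rw [hw]; nlinarith

/-- Compare the widths `wP`, `wQ` of the horizontal slices of the hulls `P`, `Q` of `K` with `p` and
`q`. Below the chord `wP ≤ wQ`. Above it `wP` decreases affinely to zero at `p`, while slices of the
convex set `Q` are at least interpolated and end strictly below `p`. So `wQ - wP` changes sign once,
from plus to minus, at some level `us`, and `∫ (u - us) (wQ - wP) < 0`. Since the areas agree, this
orders the first moments. -/
lemma IsContact.moment_lt (hc : IsContact K p x y) (hconv : Convex ℝ K) (hcomp : IsCompact K)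
    (hint : (interior K).Nonempty) (hxy : x - y = l • unitVecPerp θ) (hl : 0 < l)
    (hpos : 0 < coneArea K p) {q : Plane} (hq : coneArea K q = coneArea K p)
    (hlt : ⟪q, unitVec θ⟫_ℝ < ⟪p, unitVec θ⟫_ℝ) :
    ∫ z in silhouetteCone K q, ⟪z, unitVec θ⟫_ℝ < ∫ z in silhouetteCone K p, ⟪z, unitVec θ⟫_ℝ := by
  set t := ⟪x, unitVec θ⟫_ℝ with ht
  set a := ⟪p, unitVec θ⟫_ℝ with ha
  have hta : t < a := hc.height_lt hxy hl
  set P := convexHull ℝ (K ∪ {p}) with hP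
  set Q := convexHull ℝ (K ∪ {q}) with hQ
  have hPc : IsCompact P := isCompact_hull hconv hcomp hint p
  have hQc : IsCompact Q := isCompact_hull hconv hcomp hint q
  have hQconv : Convex ℝ Q := convex_convexHull ℝ _
  have hKQ : K ⊆ Q := Set.subset_union_left.trans (subset_convexHull ℝ _)
  -- the top of `Q`
  obtain ⟨k0, hk0, hk0max⟩ := hcomp.exists_isMaxOn (hint.mono interior_subset)
    (by fun_prop : ContinuousOn (fun k : Plane => ⟪k, unitVec θ⟫_ℝ) K)
  -- The cone area vanishes on `K`, so the subgradient inequality at `p` puts all of `K` strictly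
  -- below `p`.
  have hk0a : ⟪k0, unitVec θ⟫_ℝ < a := by
    have h := hc.subgradient hconv hcomp hint hxy hl k0
    rw [coneArea_of_mem hconv hk0] at h
    by_contra! hcon
    have : 0 ≤ l / 2 * (⟪k0, unitVec θ⟫_ℝ - a) := by
      apply mul_nonneg <;> linarith
    linarith
  set τ := max ⟪q, unitVec θ⟫_ℝ ⟪k0, unitVec θ⟫_ℝ with hτ
  have hτa : τ < a := max_lt hlt hk0a
  have htτ : t ≤ τ := (isMaxOn_iff.1 hk0max x hc.left_mem).trans (le_max_right _ _)
  have hQτ : Q ⊆ {z | ⟪z, unitVec θ⟫_ℝ ≤ τ} := by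
    apply convexHull_min
    · rintro z (hz | hz)
      · exact (isMaxOn_iff.1 hk0max z hz).trans (le_max_right _ _)
      · rw [Set.mem_singleton_iff.1 hz, Set.mem_ofPred_eq]
        exact le_max_left _ _
    · exact convex_halfSpace_le ⟨fun a b => inner_add_left a b _,
        fun c a => real_inner_smul_left a _ c⟩ _
  have hPa : P ⊆ {z | ⟪z, unitVec θ⟫_ℝ ≤ a} := by
    apply convexHull_min
    · rintro z (hz | hz)
      · exact (isMaxOn_iff.1 hk0max z hz).trans hk0a.le
      · rw [Set.mem_singleton_iff.1 hz, Set.mem_ofPred_eq]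
    · exact convex_halfSpace_le ⟨fun a b => inner_add_left a b _,
        fun c a => real_inner_smul_left a _ c⟩ _
  set wP : ℝ → ℝ := fun u => volume.real (slice θ P u) with hwP
  set wQ : ℝ → ℝ := fun u => volume.real (slice θ Q u) with hwQ
  have hPeq : P = K ∪ tri p x y := hc.convex_union hconv
  have hwPt : ∀ u ∈ Set.Icc t a, wP u = l * ((a - u) / (a - t)) := by
    intro u hu
    rw [hwP, ← volume_slice_tri hc.pos hxy hl hu]
    change volume.real (slice θ P u) = volume.real (slice θ (tri p x y) u)
    congr 1
    ext s
    simp only [slice, Set.mem_ofPred_eq, hPeq]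
    constructor
    · rintro (h | h)
      · exact hc.cap_subset hxy hl ⟨h, by
          rw [Set.mem_ofPred_eq, inner_framePt_unitVec]; exact hu.1⟩
      · exact h
    · exact Or.inr
  have hwPbelow : ∀ u, u < t → wP u ≤ wQ u := by
    intro u hu
    apply measureReal_mono _ (isCompact_slice hQc θ u).measure_lt_top.ne
    intro s hs
    have hs' : framePt θ u s ∈ K ∪ tri p x y := hPeq ▸ hs
    rcases hs' with h | h
    · exact hKQ h
    · have h3 := tri_subset_halfPlane hc.pos hxy hl h
      rw [Set.mem_ofPred_eq, inner_framePt_unitVec] at h3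
      exact absurd h3 (not_le.2 hu)
  have hwQ0 : ∀ u, τ < u → wQ u = 0 := by
    intro u hu
    have : slice θ Q u = ∅ := by
      ext s
      simp only [Set.mem_empty_iff_false, iff_false]
      intro hs
      have := hQτ hs
      rw [Set.mem_ofPred_eq, inner_framePt_unitVec] at this
      linarith
    simp [hwQ, this]
  have hwPnn : ∀ u, 0 ≤ wP u := fun u => measureReal_nonneg
  have hwP0 : ∀ u, a < u → wP u = 0 := by
    intro u hu
    have : slice θ P u = ∅ := by
      ext s
      simp only [Set.mem_empty_iff_false, iff_false]
      intro hs
      have := hPa hs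
      rw [Set.mem_ofPred_eq, inner_framePt_unitVec] at this
      linarith
    simp [hwP, this]
  -- `Q` contains the trapezoid spanned by the chord and its slice at `u1`. Its width is affine
  -- between the two levels, as is `wP`, so comparing at the two ends suffices.
  have hcross : ∀ u1 ∈ Set.Icc t τ, wP u1 ≤ wQ u1 → ∀ u ∈ Set.Icc t u1, wP u ≤ wQ u := by
    intro u1 hu1 h1 u hu
    have hw1 := hwPt u1 ⟨hu1.1, hu1.2.trans hτa.le⟩
    have hw1pos : 0 < wP u1 := by
      rw [hw1]; exact mul_pos hl (div_pos (by linarith [hu1.2]) (by linarith))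
    have hne : (slice θ Q u1).Nonempty := by
      rw [Set.nonempty_iff_ne_empty]
      intro h
      have : wQ u1 = 0 := by simp [hwQ, h]
      linarith
    obtain ⟨c, d, hcd, hIcc⟩ := exists_slice_eq_Icc hQc hQconv θ u1 hne
    have hwQ1 : wQ u1 = d - c := by
      rw [hwQ]; simp only [hIcc]; rw [Real.volume_real_Icc_of_le hcd]
    rcases eq_or_lt_of_le hu.1 with rfl | hut
    · -- base
      rw [hwPt t ⟨le_rfl, hta.le⟩, div_self (by linarith), mul_one]
      have hsub : Set.Icc ⟪y, unitVecPerp θ⟫_ℝ ⟪x, unitVecPerp θ⟫_ℝ ⊆ slice θ Q t := by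
        have hx : ⟪x, unitVecPerp θ⟫_ℝ ∈ slice θ Q t := by
          rw [slice, Set.mem_ofPred_eq, ht, framePt_inner]; exact hKQ hc.left_mem
        have hy : ⟪y, unitVecPerp θ⟫_ℝ ∈ slice θ Q t := by
          rw [slice, Set.mem_ofPred_eq, ht, ← height_eq_of_dir hxy, framePt_inner]
          exact hKQ hc.right_mem
        exact (convex_slice hQconv θ t).ordConnected.out hy hx
      have := measureReal_mono (μ := volume) hsub (isCompact_slice hQc θ t).measure_lt_top.ne
      have hw := width_eq_of_dir hxy
      rwa [Real.volume_real_Icc_of_le (by linarith), hw, sub_sub_cancel] at this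
    have htu1 : t < u1 := hut.trans_le hu.2
    set lam := (u - t) / (u1 - t) with hlam
    have hlam0 : 0 ≤ lam := div_nonneg (by linarith) (by linarith)
    have hlam1 : lam ≤ 1 := by rw [hlam, div_le_one (by linarith)]; linarith [hu.2]
    have hu_eq : (1 - lam) * t + lam * u1 = u := by
      rw [hlam]; field_simp [show u1 - t ≠ 0 by linarith]; ring
    have hmem : ∀ s0 s1, framePt θ t s0 ∈ Q → s1 ∈ Set.Icc c d →
        (1 - lam) * s0 + lam * s1 ∈ slice θ Q u := by
      intro s0 s1 h0 h1
      rw [← hIcc] at h1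
      have := hQconv h0 h1 (sub_nonneg.2 hlam1) hlam0 (by ring)
      rw [framePt_combo, hu_eq] at this
      exact this
    have hx := hmem ⟪x, unitVecPerp θ⟫_ℝ d (by rw [ht, framePt_inner]; exact hKQ hc.left_mem)
      ⟨hcd, le_rfl⟩
    have hy := hmem ⟪y, unitVecPerp θ⟫_ℝ c (by
      rw [ht, ← height_eq_of_dir hxy, framePt_inner]; exact hKQ hc.right_mem) ⟨le_rfl, hcd⟩
    have hsub := (convex_slice hQconv θ u).ordConnected.out hy hx
    have hm := measureReal_mono (μ := volume) hsub (isCompact_slice hQc θ u).measure_lt_top.ne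
    have hw := width_eq_of_dir hxy
    rw [Real.volume_real_Icc_of_le (by rw [hw]; nlinarith), hw] at hm
    have h2 := hwPt u ⟨hu.1, hu.2.trans (hu1.2.trans hτa.le)⟩
    have h3 : wP u = (1 - lam) * l + lam * wP u1 := by
      rw [h2, hw1]
      have : a - t ≠ 0 := by linarith
      rw [← hu_eq]; field_simp; ring
    have h4 := mul_le_mul_of_nonneg_left h1 hlam0
    rw [hwQ1] at h4
    have h5 : (1 - lam) * ⟪x, unitVecPerp θ⟫_ℝ + lam * d
        - ((1 - lam) * (⟪x, unitVecPerp θ⟫_ℝ - l) + lam * c) = (1 - lam) * l + lam * (d - c) := by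
      ring
    rw [h5] at hm
    change wP u ≤ wQ u
    linarith
  -- the crossing level
  set S := {u ∈ Set.Icc t τ | wP u ≤ wQ u} ∪ {t} with hS
  have hSbdd : BddAbove S := ⟨τ, by rintro u (hu | rfl); exacts [hu.1.2, htτ]⟩
  set us := sSup S with hus
  have hust : t ≤ us := le_csSup hSbdd (Or.inr rfl)
  have husτ : us ≤ τ := csSup_le ⟨t, Or.inr rfl⟩ (by rintro u (hu | rfl); exacts [hu.1.2, htτ])
  have hsign : ∀ u, (u - us) * (wQ u - wP u) ≤ 0 := by
    intro u
    rcases lt_trichotomy u us with h | h | h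
    · have hPQ : wP u ≤ wQ u := by
        rcases lt_or_ge u t with hut | hut
        · exact hwPbelow u hut
        · obtain ⟨u1, hu1, hlt1⟩ := exists_lt_of_lt_csSup ⟨t, Or.inr rfl⟩ h
          rcases hu1 with hu1 | rfl
          · exact hcross u1 hu1.1 hu1.2 u ⟨hut, hlt1.le⟩
          · exact absurd hlt1 (not_lt.2 hut)
      exact mul_nonpos_of_nonpos_of_nonneg (by linarith) (by linarith)
    · rw [h, sub_self, zero_mul]
    · have hPQ : wQ u ≤ wP u := by
        rcases le_or_gt u τ with huτ | huτ
        · by_contra! hcon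
          exact absurd (le_csSup hSbdd (Or.inl ⟨⟨hust.trans h.le, huτ⟩, hcon.le⟩)) (not_le.2 h)
        · rw [hwQ0 u huτ]; exact hwPnn u
      exact mul_nonpos_of_nonneg_of_nonpos (by linarith) (by linarith)
  -- Strictness comes from the levels above all of `Q`, where only the tip of the triangle at `p` is
  -- left.
  have hneg : ∀ u ∈ Set.Ioo τ a, (u - us) * (wQ u - wP u) < 0 := by
    intro u hu
    rw [hwQ0 u hu.1, hwPt u ⟨htτ.trans hu.1.le, hu.2.le⟩, zero_sub]
    apply mul_neg_of_pos_of_neg (by linarith [hu.1])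
    rw [neg_lt_zero]
    exact mul_pos hl (div_pos (by linarith [hu.2]) (by linarith))
  have hφ : Continuous fun u : ℝ => u - us := by fun_prop
  obtain ⟨hiP, hP1⟩ := integral_height hPc θ hφ
  obtain ⟨hiQ, hQ1⟩ := integral_height hQc θ hφ
  have hi : Integrable fun u => -((u - us) * (wQ u - wP u)) := by
    refine (hiP.sub hiQ).congr (Filter.Eventually.of_forall fun u => ?_)
    simp only [Pi.sub_apply, hwP, hwQ]; ring
  have hlt' : 0 < ∫ u, -((u - us) * (wQ u - wP u)) := by
    rw [integral_pos_iff_support_of_nonneg (fun u => by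
      simpa using hsign u) hi]
    refine lt_of_lt_of_le ?_ (measure_mono (s := Set.Ioo τ a) fun u hu => ?_)
    · rw [Real.volume_Ioo]; simpa using hτa
    · rw [Function.mem_support, neg_ne_zero]
      exact (hneg u hu).ne
  have hsplit : ∫ u, -((u - us) * (wQ u - wP u))
      = (∫ z in P, (⟪z, unitVec θ⟫_ℝ - us)) - ∫ z in Q, (⟪z, unitVec θ⟫_ℝ - us) := by
    rw [hP1, hQ1, ← integral_sub hiP hiQ]
    congr 1; funext u; simp only [hwP, hwQ]; ring
  rw [hsplit, integral_hull hconv hcomp hint p (by fun_prop),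
    integral_hull hconv hcomp hint q (by fun_prop)] at hlt'
  -- Equal cone areas make the contributions of the reference level `us` cancel.
  have hcone : ∀ r, ∫ z in silhouetteCone K r, (⟪z, unitVec θ⟫_ℝ - us)
      = (∫ z in silhouetteCone K r, ⟪z, unitVec θ⟫_ℝ) - coneArea K r * us := by
    intro r
    rw [integral_sub (integrableOn_silhouetteCone hcomp r (by fun_prop))
      (integrableOn_silhouetteCone hcomp r (by fun_prop))]
    simp [coneArea]
  rw [hcone, hcone, hq] at hlt'
  linarith

end Moment

/-! ### Highest points of the illumination curve -/

section Highest

variable {K : Set Plane}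

/-- All conditions on contact points are closed except strict positivity, which `IsContact.of_ne`
restores in the limit. -/
lemma IsContact.of_tendsto (hconv : Convex ℝ K) (hcomp : IsCompact K)
    (hint : (interior K).Nonempty) {p : Plane} (hp : p ∉ K) {q x y : ℕ → Plane}
    (hq : Filter.Tendsto q Filter.atTop (𝓝 p)) (hc : ∀ n, IsContact K (q n) (x n) (y n)) :
    ∃ x' y' : Plane, ∃ φ : ℕ → ℕ, StrictMono φ ∧ IsContact K p x' y' ∧
      Filter.Tendsto (x ∘ φ) Filter.atTop (𝓝 x') ∧ Filter.Tendsto (y ∘ φ) Filter.atTop (𝓝 y') := by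
  obtain ⟨⟨x', y'⟩, hmem, φ, hφ, hlim⟩ := (hcomp.prod hcomp).tendsto_subseq
    (x := fun n => (x n, y n)) (fun n => ⟨(hc n).left_mem, (hc n).right_mem⟩)
  have hx : Filter.Tendsto (x ∘ φ) Filter.atTop (𝓝 x') := (continuous_fst.tendsto _).comp hlim
  have hy : Filter.Tendsto (y ∘ φ) Filter.atTop (𝓝 y') := (continuous_snd.tendsto _).comp hlim
  have hq' : Filter.Tendsto (q ∘ φ) Filter.atTop (𝓝 p) := hq.comp hφ.tendsto_atTop
  refine ⟨x', y', φ, hφ, IsContact.of_ne hconv hint hp hmem.1 hmem.2 (fun k hk => ?_)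
    (fun k hk => ?_), hx, hy⟩
  · have h := (continuous_cross.tendsto (x' - p, k - p)).comp
      ((hx.sub hq').prodMk_nhds (hq'.const_sub k))
    exact ge_of_tendsto' h fun n => (hc (φ n)).left_nonneg k hk
  · have h := (continuous_cross.tendsto (y' - p, k - p)).comp
      ((hy.sub hq').prodMk_nhds (hq'.const_sub k))
    exact le_of_tendsto' h fun n => (hc (φ n)).right_nonpos k hk

/-- A one-sided derivative test at a highest point `p` of a sublevel set. Nearby points `q n` above
`p` have larger cone area, so the subgradient inequality at `q n`, evaluated at `p`, makes `cross (w
n) (x n - y n)` positive. A limit of the contact pairs of `q n` is a contact pair of `p` whose chord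
tilts to the prescribed side. -/
lemma exists_contact_of_perturb (hconv : Convex ℝ K) (hcomp : IsCompact K)
    (hint : (interior K).Nonempty) {p : Plane} (hp : p ∉ K) {θ : ℝ}
    (hmax : ∀ q, coneArea K q ≤ coneArea K p → ⟪q, unitVec θ⟫_ℝ ≤ ⟪p, unitVec θ⟫_ℝ) (v : Plane)
    (hv : ⟪v, unitVec θ⟫_ℝ = 0) :
    ∃ x y, IsContact K p x y ∧ 0 ≤ cross v (x - y) := by
  -- The additional component along `unitVec θ` puts `q n` strictly above `p`, hence outside the
  -- sublevel set, and disappears in the limit.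
  set w : ℕ → Plane := fun n => v + ((1 : ℝ) / (n + 1)) • unitVec θ with hw
  set q : ℕ → Plane := fun n => p + ((1 : ℝ) / (n + 1)) • w n with hq
  have h0 := tendsto_one_div_add_atTop_nhds_zero_nat (𝕜 := ℝ)
  have hwlim : Filter.Tendsto w Filter.atTop (𝓝 v) := by
    have := (h0.smul_const (unitVec θ)).const_add v
    rwa [zero_smul, add_zero] at this
  have hqlim : Filter.Tendsto q Filter.atTop (𝓝 p) := by
    have := (h0.smul hwlim).const_add p
    rwa [zero_smul, add_zero] at this
  have hn : ∀ n : ℕ, 0 < (1 : ℝ) / (n + 1) := fun n => by positivity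
  have hqu : ∀ n, coneArea K p < coneArea K (q n) := by
    intro n
    by_contra! h
    have := hmax _ h
    simp only [hq, hw, inner_add_left, real_inner_smul_left, hv, inner_unitVec_self] at this
    nlinarith [hn n]
  have hqK : ∀ n, q n ∉ K := by
    intro n h
    have := hqu n
    rw [coneArea_of_mem hconv h] at this
    linarith [coneArea_nonneg K p]
  choose x y hc using fun n => exists_isContact hconv hcomp hint (hqK n)
  obtain ⟨x', y', φ, hφ, hc', hx, hy⟩ := IsContact.of_tendsto hconv hcomp hint hp hqlim hc
  refine ⟨x', y', hc', ?_⟩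
  have hlim := (continuous_cross.tendsto (v, x' - y')).comp
    ((hwlim.comp hφ.tendsto_atTop).prodMk_nhds (hx.sub hy))
  refine ge_of_tendsto' hlim fun n => ?_
  have h1 := (hc (φ n)).subgradient_cross hconv hcomp hint p
  have h2 := hqu (φ n)
  have h3 : cross (p - q (φ n)) (x (φ n) - y (φ n))
      = -((1 : ℝ) / ((φ n : ℕ) + 1)) * cross (w (φ n)) (x (φ n) - y (φ n)) := by
    simp only [hq, cross]; simp; ring
  rw [h3] at h1
  have h4 := hn (φ n)
  simp only [Function.comp]
  by_contra! hcon
  nlinarith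

/-- For each direction there is a point of the illumination curve with polar chord normal to it. -/
lemma exists_isContact_dir (hconv : Convex ℝ K) (hcomp : IsCompact K)
    (hint : (interior K).Nonempty) {d : ℝ} (hd : 0 < d) (θ : ℝ) :
    ∃ p x y : Plane, ∃ l : ℝ, coneArea K p = d ∧ IsContact K p x y ∧ 0 < l ∧
      x - y = l • unitVecPerp θ := by
  have hB := isCompact_coneArea_le hconv hcomp hint d
  obtain ⟨z, hz⟩ := hint.mono interior_subset
  obtain ⟨p, hpB, hpmax⟩ := hB.exists_isMaxOn ⟨z, by
      rw [Set.mem_ofPred_eq, coneArea_of_mem hconv hz]; exact hd.le⟩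
    (by fun_prop : ContinuousOn (fun k : Plane => ⟪k, unitVec θ⟫_ℝ) _)
  rw [isMaxOn_iff] at hpmax
  have hpd : coneArea K p = d := by
    refine le_antisymm hpB (not_lt.1 fun hlt => ?_)
    have hcont : Continuous fun ε : ℝ => coneArea K (p + ε • unitVec θ) :=
      (continuous_coneArea hconv hcomp hint).comp (by fun_prop)
    have h0 : Filter.Tendsto (fun ε : ℝ => coneArea K (p + ε • unitVec θ)) (𝓝[>] 0)
        (𝓝 (coneArea K p)) := by
      have := (hcont.tendsto 0).mono_left (nhdsWithin_le_nhds (s := Set.Ioi (0 : ℝ)))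
      simpa using this
    obtain ⟨ε, h1, h2⟩ := ((h0.eventually (gt_mem_nhds hlt)).and self_mem_nhdsWithin).exists
    have h3 := hpmax _ (Set.mem_ofPred_eq ▸ h1.le : p + ε • unitVec θ ∈ {q | coneArea K q ≤ d})
    simp only [inner_add_left, real_inner_smul_left, inner_unitVec_self] at h3
    have h4 : 0 < ε := h2
    linarith
  have hp : p ∉ K := fun h => by rw [coneArea_of_mem hconv h] at hpd; linarith
  have hmax : ∀ q, coneArea K q ≤ coneArea K p → ⟪q, unitVec θ⟫_ℝ ≤ ⟪p, unitVec θ⟫_ℝ :=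
    fun q hq => hpmax q (hpd ▸ hq : coneArea K q ≤ d)
  -- The two perturbations give contact chords at `p` with opposite tilts. The contact conditions
  -- are convex in the contact points, so a suitable average of the two chords is a contact chord
  -- with no tilt.
  obtain ⟨x1, y1, hc1, hs1⟩ := exists_contact_of_perturb hconv hcomp hint hp hmax
    (unitVecPerp θ) (by simp)
  obtain ⟨x2, y2, hc2, hs2⟩ := exists_contact_of_perturb hconv hcomp hint hp hmax
    (-unitVecPerp θ) (by simp)
  have hs2' : cross (unitVecPerp θ) (x2 - y2) ≤ 0 := by
    have : cross (-unitVecPerp θ) (x2 - y2) = -cross (unitVecPerp θ) (x2 - y2) := by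
      simp [cross]; ring
    linarith
  obtain ⟨a, ha0, ha1, ha⟩ : ∃ a : ℝ, 0 ≤ a ∧ a ≤ 1 ∧
      a * cross (unitVecPerp θ) (x1 - y1) + (1 - a) * cross (unitVecPerp θ) (x2 - y2) = 0 := by
    rcases eq_or_lt_of_le hs1 with h | h
    · exact ⟨1, zero_le_one, le_rfl, by rw [← h]; ring⟩
    · set c1 := cross (unitVecPerp θ) (x1 - y1)
      set c2 := cross (unitVecPerp θ) (x2 - y2)
      refine ⟨-c2 / (c1 - c2), div_nonneg (by linarith) (by linarith), ?_, ?_⟩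
      · rw [div_le_one (by linarith)]; linarith
      · field_simp [show c1 - c2 ≠ 0 by linarith]; ring
  have hlin : ∀ (z1 z2 k : Plane), cross (a • z1 + (1 - a) • z2 - p) (k - p)
      = a * cross (z1 - p) (k - p) + (1 - a) * cross (z2 - p) (k - p) := by
    intro z1 z2 k; simp [cross]; ring
  have ha1' : 0 ≤ 1 - a := sub_nonneg.2 ha1
  have hc : IsContact K p (a • x1 + (1 - a) • x2) (a • y1 + (1 - a) • y2) := by
    refine IsContact.of_ne hconv hint hp (hconv hc1.left_mem hc2.left_mem ha0 ha1' (by ring))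
      (hconv hc1.right_mem hc2.right_mem ha0 ha1' (by ring)) (fun k hk => ?_) (fun k hk => ?_)
    · rw [hlin]
      have h1 := hc1.left_nonneg k hk
      have h2 := hc2.left_nonneg k hk
      positivity
    · rw [hlin]
      have h1 := hc1.right_nonpos k hk
      have h2 := hc2.right_nonpos k hk
      nlinarith
  set x := a • x1 + (1 - a) • x2 with hx
  set y := a • y1 + (1 - a) • y2 with hy
  have hz : cross (unitVecPerp θ) (x - y) = 0 := by
    rw [← ha, hx, hy]; simp [cross]; ring
  have hzu : ⟪x - y, unitVec θ⟫_ℝ = 0 := by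
    rw [cross_frame θ] at hz
    simpa using hz
  have hdir : x - y = ⟪x - y, unitVecPerp θ⟫_ℝ • unitVecPerp θ := by
    apply frame_ext θ
    · rw [hzu, real_inner_smul_left]; simp
    · rw [real_inner_smul_left]; simp
  refine ⟨p, x, y, _, hpd, hc, ?_, hdir⟩
  have hpos := hc.pos
  rw [cross_apex hdir] at hpos
  have hxp : ⟪x, unitVec θ⟫_ℝ ≤ ⟪p, unitVec θ⟫_ℝ :=
    hmax x (by rw [coneArea_of_mem hconv hc.left_mem]; exact coneArea_nonneg K p)
  exact pos_of_mul_pos_left hpos (by linarith)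
end Highest
/-! ### Centroids -/

lemma inner_areaCentroid {S : Set Plane} {d : ℝ} (hd : d ≠ 0) (hS : volume.real S = d)
    (hb : Bornology.IsBounded S) (e : Plane) :
    d * ⟪areaCentroid S, e⟫_ℝ = ∫ q in S, ⟪q, e⟫_ℝ := by
  have hi : IntegrableOn (fun q : Plane => q) S :=
    (continuous_id.continuousOn.integrableOn_compact hb.isCompact_closure).mono_set subset_closure
  rw [areaCentroid, setAverage_eq, hS, real_inner_smul_left, ← mul_assoc, mul_inv_cancel₀ hd,
    one_mul, real_inner_comm, ← integral_inner hi]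
  simp only [real_inner_comm e]

section Illumination

variable {K : Set Plane} {p x y : Plane} {θ l d : ℝ}

/-- The centroid of the silhouette cone. -/
def coneCentroid (K : Set Plane) (p : Plane) : Plane := areaCentroid (silhouetteCone K p)

lemma inner_coneCentroid (hcomp : IsCompact K) (hd : 0 < d) (hp : coneArea K p = d) (e : Plane) :
    d * ⟪coneCentroid K p, e⟫_ℝ = ∫ q in silhouetteCone K p, ⟪q, e⟫_ℝ :=
  inner_areaCentroid hd.ne' hp (isBounded_silhouetteCone hcomp p) e

lemma notMem_of_coneArea_pos (hconv : Convex ℝ K) (hp : 0 < coneArea K p) : p ∉ K :=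
  fun h => hp.ne' (coneArea_of_mem hconv h)

/-- The homothetic image of `p` is the centroid of the cone of some `q`. If `q ≠ p`, then in the
direction normal to the chord of `p` this centroid is strictly lower than that of the cone of `p`.
But the latter is the image of a point of the curve, which is no higher than `p`, and `r > 0`
preserves heights: a contradiction. -/
lemma coneCentroid_eq_homothety (hK : HasUniqueNormals K) (hconv : Convex ℝ K)
    (hcomp : IsCompact K) (hint : (interior K).Nonempty) {r : ℝ} (hd : 0 < d) (hr : 0 < r)
    (h : IsHomotheticWithRatio (illuminationCurve K d) (illuminationCentroidCurve K d) r) :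
    ∃ c : Plane, ∀ p, coneArea K p = d → coneCentroid K p = c + r • (p - c) := by
  obtain ⟨c, hc⟩ := h
  have hhom : ∀ p : Plane, AffineMap.homothety c r p = c + r • (p - c) := fun p => by
    rw [AffineMap.homothety_apply, vsub_eq_sub, vadd_eq_add, add_comm]
  refine ⟨c, fun p hp => ?_⟩
  have hmem : ∀ p, coneArea K p = d ↔ p ∈ illuminationCurve K d := fun p =>
    (mem_illuminationCurve_iff hcomp hd).symm
  have hpK : p ∉ K := notMem_of_coneArea_pos hconv (hp ▸ hd)
  obtain ⟨x, y, hxy⟩ := exists_isContact hconv hcomp hint hpK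
  obtain ⟨θ, l, hl, hdir⟩ := hxy.exists_dir
  have h1 : c + r • (p - c) ∈ illuminationCentroidCurve K d := by
    rw [← hc, ← hhom]; exact Set.mem_image_of_mem _ ((hmem p).1 hp)
  obtain ⟨q, hq, hqe⟩ := h1
  change _ = coneCentroid K q at hqe
  rw [← hmem] at hq
  by_cases hqp : q = p
  · rw [hqe, hqp]
  exfalso
  have hlt := hxy.height_lt_of_ne hK hconv hcomp hint hdir hl (q := q) (by rw [hq, hp]) hqp
  have hmom := hxy.moment_lt hconv hcomp hint hdir hl (hp ▸ hd) (hq.trans hp.symm) hlt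
  rw [← inner_coneCentroid hcomp hd hq, ← inner_coneCentroid hcomp hd hp] at hmom
  have hmom' := lt_of_mul_lt_mul_left hmom hd.le
  have h2 : coneCentroid K p ∈ illuminationCentroidCurve K d := ⟨p, (hmem p).1 hp, rfl⟩
  rw [← hc] at h2
  obtain ⟨p', hp', hpe⟩ := h2
  rw [← hmem] at hp'
  rw [hhom] at hpe
  have hle : ⟪p', unitVec θ⟫_ℝ ≤ ⟪p, unitVec θ⟫_ℝ := by
    by_cases hpp : p' = p
    · rw [hpp]
    · exact (hxy.height_lt_of_ne hK hconv hcomp hint hdir hl (by rw [hp', hp]) hpp).le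
  rw [← hqe, ← hpe] at hmom'
  simp only [inner_add_left, real_inner_smul_left, inner_sub_left] at hmom'
  nlinarith

/-- With the chord of `p` held fixed, the weighted integral over the cone is exactly triangle minus
cap at `p`, and at least that at `q`. Subtracting, the cap drops out: the triangle contributes `T/3
* ⟪q - p, e⟫`, the homothety `d r ⟪q - p, e⟫`, and the error is proportional to the loss of height.
-/
lemma coneCentroid_bound_aux (hconv : Convex ℝ K) (hcomp : IsCompact K)
    (hint : (interior K).Nonempty) {r : ℝ} (hd : 0 < d) {c : Plane}
    (hcen : ∀ p, coneArea K p = d → coneCentroid K p = c + r • (p - c)) {R : ℝ}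
    (hR : ∀ q, coneArea K q ≤ d → ‖q‖ ≤ R) (hc : IsContact K p x y) (hp : coneArea K p = d)
    (hxy : x - y = l • unitVecPerp θ) (hl : 0 < l) {q : Plane} (hq : coneArea K q = d)
    (hqx : ⟪x, unitVec θ⟫_ℝ < ⟪q, unitVec θ⟫_ℝ)
    (hqp : ⟪q, unitVec θ⟫_ℝ ≤ ⟪p, unitVec θ⟫_ℝ) {e : Plane} (he : ‖e‖ = 1) :
    (l / 2 * (⟪p, unitVec θ⟫_ℝ - ⟪x, unitVec θ⟫_ℝ) / 3 - d * r) * ⟪q - p, e⟫_ℝ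
      ≤ 2 * l * R * (⟪p, unitVec θ⟫_ℝ - ⟪q, unitVec θ⟫_ℝ) := by
  have hKR : ∀ k ∈ K, ‖k‖ ≤ R := fun k hk => hR k (by rw [coneArea_of_mem hconv hk]; exact hd.le)
  have hin : ∀ z : Plane, ‖z‖ ≤ R → |⟪z, e⟫_ℝ| ≤ R := fun z hz => by
    have := abs_real_inner_le_norm z e
    rw [he, mul_one] at this
    exact this.trans hz
  have hpR := hin p (hR p hp.le)
  have hqR := hin q (hR q hq.le)
  have hxR := hin x (hKR x hc.left_mem)
  have hyR := hin y (hKR y hc.right_mem)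
  -- The constant makes the weight `c0 + ⟪z, e⟫` nonnegative on the hull, as the one-sided
  -- comparison requires; the mean over the triangle is at most `4 * R`.
  set c0 := 2 * R - ⟪p, e⟫_ℝ with hc0
  have hf0 : ∀ z ∈ convexHull ℝ (K ∪ {q}), 0 ≤ c0 + ⟪z, e⟫_ℝ := by
    intro z hz
    have hzR : ‖z‖ ≤ R := by
      rw [← mem_closedBall_zero_iff]
      refine convexHull_min ?_ (convex_closedBall _ _) hz
      rintro w (hw | hw)
      · rw [mem_closedBall_zero_iff]; exact hKR w hw
      · rw [mem_closedBall_zero_iff, Set.mem_singleton_iff.1 hw]; exact hR q hq.le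
    have := abs_le.1 (hin z hzR)
    have := abs_le.1 hpR
    linarith
  have hfc : Continuous fun z : Plane => c0 + ⟪z, e⟫_ℝ := by fun_prop
  have hDq : 0 < cross (x - q) (y - q) := by
    rw [cross_apex hxy]; exact mul_pos hl (by linarith)
  have h1 := le_integral_silhouetteCone hcomp hconv hint hc.left_mem hc.right_mem hxy hl hqx hfc hf0
  have h2 := hc.integral_silhouetteCone hconv hcomp hxy hl hfc
  rw [tri_integral hDq, cross_apex hxy] at h1
  rw [tri_integral hc.pos, cross_apex hxy] at h2
  have hcone : ∀ z, coneArea K z = d → ∫ w in silhouetteCone K z, (c0 + ⟪w, e⟫_ℝ)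
      = d * c0 + d * ⟪c + r • (z - c), e⟫_ℝ := by
    intro z hz
    rw [← hcen z hz, inner_coneCentroid hcomp hd hz,
      integral_add (integrableOn_silhouetteCone hcomp z continuous_const)
      (integrableOn_silhouetteCone hcomp z (by fun_prop))]
    rw [← hz]; simp [coneArea]
  rw [hcone q hq] at h1
  rw [hcone p hp] at h2
  simp only [inner_add_left, real_inner_smul_left, inner_sub_left] at h1 h2 ⊢
  have hpR' := abs_le.1 hpR
  have hqR' := abs_le.1 hqR
  have hxR' := abs_le.1 hxR
  have hyR' := abs_le.1 hyR
  have hB : c0 + (⟪q, e⟫_ℝ + ⟪x, e⟫_ℝ + ⟪y, e⟫_ℝ) / 3 ≤ 4 * R := by linarith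
  have hm := mul_le_mul_of_nonneg_left hB
    (mul_nonneg (by linarith : 0 ≤ l / 2) (sub_nonneg.2 hqp))
  linarith

/-- Comparison of the displacement of the centroid with that of the apex. -/
lemma coneCentroid_bound (hconv : Convex ℝ K) (hcomp : IsCompact K)
    (hint : (interior K).Nonempty) {r : ℝ} (hd : 0 < d) {c : Plane}
    (hcen : ∀ p, coneArea K p = d → coneCentroid K p = c + r • (p - c)) {R : ℝ}
    (hR : ∀ q, coneArea K q ≤ d → ‖q‖ ≤ R) (hc : IsContact K p x y) (hp : coneArea K p = d)
    (hxy : x - y = l • unitVecPerp θ) (hl : 0 < l) {q : Plane} (hq : coneArea K q = d)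
    (hqx : ⟪x, unitVec θ⟫_ℝ < ⟪q, unitVec θ⟫_ℝ)
    (hqp : ⟪q, unitVec θ⟫_ℝ ≤ ⟪p, unitVec θ⟫_ℝ) :
    |l / 2 * (⟪p, unitVec θ⟫_ℝ - ⟪x, unitVec θ⟫_ℝ) / 3 - d * r| * |⟪q - p, unitVecPerp θ⟫_ℝ|
      ≤ 2 * l * R * (⟪p, unitVec θ⟫_ℝ - ⟪q, unitVec θ⟫_ℝ) := by
  rw [← abs_mul, abs_le]
  have h1 := coneCentroid_bound_aux hconv hcomp hint hd hcen hR hc hp hxy hl hq hqx hqp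
    (norm_unitVecPerp θ)
  have h2 := coneCentroid_bound_aux hconv hcomp hint hd hcen hR hc hp hxy hl hq hqx hqp
    (e := -unitVecPerp θ) (by rw [norm_neg, norm_unitVecPerp])
  rw [inner_neg_right] at h2
  constructor <;> linarith

/-- A continuous choice of the highest points of the illumination curve. -/
lemma continuous_highest (hconv : Convex ℝ K) (hcomp : IsCompact K)
    (hint : (interior K).Nonempty) {P : ℝ → Plane} (hP : ∀ θ, coneArea K (P θ) = d)
    (hmax : ∀ θ q, coneArea K q ≤ d → q ≠ P θ → ⟪q, unitVec θ⟫_ℝ < ⟪P θ, unitVec θ⟫_ℝ) :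
    Continuous P := by
  rw [continuous_iff_continuousAt]
  intro θ0
  rw [ContinuousAt, tendsto_nhds]
  intro U hU hmem
  have hcpt : IsCompact ({q | coneArea K q ≤ d} \ U) :=
    (isCompact_coneArea_le hconv hcomp hint d).diff hU
  have hev : ∀ᶠ θ in 𝓝 θ0, ∀ q ∈ {q | coneArea K q ≤ d} \ U,
      ⟪q, unitVec θ⟫_ℝ < ⟪P θ0, unitVec θ⟫_ℝ := by
    apply hcpt.eventually_forall_of_forall_eventually
    intro q hq
    have hopen : IsOpen {z : ℝ × Plane | ⟪z.2, unitVec z.1⟫_ℝ < ⟪P θ0, unitVec z.1⟫_ℝ} := by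
      have := continuous_unitVec
      exact isOpen_lt (by fun_prop) (by fun_prop)
    exact hopen.mem_nhds (hmax θ0 q hq.1 fun h => hq.2 (h ▸ hmem))
  filter_upwards [hev] with θ hθ
  by_contra hcon
  have h1 := hθ (P θ) ⟨(hP θ).le, hcon⟩
  by_cases h : P θ0 = P θ
  · rw [h] at h1; exact lt_irrefl _ h1
  · exact absurd (hmax θ (P θ0) (hP θ0).le h) (not_lt.2 h1.le)

/-- `P θ` and `P φ` are each highest in their own direction, so the loss of height between them is
at most `‖P φ - P θ‖ * |φ - θ|`, of smaller order than the displacement. By `coneCentroid_bound`, a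
coefficient `κ ≠ 0` would bound the tangential displacement by a multiple of this loss. That is
impossible for `φ` near `θ` with `P φ ≠ P θ`. -/
lemma triangle_area_of_frequently_ne (hconv : Convex ℝ K) (hcomp : IsCompact K)
    (hint : (interior K).Nonempty) {r : ℝ} (hd : 0 < d) {c : Plane}
    (hcen : ∀ p, coneArea K p = d → coneCentroid K p = c + r • (p - c)) {P : ℝ → Plane}
    (hP : ∀ θ, coneArea K (P θ) = d)
    (hmax : ∀ θ q, coneArea K q ≤ d → q ≠ P θ → ⟪q, unitVec θ⟫_ℝ < ⟪P θ, unitVec θ⟫_ℝ)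
    (hPc : Continuous P) (hfreq : ∃ᶠ φ in 𝓝 θ, P φ ≠ P θ) (hc : IsContact K (P θ) x y)
    (hxy : x - y = l • unitVecPerp θ) (hl : 0 < l) :
    l / 2 * (⟪P θ, unitVec θ⟫_ℝ - ⟪x, unitVec θ⟫_ℝ) = 3 * (d * r) := by
  obtain ⟨R, hR⟩ := exists_bound_of_coneArea_le hconv hcomp hint d
  set κ := l / 2 * (⟪P θ, unitVec θ⟫_ℝ - ⟪x, unitVec θ⟫_ℝ) / 3 - d * r with hκ
  suffices κ = 0 by rw [hκ] at this; linarith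
  by_contra hne
  have hκ0 : 0 < |κ| := abs_pos.2 hne
  have hR0 : 0 ≤ R := (norm_nonneg _).trans (hR _ (hP θ).le)
  have hev1 : ∀ᶠ φ in 𝓝 θ, ⟪x, unitVec θ⟫_ℝ < ⟪P φ, unitVec θ⟫_ℝ :=
    ((by fun_prop : Continuous fun φ => ⟪P φ, unitVec θ⟫_ℝ).tendsto θ).eventually
      (lt_mem_nhds (hc.height_lt hxy hl))
  have hev2 : ∀ᶠ φ in 𝓝 θ, (|κ| + 2 * l * R) * |φ - θ| < |κ| := by
    have : Filter.Tendsto (fun φ => (|κ| + 2 * l * R) * |φ - θ|) (𝓝 θ)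
        (𝓝 ((|κ| + 2 * l * R) * |θ - θ|)) :=
      (by fun_prop : Continuous fun φ => (|κ| + 2 * l * R) * |φ - θ|).tendsto θ
    rw [sub_self, abs_zero, mul_zero] at this
    exact this.eventually (gt_mem_nhds hκ0)
  obtain ⟨φ, hφ, h1, h2⟩ := (hfreq.and_eventually (hev1.and hev2)).exists
  have h3 := hmax θ (P φ) (hP φ).le hφ
  have h4 := coneCentroid_bound hconv hcomp hint hd hcen hR hc (hP θ) hxy hl (hP φ) h1 h3.le
  have h5 := hmax φ (P θ) (hP θ).le (Ne.symm hφ)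
  have hN : 0 < ‖P φ - P θ‖ := norm_pos_iff.2 (sub_ne_zero.2 hφ)
  have h6 : ⟪P θ, unitVec θ⟫_ℝ - ⟪P φ, unitVec θ⟫_ℝ ≤ ‖P φ - P θ‖ * |φ - θ| := by
    have e1 : ⟪P θ, unitVec θ⟫_ℝ - ⟪P φ, unitVec θ⟫_ℝ
        = ⟪P φ - P θ, unitVec φ - unitVec θ⟫_ℝ
          + (⟪P θ, unitVec φ⟫_ℝ - ⟪P φ, unitVec φ⟫_ℝ) := by
      simp only [inner_sub_left, inner_sub_right]; ring
    have e2 := real_inner_le_norm (P φ - P θ) (unitVec φ - unitVec θ)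
    have e3 := mul_le_mul_of_nonneg_left (norm_unitVec_sub_le φ θ) hN.le
    linarith
  have h7 := norm_le_frame θ (P φ - P θ)
  have h8 : |⟪P φ - P θ, unitVec θ⟫_ℝ| = ⟪P θ, unitVec θ⟫_ℝ - ⟪P φ, unitVec θ⟫_ℝ := by
    rw [inner_sub_left, abs_of_neg (by linarith)]; ring
  rw [h8] at h7
  set D := ⟪P θ, unitVec θ⟫_ℝ - ⟪P φ, unitVec θ⟫_ℝ
  set N := ‖P φ - P θ‖
  have h9 : |κ| * N ≤ |κ| * D + 2 * l * R * D := by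
    have := mul_le_mul_of_nonneg_left h7 hκ0.le
    rw [hκ] at this ⊢
    linarith
  have h10 : (|κ| + 2 * l * R) * D ≤ (|κ| + 2 * l * R) * (N * |φ - θ|) :=
    mul_le_mul_of_nonneg_left h6 (by positivity)
  have h11 := mul_lt_mul_of_pos_right h2 hN
  linarith

/-- Interpolation between two contact chords of the same apex cutting off equal triangles. -/
lemma IsContact.interpolate (hconv : Convex ℝ K) {x₁ y₁ x₂ y₂ : Plane} {θ₁ θ₂ l₁ l₂ : ℝ}
    (hc₁ : IsContact K p x₁ y₁) (hc₂ : IsContact K p x₂ y₂)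
    (hxy₁ : x₁ - y₁ = l₁ • unitVecPerp θ₁) (hxy₂ : x₂ - y₂ = l₂ • unitVecPerp θ₂)
    (hl₁ : 0 < l₁) (hl₂ : 0 < l₂) (hpK : p ∉ K)
    (hT : cross (x₁ - p) (y₁ - p) = cross (x₂ - p) (y₂ - p))
    (hθ₁ : θ₁ ∈ Set.Icc (θ - Real.pi) θ) (hθ₂ : θ₂ ∈ Set.Icc θ (θ + Real.pi)) :
    ∃ x y, IsContact K p x y ∧ ⟪x - y, unitVec θ⟫_ℝ = 0 ∧
      cross (x - p) (y - p) = cross (x₁ - p) (y₁ - p) := by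
  have hpar : ∀ a b : Plane, a ≠ 0 → cross a b = 0 → ∃ c : ℝ, b = c • a := by
    intro a b ha h
    have haa : ⟪a, a⟫_ℝ ≠ 0 := (real_inner_self_pos.2 ha).ne'
    refine ⟨⟪a, b⟫_ℝ / ⟪a, a⟫_ℝ, ?_⟩
    apply plane_ext
    · rw [PiLp.smul_apply, smul_eq_mul, div_mul_eq_mul_div, eq_div_iff haa]
      simp only [inner_plane, cross] at h ⊢
      linear_combination -a 1 * h
    · rw [PiLp.smul_apply, smul_eq_mul, div_mul_eq_mul_div, eq_div_iff haa]
      simp only [inner_plane, cross] at h ⊢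
      linear_combination a 0 * h
  have hsl : ∀ (c : ℝ) (a b : Plane), cross (c • a) b = c * cross a b := by
    intro c a b; simp [cross]; ring
  have hsr : ∀ (c : ℝ) (a b : Plane), cross a (c • b) = c * cross a b := by
    intro c a b; simp [cross]; ring
  set e := x₁ - p with he
  set f := y₁ - p with hf
  have hD := hc₁.pos
  have he0 : e ≠ 0 := sub_ne_zero.2 fun h => hpK (h ▸ hc₁.left_mem)
  have hf0 : f ≠ 0 := sub_ne_zero.2 fun h => hpK (h ▸ hc₁.right_mem)
  -- Both pairs of contact points lie on the same two supporting rays from `p`, so the second pair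
  -- is obtained from the first by scaling; equal areas mean `α * β = 1`.
  obtain ⟨α, hα⟩ := hpar e (x₂ - p) he0 (le_antisymm (by
    rw [cross_swap]; linarith [hc₂.left_nonneg _ hc₁.left_mem]) (hc₁.left_nonneg _ hc₂.left_mem))
  obtain ⟨β, hβ⟩ := hpar f (y₂ - p) hf0 (le_antisymm (hc₁.right_nonpos _ hc₂.right_mem) (by
    rw [cross_swap]; linarith [hc₂.right_nonpos _ hc₁.right_mem]))
  have hα0 : 0 ≤ α := by
    have := hc₂.left_nonneg _ hc₁.right_mem
    rw [hα, hsl] at this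
    exact nonneg_of_mul_nonneg_left this hD
  have hαβ : α * β = 1 := by
    rw [hα, hβ, hsl, hsr] at hT
    have : (α * β - 1) * cross e f = 0 := by linarith
    rcases mul_eq_zero.1 this with h | h
    · linarith
    · linarith
  have hαpos : 0 < α := lt_of_le_of_ne hα0 fun h => by rw [← h] at hαβ; simp at hαβ
  have hβeq : β = α⁻¹ := by field_simp; linarith
  -- The chords with end points `p + a • e`, `p + a⁻¹ • f` cut off triangles of constant area. Their
  -- tilt `ψ` has the sign of `sin (θ - θ₁)` at `a = 1` and of `sin (θ - θ₂)` at `a = α`, so it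
  -- vanishes in between.
  set ψ : ℝ → ℝ := fun a => ⟪a • e - a⁻¹ • f, unitVec θ⟫_ℝ with hψ
  have hmin : 0 < min 1 α := lt_min one_pos hαpos
  have hψc : ContinuousOn ψ (Set.uIcc 1 α) := by
    have : ∀ a ∈ Set.uIcc 1 α, a ≠ 0 := fun a ha => (hmin.trans_le ha.1).ne'
    have hinv : ContinuousOn (fun a : ℝ => a⁻¹) (Set.uIcc 1 α) := continuousOn_inv₀.mono this
    exact ContinuousOn.inner (𝕜 := ℝ) ((by fun_prop : ContinuousOn (fun a : ℝ => a • e) _).sub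
      (hinv.smul continuousOn_const)) continuousOn_const
  have hψ1 : 0 ≤ ψ 1 := by
    have : (1 : ℝ) • e - (1 : ℝ)⁻¹ • f = l₁ • unitVecPerp θ₁ := by
      rw [← hxy₁, he, hf]; simp
    simp only [hψ]
    rw [this, real_inner_smul_left, inner_unitVecPerp_unitVec']
    exact mul_nonneg hl₁.le (Real.sin_nonneg_of_nonneg_of_le_pi (by linarith [hθ₁.2])
      (by linarith [hθ₁.1]))
  have hψα : ψ α ≤ 0 := by
    have : α • e - α⁻¹ • f = l₂ • unitVecPerp θ₂ := by
      rw [← hxy₂, ← hβeq, ← hα, ← hβ]; simp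
    simp only [hψ]
    rw [this, real_inner_smul_left, inner_unitVecPerp_unitVec']
    exact mul_nonpos_of_nonneg_of_nonpos hl₂.le
      (Real.sin_nonpos_of_nonpos_of_neg_pi_le (by linarith [hθ₂.1]) (by linarith [hθ₂.2]))
  obtain ⟨a, ha, ha0⟩ : ∃ a ∈ Set.uIcc 1 α, ψ a = 0 :=
    intermediate_value_uIcc hψc (Set.mem_uIcc.2 (Or.inr ⟨hψα, hψ1⟩))
  have hapos : 0 < a := hmin.trans_le ha.1
  have hainv : a⁻¹ ∈ Set.uIcc (1 : ℝ) α⁻¹ := by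
    rcases Set.mem_uIcc.1 ha with h | h
    · exact Set.mem_uIcc.2 (Or.inr ⟨inv_anti₀ hapos h.2, by simpa using inv_anti₀ one_pos h.1⟩)
    · exact Set.mem_uIcc.2 (Or.inl ⟨by simpa using inv_anti₀ hapos h.2, inv_anti₀ hαpos h.1⟩)
  have hseg : ∀ (v : Plane) (c a : ℝ), a ∈ Set.uIcc 1 c → p + v ∈ K → p + c • v ∈ K →
      p + a • v ∈ K := by
    intro v c a ha h1 h2
    rw [← segment_eq_uIcc] at ha
    obtain ⟨s, t, hs, ht, hst, rfl⟩ := ha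
    have := hconv h1 h2 hs ht hst
    convert this using 1
    obtain rfl : t = 1 - s := by linarith
    simp only [smul_eq_mul]
    module
  refine ⟨p + a • e, p + a⁻¹ • f, ⟨?_, ?_, fun k hk => ?_, fun k hk => ?_, ?_⟩, ?_, ?_⟩
  · refine hseg e α a ha ?_ ?_
    · rw [he, add_sub_cancel]; exact hc₁.left_mem
    · rw [← hα, add_sub_cancel]; exact hc₂.left_mem
  · refine hseg f α⁻¹ a⁻¹ hainv ?_ ?_
    · rw [hf, add_sub_cancel]; exact hc₁.right_mem
    · rw [← hβeq, ← hβ, add_sub_cancel]; exact hc₂.right_mem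
  · rw [add_sub_cancel_left, hsl]; exact mul_nonneg hapos.le (hc₁.left_nonneg k hk)
  · rw [add_sub_cancel_left, hsl]
    exact mul_nonpos_of_nonneg_of_nonpos (inv_pos.2 hapos).le (hc₁.right_nonpos k hk)
  · rw [add_sub_cancel_left, add_sub_cancel_left, hsl, hsr, ← mul_assoc,
      mul_inv_cancel₀ hapos.ne', one_mul]
    exact hD
  · rw [add_sub_add_left_eq_sub]; exact ha0
  · rw [add_sub_cancel_left, add_sub_cancel_left, hsl, hsr, ← mul_assoc,
      mul_inv_cancel₀ hapos.ne', one_mul]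

lemma exists_last_mem {J : Set ℝ} (hJ : IsClosed J) {a b : ℝ} (ha : a ∈ J) (hb : b ∉ J)
    (hab : a ≤ b) : ∃ c ∈ Set.Icc a b, c ∈ J ∧ ∃ᶠ φ in 𝓝 c, φ ∉ J := by
  have hc : IsCompact (J ∩ Set.Icc a b) := isCompact_Icc.inter_left hJ
  obtain ⟨c, ⟨hcJ, hcI⟩, hmax⟩ := hc.exists_isMaxOn ⟨a, ha, le_rfl, hab⟩ continuousOn_id
  have hcb : c < b := lt_of_le_of_ne hcI.2 fun h => hb (h ▸ hcJ)
  refine ⟨c, hcI, hcJ, ?_⟩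
  have h : ∀ᶠ φ in 𝓝[>] c, φ ∉ J := by
    filter_upwards [Ioo_mem_nhdsGT hcb] with φ hφ hJφ
    exact absurd (isMaxOn_iff.1 hmax φ ⟨hJφ, hcI.1.trans hφ.1.le, hφ.2.le⟩) (not_le.2 hφ.1)
  exact h.frequently.filter_mono nhdsWithin_le_nhds

lemma exists_first_mem {J : Set ℝ} (hJ : IsClosed J) {a b : ℝ} (ha : a ∉ J) (hb : b ∈ J)
    (hab : a ≤ b) : ∃ c ∈ Set.Icc a b, c ∈ J ∧ ∃ᶠ φ in 𝓝 c, φ ∉ J := by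
  have hc : IsCompact (J ∩ Set.Icc a b) := isCompact_Icc.inter_left hJ
  obtain ⟨c, ⟨hcJ, hcI⟩, hmin⟩ := hc.exists_isMinOn ⟨b, hb, hab, le_rfl⟩ continuousOn_id
  have hac : a < c := lt_of_le_of_ne hcI.1 fun h => ha (h ▸ hcJ)
  refine ⟨c, hcI, hcJ, ?_⟩
  have h : ∀ᶠ φ in 𝓝[<] c, φ ∉ J := by
    filter_upwards [Ioo_mem_nhdsLT hac] with φ hφ hJφ
    exact absurd (isMinOn_iff.1 hmin φ ⟨hJφ, hφ.1.le, hφ.2.le.trans hcI.2⟩) (not_le.2 hφ.2)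
  exact h.frequently.filter_mono nhdsWithin_le_nhds

/-- If the centroids of the silhouette cones are homothetic images of their apexes, then every
direction has a polar chord cutting off a triangle of fixed area. -/
lemma exists_chord_of_homothety (hK : HasUniqueNormals K) (hconv : Convex ℝ K)
    (hcomp : IsCompact K) (hint : (interior K).Nonempty) {r : ℝ} (hd : 0 < d) {c : Plane}
    (hcen : ∀ p, coneArea K p = d → coneCentroid K p = c + r • (p - c)) (θ : ℝ) :
    ∃ p x y : Plane, ∃ l : ℝ, coneArea K p = d ∧ IsContact K p x y ∧ 0 < l ∧
      x - y = l • unitVecPerp θ ∧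
      l / 2 * (⟪p, unitVec θ⟫_ℝ - ⟪x, unitVec θ⟫_ℝ) = 3 * (d * r) := by
  choose P X Y L hP hc hL hdir using exists_isContact_dir hconv hcomp hint hd
  have hmax : ∀ θ q, coneArea K q ≤ d → q ≠ P θ → ⟪q, unitVec θ⟫_ℝ < ⟪P θ, unitVec θ⟫_ℝ :=
    fun θ q hq hne => (hc θ).height_lt_of_ne hK hconv hcomp hint (hdir θ) (hL θ)
      (by rwa [hP θ]) hne
  have hPc := continuous_highest hconv hcomp hint hP hmax
  -- The directions in which `P θ` is highest. They can form a nondegenerate interval, if `P θ` is a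
  -- corner of the curve, and then the area relation is known only where `P` starts to move.
  set J := {φ | P φ = P θ} with hJ
  have hJc : IsClosed J := isClosed_eq hPc continuous_const
  have hPK : P θ ∉ K := notMem_of_coneArea_pos hconv ((hP θ).symm ▸ hd)
  obtain ⟨z, hz⟩ := hint.mono interior_subset
  have hz0 : coneArea K z ≤ d := by rw [coneArea_of_mem hconv hz]; exact hd.le
  have hzP : ∀ φ, z ≠ P φ := fun φ h =>
    notMem_of_coneArea_pos hconv ((hP φ).symm ▸ hd : 0 < coneArea K (P φ)) (h ▸ hz)
  -- A point highest in two opposite directions would lie both above and below a point of `K`. So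
  -- `J` ends within distance `π` on both sides of `θ`.
  have hopp : ∀ φ, unitVec φ = -unitVec θ → φ ∉ J := by
    intro φ hφ hmem
    have h1 := hmax θ z hz0 (hzP θ)
    have h2 := hmax φ z hz0 (hzP φ)
    rw [(hmem : P φ = P θ), hφ, inner_neg_right, inner_neg_right] at h2
    linarith
  have hJ1 : θ + Real.pi ∉ J := hopp _ (unitVec_add_pi θ)
  have hJ2 : θ - Real.pi ∉ J := hopp _ (by
    have := unitVec_add_pi (θ - Real.pi)
    rw [sub_add_cancel] at this
    rw [this, neg_neg])
  have hT : ∀ φ ∈ J, (∃ᶠ η in 𝓝 φ, η ∉ J) → IsContact K (P θ) (X φ) (Y φ) ∧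
      cross (X φ - P θ) (Y φ - P θ) = 2 * (3 * (d * r)) := by
    intro φ hφ hfr
    have hφ' : P φ = P θ := hφ
    have h1 := triangle_area_of_frequently_ne hconv hcomp hint hd hcen hP hmax hPc
      (hfr.mono fun η hη h => hη (h.trans hφ')) (hc φ) (hdir φ) (hL φ)
    refine ⟨hφ' ▸ hc φ, ?_⟩
    rw [← hφ', cross_apex (hdir φ), ← h1]; ring
  obtain ⟨θ₂, hI₂, hm₂, hf₂⟩ := exists_last_mem hJc (rfl : P θ = P θ) hJ1
    (by linarith [Real.pi_pos])
  obtain ⟨θ₁, hI₁, hm₁, hf₁⟩ := exists_first_mem hJc hJ2 (rfl : P θ = P θ)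
    (by linarith [Real.pi_pos])
  obtain ⟨hc₁, hT₁⟩ := hT θ₁ hm₁ hf₁
  obtain ⟨hc₂, hT₂⟩ := hT θ₂ hm₂ hf₂
  obtain ⟨x, y, hxy, hort, hTx⟩ := hc₁.interpolate hconv hc₂ (hdir θ₁) (hdir θ₂) (hL θ₁) (hL θ₂)
    hPK (hT₁.trans hT₂.symm) hI₁ hI₂
  have hd' : x - y = ⟪x - y, unitVecPerp θ⟫_ℝ • unitVecPerp θ := by
    apply frame_ext θ
    · rw [hort, real_inner_smul_left]; simp
    · rw [real_inner_smul_left]; simp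
  have hxl : ⟪x, unitVec θ⟫_ℝ < ⟪P θ, unitVec θ⟫_ℝ :=
    hmax θ x (by rw [coneArea_of_mem hconv hxy.left_mem]; exact hd.le)
      fun h => hPK (h ▸ hxy.left_mem)
  have hpos := hxy.pos
  have hapex := cross_apex (p := P θ) hd'
  rw [hapex] at hpos
  refine ⟨P θ, x, y, _, hP θ, hxy, pos_of_mul_pos_left hpos (by linarith), hd', ?_⟩
  rw [hTx, hT₁] at hapex
  linarith

end Illumination
/-! ### Caps and water lines -/

section Water

variable {K : Set Plane} {δ : ℝ}

lemma volume_lineAt (θ t : ℝ) : volume (lineAt θ t) = 0 := by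
  have hcl : MeasurableSet (lineAt θ t) :=
    (isClosed_eq (by fun_prop : Continuous fun q : Plane => ⟪q, unitVec θ⟫_ℝ)
      continuous_const).measurableSet
  rw [← (measurePreserving_framePt θ).measure_preimage hcl.nullMeasurableSet]
  have : (fun z : ℝ × ℝ => framePt θ z.1 z.2) ⁻¹' lineAt θ t = {t} ×ˢ Set.univ := by
    ext z
    simp [lineAt]
  rw [this, Measure.volume_eq_prod, Measure.prod_prod]
  simp

/-- Dominated convergence: membership of `q` in the cap is locally constant in the parameters unless
`q` lies on the limiting line, which is a null set. -/
lemma continuous_integral_cap (hcomp : IsCompact K) {f : Plane → ℝ} (hf : Continuous f) :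
    Continuous fun z : ℝ × ℝ => ∫ q in cap K z.1 z.2, f q := by
  rw [continuous_iff_continuousAt]
  intro z0
  have hi : IntegrableOn f K := hf.continuousOn.integrableOn_compact hcomp
  have hm : ∀ z : ℝ × ℝ, MeasurableSet (cap K z.1 z.2) := fun z =>
    (isCompact_cap hcomp z.1 z.2).measurableSet
  simp only [← integral_indicator (hm _)]
  refine tendsto_integral_filter_of_dominated_convergence (fun q => ‖K.indicator f q‖)
    (Filter.Eventually.of_forall fun z => ?_) (Filter.Eventually.of_forall fun z =>
    Filter.Eventually.of_forall fun q => ?_) ((integrable_indicator_iff hcomp.measurableSet).2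
      hi).norm ?_
  · exact hf.measurable.aestronglyMeasurable.indicator (hm z)
  · by_cases hq : q ∈ cap K z.1 z.2
    · rw [Set.indicator_of_mem hq, Set.indicator_of_mem hq.1]
    · rw [Set.indicator_of_notMem hq, norm_zero]; exact norm_nonneg _
  · have hnull : ∀ᵐ q : Plane, q ∉ lineAt z0.1 z0.2 := by
      rw [ae_iff]; simpa using volume_lineAt z0.1 z0.2
    filter_upwards [hnull] with q hq
    apply tendsto_const_nhds.congr'
    have := continuous_unitVec
    rcases lt_or_gt_of_ne (hq : ¬ ⟪q, unitVec z0.1⟫_ℝ = z0.2) with h | h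
    · have hev : ∀ᶠ z : ℝ × ℝ in 𝓝 z0, ⟪q, unitVec z.1⟫_ℝ < z.2 :=
        (isOpen_lt (by fun_prop : Continuous fun z : ℝ × ℝ => ⟪q, unitVec z.1⟫_ℝ)
          continuous_snd).mem_nhds h
      filter_upwards [hev] with z hz
      rw [Set.indicator_of_notMem fun hh => not_le.2 h hh.2,
        Set.indicator_of_notMem fun hh => not_le.2 hz hh.2]
    · have hev : ∀ᶠ z : ℝ × ℝ in 𝓝 z0, z.2 < ⟪q, unitVec z.1⟫_ℝ :=
        (isOpen_lt continuous_snd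
          (by fun_prop : Continuous fun z : ℝ × ℝ => ⟪q, unitVec z.1⟫_ℝ)).mem_nhds h
      filter_upwards [hev] with z hz
      by_cases hqK : q ∈ K
      · rw [Set.indicator_of_mem (show q ∈ cap K z0.1 z0.2 from ⟨hqK, le_of_lt h⟩),
          Set.indicator_of_mem (show q ∈ cap K z.1 z.2 from ⟨hqK, le_of_lt hz⟩)]
      · rw [Set.indicator_of_notMem fun hh => hqK hh.1,
          Set.indicator_of_notMem fun hh => hqK hh.1]

/-- The area of a cap. -/
def capArea (K : Set Plane) (θ t : ℝ) : ℝ := volume.real (cap K θ t)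

lemma capArea_eq_integral (K : Set Plane) (θ t : ℝ) : capArea K θ t = ∫ _q in cap K θ t, (1 : ℝ) := by
  simp [capArea]

lemma continuous_capArea (hcomp : IsCompact K) :
    Continuous fun z : ℝ × ℝ => capArea K z.1 z.2 := by
  simp only [capArea_eq_integral]
  exact continuous_integral_cap hcomp continuous_const

lemma volume_cap_ne_top (hcomp : IsCompact K) (θ t : ℝ) : volume (cap K θ t) ≠ ⊤ :=
  (isCompact_cap hcomp θ t).measure_lt_top.ne

lemma isWaterLine_iff (hcomp : IsCompact K) (hδ : 0 < δ) {θ t : ℝ} :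
    IsWaterLine K δ θ t ↔ capArea K θ t = δ := by
  rw [capArea, Measure.real, IsWaterLine]
  constructor
  · intro h; rw [h, ENNReal.toReal_ofReal hδ.le]
  · intro h; rw [← h, ENNReal.ofReal_toReal (volume_cap_ne_top hcomp θ t)]

lemma capArea_antitone (hcomp : IsCompact K) (θ : ℝ) : Antitone (capArea K θ) := fun _ _ h =>
  measureReal_mono (fun _ hq => ⟨hq.1, h.trans hq.2⟩) (volume_cap_ne_top hcomp θ _)

lemma exists_interior_height_eq (hconv : Convex ℝ K) {θ t : ℝ} {z w : Plane}
    (hz : z ∈ interior K) (hw : w ∈ interior K) (hzt : ⟪z, unitVec θ⟫_ℝ < t)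
    (htw : t < ⟪w, unitVec θ⟫_ℝ) : ∃ v ∈ interior K, ⟪v, unitVec θ⟫_ℝ = t := by
  have := hconv.interior.isPreconnected.intermediate_value hz hw
    (f := fun q => ⟪q, unitVec θ⟫_ℝ) (by fun_prop) ⟨hzt.le, htw.le⟩
  exact this

lemma exists_interior_above (hconv : Convex ℝ K) (hint : (interior K).Nonempty) {θ t : ℝ}
    (h : 0 < capArea K θ t) : ∃ z ∈ interior K, t < ⟪z, unitVec θ⟫_ℝ := by
  obtain ⟨k, hk, hkt⟩ : ∃ k ∈ K, t < ⟪k, unitVec θ⟫_ℝ := by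
    by_contra! hcon
    have hsub : cap K θ t ⊆ lineAt θ t := fun q hq => le_antisymm (hcon q hq.1) hq.2
    have : volume (cap K θ t) = 0 := measure_mono_null hsub (volume_lineAt θ t)
    rw [capArea, Measure.real, this] at h
    simp at h
  have hcl : k ∈ closure (interior K) := by
    rw [hconv.closure_interior_eq_closure_of_nonempty_interior hint]
    exact subset_closure hk
  obtain ⟨z, hz1, hz2⟩ := mem_closure_iff.1 hcl {q | t < ⟪q, unitVec θ⟫_ℝ}
    (isOpen_lt continuous_const (by fun_prop)) hkt
  exact ⟨z, hz2, hz1⟩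

lemma exists_interior_below (hconv : Convex ℝ K) (hint : (interior K).Nonempty) {θ t : ℝ}
    (h : capArea K θ t < volume.real K) : ∃ z ∈ interior K, ⟪z, unitVec θ⟫_ℝ < t := by
  obtain ⟨k, hk, hkt⟩ : ∃ k ∈ K, ⟪k, unitVec θ⟫_ℝ < t := by
    by_contra! hcon
    have : cap K θ t = K := Set.inter_eq_left.2 hcon
    rw [capArea, this] at h
    exact lt_irrefl _ h
  have hcl : k ∈ closure (interior K) := by
    rw [hconv.closure_interior_eq_closure_of_nonempty_interior hint]
    exact subset_closure hk
  obtain ⟨z, hz1, hz2⟩ := mem_closure_iff.1 hcl {q | ⟪q, unitVec θ⟫_ℝ < t}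
    (isOpen_lt (by fun_prop) continuous_const) hkt
  exact ⟨z, hz2, hz1⟩

/-- The two bounds on areas provide interior points above `t` and below `s`. By connectedness there
is one strictly between, so the slab between the levels has positive area in `K`. -/
lemma capArea_strict (hconv : Convex ℝ K) (hcomp : IsCompact K) (hint : (interior K).Nonempty)
    {θ s t : ℝ} (hst : s < t) (ht : 0 < capArea K θ t) (hs : capArea K θ s < volume.real K) :
    capArea K θ t < capArea K θ s := by
  obtain ⟨z, hz, hzt⟩ := exists_interior_above hconv hint ht
  obtain ⟨w, hw, hws⟩ := exists_interior_below hconv hint hs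
  obtain ⟨v, hv, hvt⟩ := exists_interior_height_eq hconv hw hz (θ := θ)
    (t := (s + t) / 2)
    (by linarith) (by linarith)
  set N := interior K ∩ ({q | s < ⟪q, unitVec θ⟫_ℝ} ∩ {q | ⟪q, unitVec θ⟫_ℝ < t}) with hN
  have hNo : IsOpen N := isOpen_interior.inter
    ((isOpen_lt continuous_const (by fun_prop)).inter (isOpen_lt (by fun_prop) continuous_const))
  have hvN : v ∈ N := ⟨hv, by rw [Set.mem_ofPred_eq, hvt]; linarith,
    by rw [Set.mem_ofPred_eq, hvt]; linarith⟩
  have hNpos : 0 < volume N := hNo.measure_pos volume ⟨v, hvN⟩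
  have hNs : N ⊆ cap K θ s := fun q hq =>
    ⟨interior_subset hq.1, (show s < ⟪q, unitVec θ⟫_ℝ from hq.2.1).le⟩
  have hNf := measure_ne_top_of_subset hNs (volume_cap_ne_top hcomp θ s)
  have hdisj : Disjoint (cap K θ t) N := by
    rw [Set.disjoint_left]
    rintro q hq hqN
    have h1 : t ≤ ⟪q, unitVec θ⟫_ℝ := hq.2
    have h2 : ⟪q, unitVec θ⟫_ℝ < t := hqN.2.2
    exact absurd h1 (not_le.2 h2)
  have h1 : capArea K θ t + volume.real N ≤ capArea K θ s := by
    rw [capArea, ← measureReal_union hdisj hNo.measurableSet (volume_cap_ne_top hcomp θ t) hNf]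
    exact measureReal_mono (Set.union_subset (fun q hq => ⟨hq.1, hst.le.trans hq.2⟩) hNs)
      (volume_cap_ne_top hcomp θ s)
  have h2 : 0 < volume.real N := ENNReal.toReal_pos hNpos.ne' hNf
  linarith

lemma exists_capArea_eq (hcomp : IsCompact K) (hδ : 0 < δ)
    (hδK : δ < volume.real K) (θ : ℝ) : ∃ t, capArea K θ t = δ := by
  obtain ⟨R, hR⟩ := hcomp.isBounded.exists_norm_le
  have hb : ∀ q ∈ K, |⟪q, unitVec θ⟫_ℝ| ≤ R := fun q hq =>
    (abs_inner_unitVec_le θ q).trans (hR q hq)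
  have h1 : capArea K θ (-R) = volume.real K := by
    have : cap K θ (-R) = K := Set.inter_eq_left.2 fun q hq => (abs_le.1 (hb q hq)).1
    rw [capArea, this]
  have h2 : capArea K θ (R + 1) = 0 := by
    have : cap K θ (R + 1) = ∅ := by
      ext q
      simp only [Set.mem_empty_iff_false, iff_false]
      rintro ⟨hq, hq2⟩
      have := (abs_le.1 (hb q hq)).2
      have hq3 : R + 1 ≤ ⟪q, unitVec θ⟫_ℝ := hq2
      linarith
    rw [capArea, this]; simp
  have hc : Continuous (capArea K θ) :=
    (continuous_capArea hcomp).comp (Continuous.prodMk_right θ)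
  exact mem_range_of_exists_le_of_exists_ge hc ⟨R + 1, by rw [h2]; exact hδ.le⟩
    ⟨-R, by rw [h1]; exact hδK.le⟩

lemma capArea_inj (hconv : Convex ℝ K) (hcomp : IsCompact K) (hint : (interior K).Nonempty)
    (hδ : 0 < δ) (hδK : δ < volume.real K) {θ s t : ℝ} (hs : capArea K θ s = δ)
    (ht : capArea K θ t = δ) : s = t := by
  rcases lt_trichotomy s t with h | h | h
  · have := capArea_strict hconv hcomp hint h (ht ▸ hδ) (hs ▸ hδK)
    linarith
  · exact h
  · have := capArea_strict hconv hcomp hint h (hs ▸ hδ) (ht ▸ hδK)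
    linarith

lemma continuous_waterHeight (hconv : Convex ℝ K) (hcomp : IsCompact K)
    (hint : (interior K).Nonempty) (hδ : 0 < δ) (hδK : δ < volume.real K) {h : ℝ → ℝ}
    (hh : ∀ θ, capArea K θ (h θ) = δ) : Continuous h := by
  rw [continuous_iff_continuousAt]
  intro θ0
  have hA := continuous_capArea hcomp
  have hAt : ∀ t, Continuous fun θ => capArea K θ t := fun t =>
    hA.comp (Continuous.prodMk_left t)
  apply tendsto_order.2
  constructor
  · intro a ha
    have h1 : δ < capArea K θ0 a := by
      rcases lt_or_ge (capArea K θ0 a) (volume.real K) with h2 | h2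
      · have := capArea_strict hconv hcomp hint ha ((hh θ0).symm ▸ hδ) h2
        rwa [hh] at this
      · linarith
    filter_upwards [((hAt a).tendsto θ0).eventually (lt_mem_nhds h1)] with θ hθ
    by_contra! hcon
    have := capArea_antitone hcomp θ hcon
    rw [hh] at this
    linarith
  · intro b hb
    have h1 : capArea K θ0 b < δ := by
      rcases lt_or_ge 0 (capArea K θ0 b) with h2 | h2
      · have := capArea_strict hconv hcomp hint hb h2 ((hh θ0).symm ▸ hδK)
        rwa [hh] at this
      · linarith
    filter_upwards [((hAt b).tendsto θ0).eventually (gt_mem_nhds h1)] with θ hθ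
    by_contra! hcon
    have := capArea_antitone hcomp θ hcon
    rw [hh] at this
    linarith

lemma capArea_add_pi (hcomp : IsCompact K) (θ t : ℝ) :
    capArea K (θ + Real.pi) (-t) = volume.real K - capArea K θ t := by
  have h1 : cap K (θ + Real.pi) (-t) = K ∩ {q | ⟪q, unitVec θ⟫_ℝ ≤ t} := by
    ext q
    simp [cap, unitVec_add_pi]
  have hm : MeasurableSet (cap K θ t) := (isCompact_cap hcomp θ t).measurableSet
  have h2 : volume.real (K ∩ {q | ⟪q, unitVec θ⟫_ℝ ≤ t}) = volume.real (K \ cap K θ t) := by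
    apply measureReal_congr
    have hnull : ∀ᵐ q : Plane, q ∉ lineAt θ t := by
      rw [ae_iff]; simpa using volume_lineAt θ t
    filter_upwards [hnull] with q hq
    apply propext
    change (q ∈ K ∧ ⟪q, unitVec θ⟫_ℝ ≤ t) ↔ (q ∈ K ∧ ¬ (q ∈ K ∧ t ≤ ⟪q, unitVec θ⟫_ℝ))
    have hq' : ⟪q, unitVec θ⟫_ℝ ≠ t := hq
    constructor
    · rintro ⟨h, h'⟩
      exact ⟨h, fun hh => hq' (le_antisymm h' hh.2)⟩
    · rintro ⟨h, h'⟩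
      exact ⟨h, le_of_lt (not_le.1 fun hh => h' ⟨h, hh⟩)⟩
  rw [capArea, h1, h2, capArea, measureReal_sdiff (show cap K θ t ⊆ K from Set.inter_subset_left) hm
    hcomp.measure_lt_top.ne]

/-- A negative sum would mean that opposite caps cover `K` and overlap in a slab of positive area,
so `2δ` would exceed the area of `K`. Through this inequality the bound on `δ` fixes orientations in
`exists_ne_opposite` and `speed_pos`. -/
lemma waterHeight_add_nonneg (hconv : Convex ℝ K) (hcomp : IsCompact K)
    (hint : (interior K).Nonempty) (hδ : 0 < δ) (hδK : δ ≤ volume.real K / 2) {h : ℝ → ℝ}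
    (hh : ∀ θ, capArea K θ (h θ) = δ) (θ : ℝ) : 0 ≤ h θ + h (θ + Real.pi) := by
  by_contra! hcon
  have h1 := capArea_add_pi hcomp θ (h θ)
  rw [hh] at h1
  have h2 := capArea_strict hconv hcomp hint (θ := θ + Real.pi) (s := h (θ + Real.pi))
    (t := -h θ) (by linarith) (by rw [h1]; linarith) (by rw [hh]; linarith)
  rw [h1, hh] at h2
  linarith

/-! ### Chords -/

/-- `x` and `y` are the end points of the chord of `K` on a line through the interior. -/
structure IsChord (K : Set Plane) (θ t : ℝ) (x y : Plane) : Prop where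
  left_mem : x ∈ K
  right_mem : y ∈ K
  left_notMem : x ∉ interior K
  right_notMem : y ∉ interior K
  left_height : ⟪x, unitVec θ⟫_ℝ = t
  right_height : ⟪y, unitVec θ⟫_ℝ = t
  lt : ⟪y, unitVecPerp θ⟫_ℝ < ⟪x, unitVecPerp θ⟫_ℝ
  slice_eq : slice θ K t = Set.Icc ⟪y, unitVecPerp θ⟫_ℝ ⟪x, unitVecPerp θ⟫_ℝ
  interior : ∀ s ∈ Set.Ioo ⟪y, unitVecPerp θ⟫_ℝ ⟪x, unitVecPerp θ⟫_ℝ,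
    framePt θ t s ∈ interior K

lemma exists_isChord (hconv : Convex ℝ K) (hcomp : IsCompact K) {θ t : ℝ} {z : Plane}
    (hz : z ∈ interior K) (hzt : ⟪z, unitVec θ⟫_ℝ = t) : ∃ x y, IsChord K θ t x y := by
  set c := ⟪z, unitVecPerp θ⟫_ℝ with hc
  have hzc : framePt θ t c = z := by rw [← hzt, hc, framePt_inner]
  obtain ⟨a, b, hab, hI⟩ := exists_slice_eq_Icc hcomp hconv θ t ⟨c, by
    rw [slice, Set.mem_ofPred_eq, hzc]; exact interior_subset hz⟩
  have hnear : ∀ s, framePt θ t s ∈ interior K → s ∈ Set.Ioo a b := by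
    intro s hs
    have : slice θ K t ∈ 𝓝 s :=
      ((continuous_framePt_right θ t).tendsto s).eventually (mem_interior_iff_mem_nhds.1 hs)
    rw [hI] at this
    rwa [Icc_mem_nhds_iff] at this
  have hcI : c ∈ Set.Ioo a b := hnear c (hzc ▸ hz)
  have hmem : ∀ s ∈ Set.Icc a b, framePt θ t s ∈ K := fun s hs => by
    rw [← hI] at hs; exact hs
  have ha := hmem a ⟨le_rfl, hab⟩
  have hb := hmem b ⟨hab, le_rfl⟩
  refine ⟨framePt θ t b, framePt θ t a, ⟨hb, ha, fun h => lt_irrefl _ (hnear b h).2,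
    fun h => lt_irrefl _ (hnear a h).1, by simp, by simp, by simpa using hcI.1.trans hcI.2,
    by simpa using hI, fun s hs => ?_⟩⟩
  simp only [inner_framePt_unitVecPerp] at hs
  rcases lt_trichotomy s c with h | h | h
  · have hlt : a < c := hcI.1
    have := hconv.combo_interior_self_mem_interior (hzc ▸ hz) ha
      (a := (s - a) / (c - a)) (b := (c - s) / (c - a))
      (div_pos (by linarith [hs.1]) (by linarith)) (div_nonneg (by linarith) (by linarith))
      (by field_simp [show c - a ≠ 0 by linarith]; ring)
    rw [framePt_combo] at this
    convert this using 2 <;> field_simp [show c - a ≠ 0 by linarith] <;> ring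
  · rw [h, hzc]; exact hz
  · have hlt : c < b := hcI.2
    have := hconv.combo_interior_self_mem_interior (hzc ▸ hz) hb
      (a := (b - s) / (b - c)) (b := (s - c) / (b - c))
      (div_pos (by linarith [hs.2]) (by linarith)) (div_nonneg (by linarith) (by linarith))
      (by field_simp [show b - c ≠ 0 by linarith]; ring)
    rw [framePt_combo] at this
    convert this using 2 <;> field_simp [show b - c ≠ 0 by linarith] <;> ring

end Water
/-! ### Differentiation of integrals over caps -/

section CapDeriv

variable {K : Set Plane} {θ t : ℝ} {x y : Plane}

/-- A cap in slanted coordinates. -/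
def slantCap (K : Set Plane) (θ : ℝ) (v : ℝ × ℝ) : Set Plane :=
  K ∩ {q | v.2 ≤ ⟪q, unitVec θ⟫_ℝ + v.1 * ⟪q, unitVecPerp θ⟫_ℝ}

lemma isCompact_slantCap (hcomp : IsCompact K) (θ : ℝ) (v : ℝ × ℝ) :
    IsCompact (slantCap K θ v) :=
  hcomp.inter_right (isClosed_le continuous_const (by fun_prop))

/-- Dividing by the cosine turns a rotated half plane into the region above the graph `u = v.2 - v.1
* s` in the fixed frame. Slope and height can then be varied without moving the coordinates. -/
lemma cap_eq_slantCap (K : Set Plane) {θ φ : ℝ} (hφ : 0 < Real.cos (φ - θ)) (t : ℝ) :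
    cap K φ t = slantCap K θ (Real.tan (φ - θ), t / Real.cos (φ - θ)) := by
  ext q
  have h : ⟪q, unitVec φ⟫_ℝ = Real.cos (φ - θ) *
      (⟪q, unitVec θ⟫_ℝ + Real.tan (φ - θ) * ⟪q, unitVecPerp θ⟫_ℝ) := by
    rw [mul_add, ← mul_assoc, mul_comm (Real.cos _) (Real.tan _), Real.tan_mul_cos hφ.ne']
    simp only [inner_unitVec, inner_unitVecPerp, Real.cos_sub, Real.sin_sub]
    linear_combination (-(q 0 * Real.cos φ) - q 1 * Real.sin φ) * Real.sin_sq_add_cos_sq θ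
  simp only [cap, slantCap, Set.mem_inter_iff, Set.mem_ofPred_eq, h, div_le_iff₀' hφ]

lemma integral_slantCap (hcomp : IsCompact K) {f : Plane → ℝ} (hf : Continuous f) {R : ℝ}
    (hR : ∀ q ∈ K, ‖q‖ ≤ R) (θ : ℝ) (v : ℝ × ℝ) :
    Integrable (fun s => ∫ u in (v.2 - v.1 * s)..R, K.indicator f (framePt θ u s)) ∧
    ∫ q in slantCap K θ v, f q
      = ∫ s, ∫ u in (v.2 - v.1 * s)..R, K.indicator f (framePt θ u s) := by
  have hS := isCompact_slantCap hcomp θ v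
  have hi : IntegrableOn f (slantCap K θ v) := hf.continuousOn.integrableOn_compact hS
  have h1 := integral_frame_swap θ hS.measurableSet hi
  have hzero : ∀ u s, R < u → K.indicator f (framePt θ u s) = 0 := by
    intro u s hu
    apply Set.indicator_of_notMem
    intro h
    have h2 := abs_inner_unitVec_le θ (framePt θ u s)
    rw [inner_framePt_unitVec] at h2
    linarith [le_abs_self u, hR _ h]
  have h2 : ∀ s, ∫ u, (slantCap K θ v).indicator f (framePt θ u s)
      = ∫ u in (v.2 - v.1 * s)..R, K.indicator f (framePt θ u s) := by
    intro s
    set c := v.2 - v.1 * s with hc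
    have h3 : ∀ u, (slantCap K θ v).indicator f (framePt θ u s)
        = (Set.Ici c).indicator (fun u => K.indicator f (framePt θ u s)) u := by
      intro u
      have hmem : framePt θ u s ∈ slantCap K θ v ↔ framePt θ u s ∈ K ∧ c ≤ u := by
        simp only [slantCap, Set.mem_inter_iff, Set.mem_ofPred_eq, inner_framePt_unitVec,
          inner_framePt_unitVecPerp, hc, sub_le_iff_le_add]
      by_cases hu : c ≤ u
      · rw [Set.indicator_of_mem (show u ∈ Set.Ici c from hu)]
        by_cases hk : framePt θ u s ∈ K
        · rw [Set.indicator_of_mem hk, Set.indicator_of_mem (hmem.2 ⟨hk, hu⟩)]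
        · rw [Set.indicator_of_notMem hk, Set.indicator_of_notMem fun h => hk (hmem.1 h).1]
      · rw [Set.indicator_of_notMem (show u ∉ Set.Ici c from hu),
          Set.indicator_of_notMem fun h => hu (hmem.1 h).2]
    simp only [h3]
    rw [integral_indicator measurableSet_Ici, integral_Ici_eq_integral_Ioi]
    rcases le_or_gt c R with hcR | hcR
    · rw [intervalIntegral.integral_of_le hcR]
      refine (setIntegral_eq_of_subset_of_forall_sdiff_eq_zero measurableSet_Ioi
        (fun u hu => hu.1) fun u hu => hzero u s ?_)
      by_contra! hcon
      exact hu.2 ⟨hu.1, hcon⟩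
    · have h4 : ∫ u in Set.Ioi c, K.indicator f (framePt θ u s) = 0 :=
        setIntegral_eq_zero_of_forall_eq_zero fun u hu => hzero u s (hcR.trans hu)
      have h5 : ∫ u in Set.Ioc R c, K.indicator f (framePt θ u s) = 0 :=
        setIntegral_eq_zero_of_forall_eq_zero fun u hu => hzero u s hu.1
      rw [intervalIntegral.integral_of_ge hcR.le, h4, h5, neg_zero]
  refine ⟨?_, by rw [h1]; simp only [h2]⟩
  have hm := measurePreserving_framePt θ
  have he := framePt_measurableEmbedding θ
  have h3 := ((hm.integrable_comp_emb he).2 ((integrable_indicator_iff hS.measurableSet).2 hi))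
  rw [Measure.volume_eq_prod] at h3
  refine h3.integral_prod_right.congr (Filter.Eventually.of_forall fun s => ?_)
  exact h2 s

/-- Differentiation under the integral over `s`: the parameters occur only in the lower limit `v.2 -
v.1 * s` of the inner integral, which contributes minus the integrand on the chord times the
variation of the limit. With `|f| ≤ M` and `‖q‖ ≤ R` on `K`, the inner integral is Lipschitz with
constant `M * (1 + R)`. -/
lemma IsChord.hasFDerivAt_slantCap (hch : IsChord K θ t x y) (hcomp : IsCompact K)
    {f : Plane → ℝ} (hf : Continuous f) :
    ∃ L : ℝ × ℝ →L[ℝ] ℝ, HasFDerivAt (fun v => ∫ q in slantCap K θ v, f q) L (0, t) ∧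
      ∀ v : ℝ × ℝ, L v = ∫ s in Set.Icc ⟪y, unitVecPerp θ⟫_ℝ ⟪x, unitVecPerp θ⟫_ℝ,
        f (framePt θ t s) * (s * v.1 - v.2) := by
  obtain ⟨R, hR⟩ := hcomp.isBounded.exists_norm_le
  obtain ⟨M, hM⟩ := hcomp.exists_bound_of_continuousOn hf.continuousOn
  have hM0 : 0 ≤ M := (norm_nonneg _).trans (hM x hch.left_mem)
  have hR0 : 0 ≤ R := (norm_nonneg _).trans (hR x hch.left_mem)
  have hk_le : ∀ u s, ‖K.indicator f (framePt θ u s)‖ ≤ M := by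
    intro u s
    by_cases h : framePt θ u s ∈ K
    · rw [Set.indicator_of_mem h]; exact hM _ h
    · rw [Set.indicator_of_notMem h, norm_zero]; exact hM0
  have hk_zero : ∀ u s, R < |s| → K.indicator f (framePt θ u s) = 0 := by
    intro u s hs
    apply Set.indicator_of_notMem
    intro h
    have h2 := abs_inner_unitVecPerp_le θ (framePt θ u s)
    rw [inner_framePt_unitVecPerp] at h2
    linarith [hR _ h]
  have hkm : ∀ s, Measurable fun u => K.indicator f (framePt θ u s) := fun s =>
    (hf.measurable.indicator hcomp.measurableSet).comp
      ((continuous_framePt θ).comp (Continuous.prodMk_left s)).measurable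
  have hki : ∀ s a b, IntervalIntegrable (fun u => K.indicator f (framePt θ u s)) volume a b := by
    intro s a b
    refine (intervalIntegrable_const (c := M)).mono_fun (hkm s).aestronglyMeasurable ?_
    refine Filter.Eventually.of_forall fun u => ?_
    rw [Real.norm_of_nonneg hM0]; exact hk_le u s
  set F : ℝ × ℝ → ℝ → ℝ := fun v s => ∫ u in (v.2 - v.1 * s)..R, K.indicator f (framePt θ u s)
    with hF
  set Ls : ℝ → ℝ × ℝ →L[ℝ] ℝ := fun s =>
    ContinuousLinearMap.snd ℝ ℝ ℝ - s • ContinuousLinearMap.fst ℝ ℝ ℝ with hLs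
  set F' : ℝ → ℝ × ℝ →L[ℝ] ℝ := fun s => (-K.indicator f (framePt θ t s)) • Ls s with hF'
  have hgoal := hasFDerivAt_integral_of_dominated_loc_of_lip (μ := volume) (F := F) (F' := F')
    (x₀ := ((0 : ℝ), t)) (s := Set.univ)
    (bound := (Set.Icc (-R) R).indicator fun _ => M * (1 + R)) Filter.univ_mem
    (Filter.Eventually.of_forall fun v => (integral_slantCap hcomp hf hR θ v).1.1)
    (integral_slantCap hcomp hf hR θ _).1 ?_ ?_ ?_ ?_
  · refine ⟨∫ s, F' s, ?_, fun v => ?_⟩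
    · refine hgoal.2.congr_of_eventuallyEq (Filter.Eventually.of_forall fun v => ?_)
      exact (integral_slantCap hcomp hf hR θ v).2
    · rw [ContinuousLinearMap.integral_apply hgoal.1, ← integral_indicator measurableSet_Icc]
      congr 1
      funext s
      have hmem : framePt θ t s ∈ K ↔ s ∈ Set.Icc ⟪y, unitVecPerp θ⟫_ℝ ⟪x, unitVecPerp θ⟫_ℝ := by
        rw [← hch.slice_eq]; rfl
      by_cases hs : framePt θ t s ∈ K
      · rw [Set.indicator_of_mem (hmem.1 hs)]
        simp only [hF', hLs, Set.indicator_of_mem hs]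
        simp
        ring
      · rw [Set.indicator_of_notMem fun h => hs (hmem.2 h)]
        simp only [hF', Set.indicator_of_notMem hs]
        simp
  · change AEStronglyMeasurable ((fun s => -K.indicator f (framePt θ t s)) • Ls) volume
    apply AEStronglyMeasurable.smul
    · refine ((hf.measurable.indicator hcomp.measurableSet).comp
        (continuous_framePt_right θ t).measurable).neg.aestronglyMeasurable
    · exact (by fun_prop : Continuous Ls).aestronglyMeasurable
  · refine Filter.Eventually.of_forall fun s => ?_
    apply LipschitzOnWith.of_dist_le_mul
    intro v _ w _
    rw [Real.coe_nnabs]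
    change |F v s - F w s| ≤ _
    have hsub : F v s - F w s = ∫ u in (v.2 - v.1 * s)..(w.2 - w.1 * s),
        K.indicator f (framePt θ u s) := by
      simp only [hF]
      rw [sub_eq_iff_eq_add]
      exact (intervalIntegral.integral_add_adjacent_intervals (hki s _ _) (hki s _ _)).symm
    by_cases hs : s ∈ Set.Icc (-R) R
    · rw [Set.indicator_of_mem hs, hsub,
        abs_of_nonneg (show 0 ≤ M * (1 + R) by positivity)]
      have h1 := intervalIntegral.norm_integral_le_of_norm_le_const
        (a := v.2 - v.1 * s) (b := w.2 - w.1 * s)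
        (f := fun u => K.indicator f (framePt θ u s)) (C := M) fun u _ => hk_le u s
      rw [Real.norm_eq_abs] at h1
      refine h1.trans ?_
      rw [mul_assoc]
      apply mul_le_mul_of_nonneg_left _ hM0
      have h2 : |v.1 - w.1| ≤ dist v w := by
        rw [← Real.dist_eq, Prod.dist_eq]; exact le_max_left _ _
      have h3 : |v.2 - w.2| ≤ dist v w := by
        rw [← Real.dist_eq, Prod.dist_eq]; exact le_max_right _ _
      have h4 : |s| ≤ R := abs_le.2 hs
      calc |w.2 - w.1 * s - (v.2 - v.1 * s)| = |(v.1 - w.1) * s - (v.2 - w.2)| := by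
            congr 1; ring
        _ ≤ |(v.1 - w.1) * s| + |v.2 - w.2| := abs_sub _ _
        _ = |v.1 - w.1| * |s| + |v.2 - w.2| := by rw [abs_mul]
        _ ≤ dist v w * R + dist v w := by gcongr
        _ = (1 + R) * dist v w := by ring
    · have hs' : R < |s| := by
        rw [← not_le, abs_le]; exact hs
      rw [Set.indicator_of_notMem hs, hsub]
      simp [hk_zero _ s hs']
  · exact (integrable_indicator_iff measurableSet_Icc).2
      (continuousOn_const.integrableOn_compact isCompact_Icc)
  -- Inside the chord the vertical line is in `K` near level `t`, outside it is off `K`; in both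
  -- cases the integrand is continuous there. Only the two end points of the chord are exceptional.
  · have hae : ∀ᵐ s : ℝ, s ≠ ⟪y, unitVecPerp θ⟫_ℝ ∧ s ≠ ⟪x, unitVecPerp θ⟫_ℝ := by
      apply Filter.Eventually.and
      · exact Measure.ae_ne _ _
      · exact Measure.ae_ne _ _
    filter_upwards [hae] with s hs
    have hcont : ContinuousAt (fun u => K.indicator f (framePt θ u s)) t := by
      have hfc : ContinuousAt (fun u => framePt θ u s) t :=
        ((continuous_framePt θ).comp (Continuous.prodMk_left s)).continuousAt
      by_cases hI : s ∈ Set.Icc ⟪y, unitVecPerp θ⟫_ℝ ⟪x, unitVecPerp θ⟫_ℝ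
      · have hin := hch.interior s ⟨lt_of_le_of_ne hI.1 (Ne.symm hs.1), lt_of_le_of_ne hI.2 hs.2⟩
        have hev : ∀ᶠ u in 𝓝 t, framePt θ u s ∈ K :=
          hfc.eventually (mem_interior_iff_mem_nhds.1 hin)
        refine (hf.continuousAt.comp hfc).congr ?_
        filter_upwards [hev] with u hu
        rw [Set.indicator_of_mem hu]; rfl
      · have hnot : framePt θ t s ∉ K := fun h => hI (by rw [← hch.slice_eq]; exact h)
        have hev : ∀ᶠ u in 𝓝 t, framePt θ u s ∈ Kᶜ :=
          hfc.eventually (hcomp.isClosed.isOpen_compl.mem_nhds hnot)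
        refine (continuousAt_const (y := (0 : ℝ))).congr ?_
        filter_upwards [hev] with u hu
        rw [Set.indicator_of_notMem hu]
    have hd := intervalIntegral.integral_hasDerivAt_left (hki s t R)
      ((hkm s).stronglyMeasurable.stronglyMeasurableAtFilter) hcont
    have hlin : HasFDerivAt (fun v : ℝ × ℝ => v.2 - v.1 * s) (Ls s) (0, t) := by
      have : (fun v : ℝ × ℝ => v.2 - v.1 * s) = Ls s := by
        funext v; simp [hLs]; ring
      rw [this]
      exact (Ls s).hasFDerivAt
    have hd' : HasDerivAt (fun u => ∫ w in u..R, K.indicator f (framePt θ w s))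
        (-K.indicator f (framePt θ t s)) ((fun v : ℝ × ℝ => v.2 - v.1 * s) (0, t)) := by
      simpa using hd
    exact hd'.comp_hasFDerivAt ((0 : ℝ), t) hlin

/-- The change from angle and height to slanted parameters has identity derivative at `(θ, t)`, as
`tan' = 1` and `cos' = 0` at zero, so the derivative is unchanged. -/
lemma IsChord.hasFDerivAt_cap (hch : IsChord K θ t x y) (hcomp : IsCompact K)
    {f : Plane → ℝ} (hf : Continuous f) :
    ∃ L : ℝ × ℝ →L[ℝ] ℝ, HasFDerivAt (fun v : ℝ × ℝ => ∫ q in cap K v.1 v.2, f q) L (θ, t) ∧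
      ∀ v : ℝ × ℝ, L v = ∫ s in Set.Icc ⟪y, unitVecPerp θ⟫_ℝ ⟪x, unitVecPerp θ⟫_ℝ,
        f (framePt θ t s) * (s * v.1 - v.2) := by
  obtain ⟨L, hL, hLv⟩ := hch.hasFDerivAt_slantCap hcomp hf
  refine ⟨L, ?_, hLv⟩
  set g : ℝ × ℝ → ℝ × ℝ := fun v => (Real.tan (v.1 - θ), v.2 / Real.cos (v.1 - θ)) with hg
  have hg0 : g (θ, t) = (0, t) := by simp [hg]
  have h1 : HasFDerivAt (fun v : ℝ × ℝ => v.1 - θ) (ContinuousLinearMap.fst ℝ ℝ ℝ) (θ, t) :=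
    (hasFDerivAt_fst).sub_const θ
  have hc0 : Real.cos ((θ, t).1 - θ) = 1 := by simp
  have htan : HasFDerivAt (fun v : ℝ × ℝ => Real.tan (v.1 - θ))
      (ContinuousLinearMap.fst ℝ ℝ ℝ) (θ, t) := by
    have h := (Real.hasDerivAt_tan (x := (θ, t).1 - θ)
      (by rw [hc0]; exact one_ne_zero)).comp_hasFDerivAt (θ, t) h1
    exact h.congr_fderiv (by simp)
  have hcos : HasFDerivAt (fun v : ℝ × ℝ => (Real.cos (v.1 - θ))⁻¹)
      (0 : ℝ × ℝ →L[ℝ] ℝ) (θ, t) := by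
    have h := ((Real.hasDerivAt_cos ((θ, t).1 - θ)).inv
      (by rw [hc0]; exact one_ne_zero)).comp_hasFDerivAt (θ, t) h1
    exact h.congr_fderiv (by simp)
  have hdiv : HasFDerivAt (fun v : ℝ × ℝ => v.2 / Real.cos (v.1 - θ))
      (ContinuousLinearMap.snd ℝ ℝ ℝ) (θ, t) := by
    have h := (hasFDerivAt_snd (𝕜 := ℝ) (p := (θ, t))).mul hcos
    simp only [div_eq_mul_inv]
    exact h.congr_fderiv (by simp)
  have hgd : HasFDerivAt g (ContinuousLinearMap.id ℝ (ℝ × ℝ)) (θ, t) := by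
    have := htan.prodMk hdiv
    rwa [ContinuousLinearMap.fst_prod_snd] at this
  rw [← hg0] at hL
  have hcomp' := hL.comp (θ, t) hgd
  rw [ContinuousLinearMap.comp_id] at hcomp'
  refine hcomp'.congr_of_eventuallyEq ?_
  have hev : ∀ᶠ v : ℝ × ℝ in 𝓝 (θ, t), 0 < Real.cos (v.1 - θ) := by
    refine (by fun_prop : Continuous fun v : ℝ × ℝ => Real.cos (v.1 - θ)).tendsto (θ, t)
      |>.eventually (lt_mem_nhds ?_)
    rw [hc0]; exact one_pos
  filter_upwards [hev] with v hv
  simp only [Function.comp, hg]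
  rw [cap_eq_slantCap K hv]

end CapDeriv
/-! ### The normals of a smooth convex body -/

section Normals

variable {K : Set Plane}

lemma exists_unit_normal (hconv : Convex ℝ K) (hint : (interior K).Nonempty) {x : Plane}
    (hxi : x ∉ interior K) : ∃ n : Plane, ‖n‖ = 1 ∧ ∀ q ∈ K, ⟪q, n⟫_ℝ ≤ ⟪x, n⟫_ℝ := by
  obtain ⟨f, hf⟩ := geometric_hahn_banach_open_point hconv.interior isOpen_interior hxi
  set e : Plane := (InnerProductSpace.toDual ℝ Plane).symm f with he
  have hfe : ∀ v, f v = ⟪v, e⟫_ℝ := fun v => by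
    rw [he, real_inner_comm, InnerProductSpace.toDual_symm_apply]
  have he0 : e ≠ 0 := by
    intro h
    obtain ⟨z, hz⟩ := hint
    have := hf z hz
    rw [hfe, hfe, h, inner_zero_right, inner_zero_right] at this
    exact lt_irrefl _ this
  have hK : K ⊆ {q | ⟪q, e⟫_ℝ ≤ ⟪x, e⟫_ℝ} := by
    refine subset_closure.trans ?_
    rw [← hconv.closure_interior_eq_closure_of_nonempty_interior hint]
    refine closure_minimal (fun q hq => ?_) (isClosed_le (by fun_prop) continuous_const)
    have := hf q hq
    rw [hfe, hfe] at this
    exact this.le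
  have hn : 0 < ‖e‖ := norm_pos_iff.2 he0
  refine ⟨‖e‖⁻¹ • e, by rw [norm_smul, norm_inv, norm_norm, inv_mul_cancel₀ hn.ne'],
    fun q hq => ?_⟩
  rw [real_inner_smul_right, real_inner_smul_right]
  exact mul_le_mul_of_nonneg_left (hK hq) (inv_nonneg.2 hn.le)

/-- The boundary of a smooth convex body is tangent to its supporting lines. -/
lemma inner_normal_isLittleO (hK : HasUniqueNormals K) (hconv : Convex ℝ K)
    (hint : (interior K).Nonempty) {x n : Plane} (hx : x ∈ K) (hn : ‖n‖ = 1)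
    (hxn : ∀ q ∈ K, ⟪q, n⟫_ℝ ≤ ⟪x, n⟫_ℝ) {z : ℝ → Plane} {θ : ℝ} (hzx : z θ = x)
    (hzc : ContinuousAt z θ) (hzK : ∀ φ, z φ ∈ K) (hzi : ∀ φ, z φ ∉ interior K) :
    (fun φ => ⟪z φ - x, n⟫_ℝ) =o[𝓝 θ] fun φ => z φ - x := by
  rw [Asymptotics.isLittleO_iff]
  intro ε hε
  -- Normals converge: a unit vector `m` away from `n` is not a normal at `x`, some `k` in `K` shows
  -- this, and the same `k` works for nearby points and vectors. Compactness makes the neighbourhood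
  -- of `x` uniform in `m`.
  have hcpt : IsCompact (Metric.sphere (0 : Plane) 1 ∩ {m | ε ≤ ‖m - n‖}) :=
    (isCompact_sphere _ _).inter_right (isClosed_le continuous_const (by fun_prop))
  have hev : ∀ᶠ w in 𝓝 x, ∀ m ∈ Metric.sphere (0 : Plane) 1 ∩ {m | ε ≤ ‖m - n‖},
      ∃ k ∈ K, ⟪w, m⟫_ℝ < ⟪k, m⟫_ℝ := by
    apply hcpt.eventually_forall_of_forall_eventually
    rintro m ⟨hm1, hm2⟩
    have hm1' : ‖m‖ = 1 := by simpa using hm1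
    obtain ⟨k, hk, hlt⟩ : ∃ k ∈ K, ⟪x, m⟫_ℝ < ⟪k, m⟫_ℝ := by
      by_contra! hcon
      obtain ⟨c, hc, hmc⟩ := hK x hx n m (by rintro rfl; simp at hn) (by rintro rfl; simp at hm1')
        hxn hcon
      have : c = 1 := by
        rw [hmc, norm_smul, hn, mul_one, Real.norm_of_nonneg hc.le] at hm1'
        exact hm1'
      rw [hmc, this, one_smul] at hm2
      simp at hm2
      linarith
    have hopen : IsOpen {p : Plane × Plane | ⟪p.1, p.2⟫_ℝ < ⟪k, p.2⟫_ℝ} :=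
      isOpen_lt (by fun_prop) (by fun_prop)
    filter_upwards [hopen.mem_nhds hlt] with p hp
    exact ⟨k, hk, hp⟩
  have hzc' : Filter.Tendsto z (𝓝 θ) (𝓝 x) := by rw [← hzx]; exact hzc
  filter_upwards [hzc'.eventually hev] with φ hφ
  obtain ⟨m, hm, hzm⟩ := exists_unit_normal hconv hint (hzi φ)
  have hmn : ‖m - n‖ < ε := by
    by_contra! hcon
    obtain ⟨k, hk, hlt⟩ := hφ m ⟨by simpa using hm, hcon⟩
    exact absurd (hzm k hk) (not_le.2 hlt)
  -- With `m` normal at `z φ`, one has `⟪z φ - x, n⟫ ≤ 0 ≤ ⟪z φ - x, m⟫`, so the first is at most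
  -- `‖m - n‖ * ‖z φ - x‖` in absolute value.
  have h1 : ⟪z φ - x, n⟫_ℝ ≤ 0 := by
    rw [inner_sub_left]; linarith [hxn _ (hzK φ)]
  have h2 : 0 ≤ ⟪z φ - x, m⟫_ℝ := by
    rw [inner_sub_left]; linarith [hzm x hx]
  have h3 : ⟪z φ - x, m⟫_ℝ - ⟪z φ - x, n⟫_ℝ = ⟪z φ - x, m - n⟫_ℝ := by
    rw [inner_sub_right]
  have h4 := real_inner_le_norm (z φ - x) (m - n)
  have h5 := mul_le_mul_of_nonneg_left hmn.le (norm_nonneg (z φ - x))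
  rw [Real.norm_eq_abs, abs_of_nonpos h1]
  linarith

end Normals

/-- Absorption: the term that is small compared with `w` is moved to the left side, leaving a bound
by `k` alone. It yields Lipschitz bounds before differentiability is known. -/
lemma isBigO_of_norm_le {E : Type*} [NormedAddCommGroup E] {w : ℝ → E} {g k v : ℝ → ℝ}
    {l : Filter ℝ} {C : ℝ} (hg : g =o[l] w) (hk : k =O[l] v)
    (hw : ∀ φ, ‖w φ‖ ≤ C * (|g φ| + |k φ|)) : w =O[l] v := by
  have hC : 0 < 2 * (|C| + 1) := by positivity
  have h1 := hg.def (c := (2 * (|C| + 1))⁻¹) (inv_pos.2 hC)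
  refine Asymptotics.IsBigO.trans (Asymptotics.IsBigO.of_bound (2 * (|C| + 1)) ?_) hk
  filter_upwards [h1] with φ hφ
  have h2 := hw φ
  rw [Real.norm_eq_abs, inv_mul_eq_div, le_div_iff₀ hC] at hφ
  rw [Real.norm_eq_abs]
  have h3 : C * (|g φ| + |k φ|) ≤ (|C| + 1) * (|g φ| + |k φ|) :=
    mul_le_mul_of_nonneg_right (by linarith [le_abs_self C]) (by positivity)
  nlinarith

/-- A curve in the boundary of a smooth convex body whose points lie on a differentiable family
of transversal lines is differentiable. -/
lemma hasDerivAt_boundary {K : Set Plane} (hK : HasUniqueNormals K) (hconv : Convex ℝ K)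
    (hint : (interior K).Nonempty) {z : ℝ → Plane} {h : ℝ → ℝ} {h' θ : ℝ} {n : Plane}
    (hn : ‖n‖ = 1) (hzn : ∀ q ∈ K, ⟪q, n⟫_ℝ ≤ ⟪z θ, n⟫_ℝ)
    (hzc : ContinuousAt z θ) (hzK : ∀ φ, z φ ∈ K) (hzi : ∀ φ, z φ ∉ interior K)
    (hzh : ∀ φ, ⟪z φ, unitVec φ⟫_ℝ = h φ) (hh : HasDerivAt h h' θ)
    (hnt : ⟪n, unitVecPerp θ⟫_ℝ ≠ 0) :
    ∃ v, HasDerivAt z v θ ∧ ⟪v, n⟫_ℝ = 0 ∧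
      ⟪v, unitVec θ⟫_ℝ = h' - ⟪z θ, unitVecPerp θ⟫_ℝ := by
  set c := h' - ⟪z θ, unitVecPerp θ⟫_ℝ with hc
  set α := ⟪n, unitVec θ⟫_ℝ with hα
  set β := ⟪n, unitVecPerp θ⟫_ℝ with hβ
  have hg1 := inner_normal_isLittleO hK hconv hint (hzK θ) hn hzn rfl hzc hzK hzi
  -- the component normal to the line
  have hξ : HasDerivAt (fun φ => ⟪z θ, unitVec φ - unitVec θ⟫_ℝ) ⟪z θ, unitVecPerp θ⟫_ℝ θ := by
    have h1 := (hasDerivAt_const θ (z θ)).inner ℝ ((hasDerivAt_unitVec θ).sub_const (unitVec θ))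
    simpa using h1
  -- Product of a factor that tends to zero, by mere continuity of `z`, and a factor of order `φ -
  -- θ`.
  have hrem : HasDerivAt (fun φ => ⟪z φ - z θ, unitVec φ - unitVec θ⟫_ℝ) 0 θ := by
    rw [hasDerivAt_iff_isLittleO]
    simp only [sub_self, inner_zero_left, sub_zero, smul_zero]
    have h1 : (fun φ => z φ - z θ) =o[𝓝 θ] fun _ => (1 : ℝ) := by
      rw [Asymptotics.isLittleO_one_iff]
      have := hzc.sub_const (z θ)
      simpa using this
    have h2 : (fun φ => unitVec φ - unitVec θ) =O[𝓝 θ] fun φ => φ - θ :=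
      (hasDerivAt_unitVec θ).isBigO_sub
    have h3 : (fun φ => ⟪z φ - z θ, unitVec φ - unitVec θ⟫_ℝ)
        =O[𝓝 θ] fun φ => ‖z φ - z θ‖ * ‖unitVec φ - unitVec θ‖ :=
      Asymptotics.IsBigO.of_bound 1 (Filter.Eventually.of_forall fun φ => by
        rw [one_mul, Real.norm_eq_abs,
          Real.norm_of_nonneg (mul_nonneg (norm_nonneg _) (norm_nonneg _))]
        exact abs_real_inner_le_norm _ _)
    have h4 := h3.trans_isLittleO (h1.norm_left.mul_isBigO h2.norm_left)
    simpa using h4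
  have hg2 : HasDerivAt (fun φ => ⟪z φ, unitVec θ⟫_ℝ) c θ := by
    have h1 := (hh.sub hξ).sub hrem
    rw [sub_zero] at h1
    refine (h1.const_add 0).congr_of_eventuallyEq (Filter.Eventually.of_forall fun φ => ?_)
    simp only [Pi.sub_apply, ← hzh φ, inner_sub_left, inner_sub_right]
    ring
  have hdecomp : ∀ φ, ⟪z φ - z θ, n⟫_ℝ = α * ⟪z φ - z θ, unitVec θ⟫_ℝ
      + β * ⟪z φ - z θ, unitVecPerp θ⟫_ℝ := fun φ => by
    rw [inner_frame θ (z φ - z θ) n]; ring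
  -- By transversality the displacement is controlled by its components along `unitVec θ`, which is
  -- differentiable, and along `n`, which is negligible by tangency and is absorbed.
  have hO : (fun φ => z φ - z θ) =O[𝓝 θ] fun φ => φ - θ := by
    have hk : (fun φ => ⟪z φ - z θ, unitVec θ⟫_ℝ) =O[𝓝 θ] fun φ => φ - θ := by
      have := hg2.isBigO_sub
      simpa only [inner_sub_left] using this
    refine isBigO_of_norm_le (C := 1 + |β|⁻¹ + |β|⁻¹ * |α|) hg1 hk fun φ => ?_
    have h1 := norm_le_frame θ (z φ - z θ)
    have h2 : |⟪z φ - z θ, unitVecPerp θ⟫_ℝ|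
        ≤ |β|⁻¹ * (|⟪z φ - z θ, n⟫_ℝ| + |α| * |⟪z φ - z θ, unitVec θ⟫_ℝ|) := by
      rw [inv_mul_eq_div, le_div_iff₀ (abs_pos.2 hnt), mul_comm, ← abs_mul, ← abs_mul]
      have : β * ⟪z φ - z θ, unitVecPerp θ⟫_ℝ
          = ⟪z φ - z θ, n⟫_ℝ - α * ⟪z φ - z θ, unitVec θ⟫_ℝ := by rw [hdecomp]; ring
      rw [this]
      exact abs_sub _ _
    have hb : 0 ≤ |β|⁻¹ := by positivity
    have ha : 0 ≤ |α| := abs_nonneg _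
    have hA : 0 ≤ |⟪z φ - z θ, n⟫_ℝ| := abs_nonneg _
    have hB : 0 ≤ |⟪z φ - z θ, unitVec θ⟫_ℝ| := abs_nonneg _
    have e1 := mul_nonneg hb hB
    have e2 := mul_nonneg (mul_nonneg hb ha) hA
    nlinarith
  have hdn : HasDerivAt (fun φ => ⟪z φ - z θ, n⟫_ℝ) 0 θ := by
    rw [hasDerivAt_iff_isLittleO]
    simp only [sub_self, inner_zero_left, sub_zero, smul_zero]
    exact hg1.trans_isBigO hO
  have hg2' : HasDerivAt (fun φ => ⟪z φ - z θ, unitVec θ⟫_ℝ) c θ := by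
    simp only [inner_sub_left]
    exact hg2.sub_const _
  have hg3 : HasDerivAt (fun φ => ⟪z φ - z θ, unitVecPerp θ⟫_ℝ) (-(α * c) / β) θ := by
    have h1 := (hdn.sub (hg2'.const_mul α)).div_const β
    rw [zero_sub] at h1
    refine h1.congr_of_eventuallyEq (Filter.Eventually.of_forall fun φ => ?_)
    simp only [Pi.sub_apply, hdecomp]
    field_simp
    ring
  refine ⟨framePt θ c (-(α * c) / β), ?_, ?_, by simp⟩
  · have h1 := ((hg2'.smul_const (unitVec θ)).add (hg3.smul_const (unitVecPerp θ))).const_add (z θ)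
    refine h1.congr_of_eventuallyEq (Filter.Eventually.of_forall fun φ => ?_)
    have := framePt_inner θ (z φ - z θ)
    rw [framePt] at this
    simp only [Pi.add_apply, this]
    abel
  · rw [inner_frame θ _ n]
    simp only [inner_framePt_unitVec, inner_framePt_unitVecPerp]
    rw [← hα, ← hβ]
    field_simp
    ring

/-! ### The family of water lines -/

/-- The water lines of `K`: the heights and the end points of the chords. -/
structure IsWaterFamily (K : Set Plane) (δ : ℝ) (h : ℝ → ℝ) (X Y : ℝ → Plane) : Prop where
  convex : Convex ℝ K
  compact : IsCompact K
  nonempty : (interior K).Nonempty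
  normals : HasUniqueNormals K
  pos : 0 < δ
  lt : δ < volume.real K
  area : ∀ θ, capArea K θ (h θ) = δ
  chord : ∀ θ, IsChord K θ (h θ) (X θ) (Y θ)

lemma exists_isWaterFamily {K : Set Plane} {δ : ℝ} (hconv : Convex ℝ K) (hcomp : IsCompact K)
    (hint : (interior K).Nonempty) (hK : HasUniqueNormals K) (hδ : 0 < δ)
    (hδK : δ < volume.real K) : ∃ h X Y, IsWaterFamily K δ h X Y := by
  choose h hh using exists_capArea_eq hcomp hδ hδK
  have hex : ∀ θ, ∃ x y, IsChord K θ (h θ) x y := by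
    intro θ
    obtain ⟨z, hz, hzt⟩ := exists_interior_above hconv hint ((hh θ).symm ▸ hδ)
    obtain ⟨w, hw, hws⟩ := exists_interior_below hconv hint ((hh θ).symm ▸ hδK)
    obtain ⟨v, hv, hvt⟩ := exists_interior_height_eq hconv hw hz hws hzt
    exact exists_isChord hconv hcomp hv hvt
  choose X Y hXY using hex
  exact ⟨h, X, Y, hconv, hcomp, hint, hK, hδ, hδK, hh, hXY⟩

/-- The factor centred at the midpoint annihilates constants; the second moment of an interval about
its midpoint remains. -/
lemma setIntegral_Icc_moment (lo hi A B : ℝ) (h : lo ≤ hi) :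
    ∫ s in Set.Icc lo hi, (A + s * B) * (s * 1 - (lo + hi) / 2) = B * (hi - lo) ^ 3 / 12 := by
  rw [integral_Icc_eq_integral_Ioc, ← intervalIntegral.integral_of_le h]
  have hF : ∀ s ∈ Set.uIcc lo hi, HasDerivAt
      (fun s => A * (s ^ 2 / 2 - (lo + hi) / 2 * s) + B * (s ^ 3 / 3 - (lo + hi) / 2 * (s ^ 2 / 2)))
      ((A + s * B) * (s * 1 - (lo + hi) / 2)) s := by
    intro s _
    have h1 := hasDerivAt_id s
    have h2 := ((((h1.pow 2).div_const 2).sub (h1.const_mul ((lo + hi) / 2))).const_mul A).add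
      ((((h1.pow 3).div_const 3).sub
        (((h1.pow 2).div_const 2).const_mul ((lo + hi) / 2))).const_mul B)
    refine h2.congr_deriv ?_
    simp
    ring
  rw [intervalIntegral.integral_eq_sub_of_hasDerivAt hF
    (by apply Continuous.intervalIntegrable; fun_prop)]
  ring

namespace IsWaterFamily

variable {K : Set Plane} {δ : ℝ} {h : ℝ → ℝ} {X Y : ℝ → Plane}

lemma continuous_height (W : IsWaterFamily K δ h X Y) : Continuous h :=
  continuous_waterHeight W.convex W.compact W.nonempty W.pos W.lt W.area

lemma isWaterLine_iff (W : IsWaterFamily K δ h X Y) {θ t : ℝ} :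
    IsWaterLine K δ θ t ↔ t = h θ := by
  rw [_root_.isWaterLine_iff W.compact W.pos]
  constructor
  · intro ht
    exact capArea_inj W.convex W.compact W.nonempty W.pos W.lt ht (W.area θ)
  · rintro rfl
    exact W.area θ

/-- Dupin's theorem. The differential of the cap area is `l * (μ dθ - dt)`, where `l` is the length
of the chord and `μ` the position of its midpoint along the line. It vanishes to first order along
the curve of constant area; as the area is only known to be differentiable at the point, the
implicit differentiation is done by hand, with continuity of `h` and absorption. -/
lemma hasDerivAt_height (W : IsWaterFamily K δ h X Y) (θ : ℝ) :
    HasDerivAt h ((⟪Y θ, unitVecPerp θ⟫_ℝ + ⟪X θ, unitVecPerp θ⟫_ℝ) / 2) θ := by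
  obtain ⟨L, hL, hLv⟩ := (W.chord θ).hasFDerivAt_cap W.compact (f := fun _ => 1) continuous_const
  set a := ⟪Y θ, unitVecPerp θ⟫_ℝ with ha
  set b := ⟪X θ, unitVecPerp θ⟫_ℝ with hb
  have hab : a < b := (W.chord θ).lt
  have hLv' : ∀ v : ℝ × ℝ, L v = (b - a) * ((a + b) / 2 * v.1 - v.2) := by
    intro v
    have h1 := setIntegral_Icc_affine hab.le (-v.2) v.1
    rw [hLv]
    rw [show (fun s : ℝ => (1 : ℝ) * (s * v.1 - v.2)) = fun s => -v.2 + v.1 * s from by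
      funext s; ring, h1]
    ring
  have hcurve : Filter.Tendsto (fun φ => (φ, h φ)) (𝓝 θ) (𝓝 (θ, h θ)) :=
    (continuous_id.prodMk W.continuous_height).tendsto θ
  have h1 := (hasFDerivAt_iff_isLittleO.1 hL).comp_tendsto hcurve
  have h2 : (fun φ => L (φ - θ, h φ - h θ)) =o[𝓝 θ] fun φ => (φ - θ, h φ - h θ) := by
    have : (fun φ => L (φ - θ, h φ - h θ)) = fun φ => -((fun x' : ℝ × ℝ =>
        (∫ _q in cap K x'.1 x'.2, (1 : ℝ)) - (∫ _q in cap K (θ, h θ).1 (θ, h θ).2, (1 : ℝ))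
          - L (x' - (θ, h θ))) ∘ fun φ => (φ, h φ)) φ := by
      funext φ
      simp only [Function.comp, ← capArea_eq_integral, W.area]
      simp
    rw [this]
    exact h1.neg_left
  have hO : (fun φ => (φ - θ, h φ - h θ)) =O[𝓝 θ] fun φ => φ - θ := by
    refine isBigO_of_norm_le (C := 1 + |(a + b) / 2| + (b - a)⁻¹) h2
      (Asymptotics.isBigO_refl _ _) fun φ => ?_
    rw [hLv', Prod.norm_def]
    simp only [Real.norm_eq_abs]
    set μ := (a + b) / 2
    have hba : 0 < b - a := by linarith
    rw [abs_mul, abs_of_pos hba]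
    set d := |μ * (φ - θ) - (h φ - h θ)| with hd
    have e1 : |h φ - h θ| ≤ |μ| * |φ - θ| + d := by
      rw [hd, ← abs_mul]
      calc |h φ - h θ| = |μ * (φ - θ) - (μ * (φ - θ) - (h φ - h θ))| := by congr 1; ring
        _ ≤ _ := abs_sub _ _
    have e2 : (b - a)⁻¹ * ((b - a) * d) = d := by field_simp
    have hd0 : 0 ≤ d := abs_nonneg _
    have e3 : 0 ≤ (b - a)⁻¹ := by positivity
    have e4 : 0 ≤ |φ - θ| := abs_nonneg _
    have e5 : 0 ≤ |μ| := abs_nonneg _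
    have e6 := mul_nonneg e3 e4
    have e7 := mul_nonneg (add_nonneg zero_le_one e5) (mul_nonneg hba.le hd0)
    have e8 := mul_nonneg e5 e4
    refine max_le ?_ ?_ <;> nlinarith
  have h3 := h2.trans_isBigO hO
  rw [hasDerivAt_iff_isLittleO]
  have h4 := h3.const_mul_left (-(b - a)⁻¹)
  refine h4.congr_left fun φ => ?_
  rw [hLv']
  have hba : b - a ≠ 0 := by linarith
  simp only [smul_eq_mul]
  field_simp
  ring

lemma mem_left (W : IsWaterFamily K δ h X Y) (θ : ℝ) {q : Plane} (hq : q ∈ K)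
    (hqh : ⟪q, unitVec θ⟫_ℝ = h θ) :
    ⟪q, unitVecPerp θ⟫_ℝ ∈ Set.Icc ⟪Y θ, unitVecPerp θ⟫_ℝ ⟪X θ, unitVecPerp θ⟫_ℝ := by
  rw [← (W.chord θ).slice_eq, slice, Set.mem_ofPred_eq, ← hqh, framePt_inner]
  exact hq

/-- The end points of the chords depend continuously on the direction. -/
lemma continuousAt_of_extreme (W : IsWaterFamily K δ h X Y) {z : ℝ → Plane} {σ : ℝ} (θ : ℝ)
    (hz : ∀ φ, z φ ∈ K) (hzh : ∀ φ, ⟪z φ, unitVec φ⟫_ℝ = h φ)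
    (hext : ∀ φ, ∀ q ∈ K, ⟪q, unitVec φ⟫_ℝ = h φ →
      σ * ⟪q, unitVecPerp φ⟫_ℝ ≤ σ * ⟪z φ, unitVecPerp φ⟫_ℝ)
    (hσ : ∀ q ∈ K, ⟪q, unitVec θ⟫_ℝ = h θ → q ≠ z θ →
      ∃ s ∈ Set.Ioo ⟪Y θ, unitVecPerp θ⟫_ℝ ⟪X θ, unitVecPerp θ⟫_ℝ,
        σ * ⟪q, unitVecPerp θ⟫_ℝ < σ * s) :
    ContinuousAt z θ := by
  rw [ContinuousAt, tendsto_nhds]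
  intro U hU hmem
  have hξ := continuous_unitVec
  have hξ' := continuous_unitVecPerp
  have hh := W.continuous_height
  have hev : ∀ᶠ φ in 𝓝 θ, ∀ q ∈ K \ U, q ≠ z φ := by
    apply (W.compact.diff hU).eventually_forall_of_forall_eventually
    rintro q ⟨hqK, hqU⟩
    by_cases hq : ⟪q, unitVec θ⟫_ℝ = h θ
    -- An interior point of the chord lying beyond `q` stays in `K` on neighbouring water lines, so
    -- no point near `q` can be their extreme point.
    · obtain ⟨s, hs, hlt⟩ := hσ q hqK hq fun e => hqU (e ▸ hmem)
      have h1 : ∀ᶠ p : ℝ × Plane in 𝓝 (θ, q), framePt p.1 (h p.1) s ∈ K := by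
        have hc : Continuous fun p : ℝ × Plane => framePt p.1 (h p.1) s := by
          unfold framePt; fun_prop
        exact hc.continuousAt.eventually
          (mem_interior_iff_mem_nhds.1 ((W.chord θ).interior s hs))
      have h2 : ∀ᶠ p : ℝ × Plane in 𝓝 (θ, q), σ * ⟪p.2, unitVecPerp p.1⟫_ℝ < σ * s :=
        (isOpen_lt (by fun_prop : Continuous fun p : ℝ × Plane => σ * ⟪p.2, unitVecPerp p.1⟫_ℝ)
          continuous_const).mem_nhds hlt
      filter_upwards [h1, h2] with p hp1 hp2 he
      have h3 := hext p.1 _ hp1 (by simp)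
      rw [inner_framePt_unitVecPerp, ← he] at h3
      linarith
    · have hopen : IsOpen {p : ℝ × Plane | ⟪p.2, unitVec p.1⟫_ℝ ≠ h p.1} :=
        isOpen_ne_fun (by fun_prop) (by fun_prop)
      filter_upwards [hopen.mem_nhds hq] with p hp he
      exact hp (he ▸ hzh p.1)
  filter_upwards [hev] with φ hφ
  by_contra hcon
  exact hφ (z φ) ⟨hz φ, hcon⟩ rfl

lemma continuousAt_left (W : IsWaterFamily K δ h X Y) (θ : ℝ) : ContinuousAt X θ := by
  refine W.continuousAt_of_extreme (σ := 1) θ (fun φ => (W.chord φ).left_mem)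
    (fun φ => (W.chord φ).left_height) (fun φ q hq hqh => ?_) (fun q hq hqh hne => ?_)
  · linarith [(W.mem_left φ hq hqh).2]
  · have h1 := W.mem_left θ hq hqh
    have h2 : ⟪q, unitVecPerp θ⟫_ℝ < ⟪X θ, unitVecPerp θ⟫_ℝ :=
      lt_of_le_of_ne h1.2 fun e => hne (frame_ext θ (hqh.trans (W.chord θ).left_height.symm) e)
    exact ⟨(⟪q, unitVecPerp θ⟫_ℝ + ⟪X θ, unitVecPerp θ⟫_ℝ) / 2,
      ⟨by linarith [h1.1], by linarith⟩, by linarith⟩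

lemma continuousAt_right (W : IsWaterFamily K δ h X Y) (θ : ℝ) : ContinuousAt Y θ := by
  refine W.continuousAt_of_extreme (σ := -1) θ (fun φ => (W.chord φ).right_mem)
    (fun φ => (W.chord φ).right_height) (fun φ q hq hqh => ?_) (fun q hq hqh hne => ?_)
  · linarith [(W.mem_left φ hq hqh).1]
  · have h1 := W.mem_left θ hq hqh
    have h2 : ⟪Y θ, unitVecPerp θ⟫_ℝ < ⟪q, unitVecPerp θ⟫_ℝ :=
      lt_of_le_of_ne h1.1 fun e =>
        hne (frame_ext θ (hqh.trans (W.chord θ).right_height.symm) e.symm)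
    exact ⟨(⟪q, unitVecPerp θ⟫_ℝ + ⟪Y θ, unitVecPerp θ⟫_ℝ) / 2,
      ⟨by linarith, by linarith [h1.2]⟩, by linarith⟩

lemma exists_interior (W : IsWaterFamily K δ h X Y) (θ : ℝ) :
    ∃ z ∈ interior K, ⟪z, unitVec θ⟫_ℝ = h θ :=
  ⟨_, (W.chord θ).interior _ ⟨left_lt_add_div_two.2 (W.chord θ).lt,
    add_div_two_lt_right.2 (W.chord θ).lt⟩, by simp⟩

/-- Otherwise the supporting line would be the water line itself, which meets the interior. -/
lemma transversal (W : IsWaterFamily K δ h X Y) {θ : ℝ} {x n : Plane}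
    (hx : ⟪x, unitVec θ⟫_ℝ = h θ) (hn : n ≠ 0) (hxn : ∀ q ∈ K, ⟪q, n⟫_ℝ ≤ ⟪x, n⟫_ℝ) :
    ⟪n, unitVecPerp θ⟫_ℝ ≠ 0 := by
  intro h0
  obtain ⟨z, hz, hzh⟩ := W.exists_interior θ
  have h1 := inner_lt_of_mem_interior hz hn hxn
  rw [inner_frame θ z n, inner_frame θ x n, h0, hzh, hx] at h1
  simp at h1

/-- The length of the chord. -/
def len (X Y : ℝ → Plane) (θ : ℝ) : ℝ := ⟪X θ, unitVecPerp θ⟫_ℝ - ⟪Y θ, unitVecPerp θ⟫_ℝ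

lemma len_pos (W : IsWaterFamily K δ h X Y) (θ : ℝ) : 0 < len X Y θ := sub_pos.2 (W.chord θ).lt

lemma dir (W : IsWaterFamily K δ h X Y) (θ : ℝ) : X θ - Y θ = len X Y θ • unitVecPerp θ := by
  apply frame_ext θ
  · rw [inner_sub_left, (W.chord θ).left_height, (W.chord θ).right_height, real_inner_smul_left]
    simp
  · rw [inner_sub_left, real_inner_smul_left]
    simp [len]

/-- The derivatives of the end points are tangent to the boundary of `K`. -/
lemma exists_hasDerivAt (W : IsWaterFamily K δ h X Y) (θ : ℝ) :
    ∃ vx vy n m : Plane, HasDerivAt X vx θ ∧ HasDerivAt Y vy θ ∧ n ≠ 0 ∧ m ≠ 0 ∧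
      (∀ q ∈ K, ⟪q, n⟫_ℝ ≤ ⟪X θ, n⟫_ℝ) ∧ (∀ q ∈ K, ⟪q, m⟫_ℝ ≤ ⟪Y θ, m⟫_ℝ) ∧
      ⟪vx, n⟫_ℝ = 0 ∧ ⟪vy, m⟫_ℝ = 0 ∧ ⟪vx, unitVec θ⟫_ℝ = -(len X Y θ / 2) ∧
      ⟪vy, unitVec θ⟫_ℝ = len X Y θ / 2 := by
  obtain ⟨n, hn, hXn⟩ := exists_unit_normal W.convex W.nonempty (W.chord θ).left_notMem
  obtain ⟨m, hm, hYm⟩ := exists_unit_normal W.convex W.nonempty (W.chord θ).right_notMem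
  have hn0 : n ≠ 0 := by rintro rfl; simp at hn
  have hm0 : m ≠ 0 := by rintro rfl; simp at hm
  obtain ⟨vx, h1, h2, h3⟩ := hasDerivAt_boundary W.normals W.convex W.nonempty hn hXn
    (W.continuousAt_left θ) (fun φ => (W.chord φ).left_mem) (fun φ => (W.chord φ).left_notMem)
    (fun φ => (W.chord φ).left_height) (W.hasDerivAt_height θ)
    (W.transversal (W.chord θ).left_height hn0 hXn)
  obtain ⟨vy, h4, h5, h6⟩ := hasDerivAt_boundary W.normals W.convex W.nonempty hm hYm
    (W.continuousAt_right θ) (fun φ => (W.chord φ).right_mem) (fun φ => (W.chord φ).right_notMem)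
    (fun φ => (W.chord φ).right_height) (W.hasDerivAt_height θ)
    (W.transversal (W.chord θ).right_height hm0 hYm)
  refine ⟨vx, vy, n, m, h1, h4, hn0, hm0, hXn, hYm, h2, h5, ?_, ?_⟩
  · rw [h3, len]; ring
  · rw [h6, len]; ring

end IsWaterFamily
/-! ### Mid points of the chords, centroids of the caps, and poles -/

lemma homothety_eq (c : Plane) (r : ℝ) (p : Plane) :
    AffineMap.homothety c r p = c + r • (p - c) := by
  rw [AffineMap.homothety_apply, vsub_eq_sub, vadd_eq_add, add_comm]

lemma hasDerivAt_of_inner {f : ℝ → Plane} {f' : Plane} {θ : ℝ}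
    (hf : ∀ e : Plane, HasDerivAt (fun φ => ⟪f φ, e⟫_ℝ) ⟪f', e⟫_ℝ θ) : HasDerivAt f f' θ := by
  have h0 := hf (unitVec 0)
  have h1 := hf (unitVecPerp 0)
  simp only [inner_unitVec, inner_unitVecPerp, Real.cos_zero, Real.sin_zero, mul_one, mul_zero,
    add_zero, neg_zero, zero_add] at h0 h1
  exact hasDerivAt_plane h0 h1

lemma memTangentLine_left {K : Set Plane} {p x y : Plane} (hc : IsContact K p x y) :
    MemTangentLine K x p := by
  have hx : x - p ≠ 0 := by
    intro h0
    have := hc.pos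
    simp [h0, cross] at this
  refine ⟨-perp (x - p), neg_ne_zero.2 (perp_ne_zero hx), fun q hq => ?_, ?_⟩
  · have h1 := hc.left_nonneg q hq
    have h2 := cross_same (x - p)
    rw [cross_eq_inner, inner_sub_left] at h1 h2
    rw [inner_neg_right, inner_neg_right]
    linarith
  · have h2 := cross_same (x - p)
    rw [cross_eq_inner, inner_sub_left] at h2
    rw [inner_neg_right, inner_neg_right]
    linarith

lemma memTangentLine_right {K : Set Plane} {p x y : Plane} (hc : IsContact K p x y) :
    MemTangentLine K y p := by
  have hy : y - p ≠ 0 := by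
    intro h0
    have := hc.pos
    simp [h0, cross] at this
  refine ⟨perp (y - p), perp_ne_zero hy, fun q hq => ?_, ?_⟩
  · have h1 := hc.right_nonpos q hq
    have h2 := cross_same (y - p)
    rw [cross_eq_inner, inner_sub_left] at h1 h2
    linarith
  · have h2 := cross_same (y - p)
    rw [cross_eq_inner, inner_sub_left] at h2
    linarith

lemma MemTangentLine.notMem_interior {K : Set Plane} {x p : Plane} (h : MemTangentLine K x p) :
    x ∉ interior K := by
  obtain ⟨n, hn, hx, -⟩ := h
  exact fun hi => lt_irrefl _ (inner_lt_of_mem_interior hi hn hx)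

/-- The sign of the cross product with a point of a tangent line is constant on `K`. -/
lemma MemTangentLine.exists_cross {K : Set Plane} {x p : Plane} (h : MemTangentLine K x p)
    (hxp : x ≠ p) : ∃ a : ℝ, a ≠ 0 ∧ ∀ k ∈ K, a * cross (x - p) (k - p) ≤ 0 := by
  obtain ⟨n, hn, hx, hp⟩ := h
  obtain ⟨a, rfl⟩ := eq_smul_perp (v := x - p) (sub_ne_zero.2 hxp) (n := n)
    (by rw [inner_sub_left, hp, sub_self])
  refine ⟨a, fun h0 => hn (by rw [h0, zero_smul]), fun k hk => ?_⟩
  have h1 := hx k hk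
  rw [← hp] at h1
  rw [cross_eq_inner, ← real_inner_smul_right, inner_sub_left]
  linarith

lemma isContact_of_memTangentLine {K : Set Plane} {p x y : Plane} (hx : x ∈ K) (hy : y ∈ K)
    (hxp : MemTangentLine K x p) (hyp : MemTangentLine K y p)
    (hpos : 0 < cross (x - p) (y - p)) : IsContact K p x y := by
  obtain ⟨a, ha, ha'⟩ := hxp.exists_cross (by rintro rfl; simp [cross] at hpos)
  obtain ⟨b, hb, hb'⟩ := hyp.exists_cross (by rintro rfl; simp [cross] at hpos)
  have h1 := ha' y hy
  have h2 := hb' x hx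
  rw [cross_swap] at h2
  have ha0 : a < 0 := lt_of_le_of_ne (nonpos_of_mul_nonpos_left h1 hpos) ha
  have hb0 : 0 < b := lt_of_le_of_ne (by nlinarith) hb.symm
  exact ⟨hx, hy, fun k hk => by nlinarith [ha' k hk], fun k hk => by nlinarith [hb' k hk], hpos⟩

/-- The image of the critical points of a real function is null. -/
lemma volume_image_critical_eq_zero {g : ℝ → ℝ} {s : Set ℝ} (hg : ∀ τ ∈ s, HasDerivAt g 0 τ) :
    volume (g '' s) = 0 := by
  refine addHaar_image_eq_zero_of_det_fderivWithin_eq_zero volume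
    (fun τ hτ => (hg τ hτ).hasFDerivAt.hasFDerivWithinAt) (fun τ _ => ?_)
  simp

/-- The mid points of the chords. -/
def mid (X Y : ℝ → Plane) (θ : ℝ) : Plane := (1 / 2 : ℝ) • (X θ + Y θ)

/-- The centroids of the caps. -/
def capCentroid (K : Set Plane) (h : ℝ → ℝ) (θ : ℝ) : Plane := areaCentroid (cap K θ (h θ))

namespace IsWaterFamily

variable {K : Set Plane} {δ : ℝ} {h : ℝ → ℝ} {X Y : ℝ → Plane}

lemma mid_height (W : IsWaterFamily K δ h X Y) (θ : ℝ) : ⟪mid X Y θ, unitVec θ⟫_ℝ = h θ := by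
  rw [mid, real_inner_smul_left, inner_add_left, (W.chord θ).left_height,
    (W.chord θ).right_height]
  ring

lemma mid_width (θ : ℝ) : ⟪mid X Y θ, unitVecPerp θ⟫_ℝ
    = (⟪Y θ, unitVecPerp θ⟫_ℝ + ⟪X θ, unitVecPerp θ⟫_ℝ) / 2 := by
  rw [mid, real_inner_smul_left, inner_add_left]
  ring

lemma hasDerivAt_height' (W : IsWaterFamily K δ h X Y) (θ : ℝ) :
    HasDerivAt h ⟪mid X Y θ, unitVecPerp θ⟫_ℝ θ := by
  rw [mid_width]
  exact W.hasDerivAt_height θ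

lemma eq_mid_iff (W : IsWaterFamily K δ h X Y) {θ : ℝ} {q : Plane} :
    q = mid X Y θ ↔ ⟪q, unitVec θ⟫_ℝ = h θ ∧ HasDerivAt h ⟪q, unitVecPerp θ⟫_ℝ θ := by
  constructor
  · rintro rfl
    exact ⟨W.mid_height θ, W.hasDerivAt_height' θ⟩
  · rintro ⟨h1, h2⟩
    exact frame_ext θ (h1.trans (W.mid_height θ).symm) (h2.unique (W.hasDerivAt_height' θ))

lemma flotationCurve_eq (W : IsWaterFamily K δ h X Y) :
    flotationCurve K δ = Set.range (mid X Y) := by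
  ext q
  constructor
  · rintro ⟨g, hg, θ, h1, h2⟩
    obtain rfl : g = h := funext fun φ => W.isWaterLine_iff.1 (hg φ)
    exact ⟨θ, (W.eq_mid_iff.2 ⟨h1, h2⟩).symm⟩
  · rintro ⟨θ, rfl⟩
    exact ⟨h, fun φ => W.isWaterLine_iff.2 rfl, θ, W.eq_mid_iff.1 rfl⟩

lemma buoyancyCurve_eq (W : IsWaterFamily K δ h X Y) :
    buoyancyCurve K δ = Set.range (capCentroid K h) := by
  ext q
  constructor
  · rintro ⟨θ, t, ht, rfl⟩
    exact ⟨θ, by rw [W.isWaterLine_iff.1 ht]; rfl⟩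
  · rintro ⟨θ, rfl⟩
    exact ⟨θ, h θ, W.isWaterLine_iff.2 rfl, rfl⟩

lemma inner_capCentroid (W : IsWaterFamily K δ h X Y) (θ : ℝ) (e : Plane) :
    δ * ⟪capCentroid K h θ, e⟫_ℝ = ∫ q in cap K θ (h θ), ⟪q, e⟫_ℝ :=
  inner_areaCentroid W.pos.ne' (W.area θ) (isCompact_cap W.compact θ _).isBounded e

/-- Because `h'` is the position of the midpoint, the first moment changes by the integral over the
chord of `⟪q, e⟫` against the centred coordinate, in which only the component along the chord
survives, with factor `l³/12`. -/
lemma hasDerivAt_capCentroid (W : IsWaterFamily K δ h X Y) (θ : ℝ) :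
    HasDerivAt (capCentroid K h) ((len X Y θ ^ 3 / (12 * δ)) • unitVecPerp θ) θ := by
  refine hasDerivAt_of_inner fun e => ?_
  obtain ⟨L, hL, hLv⟩ := (W.chord θ).hasFDerivAt_cap W.compact
    (f := fun q => ⟪q, e⟫_ℝ) (by fun_prop)
  have h1 := hL.comp_hasDerivAt θ ((hasDerivAt_id θ).prodMk (W.hasDerivAt_height θ))
  have h2 := h1.const_mul δ⁻¹
  have hδ := W.pos.ne'
  have hfun : (fun φ => ⟪capCentroid K h φ, e⟫_ℝ) = fun φ => δ⁻¹ *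
      ((fun v : ℝ × ℝ => ∫ q in cap K v.1 v.2, ⟪q, e⟫_ℝ) ∘ fun φ => (id φ, h φ)) φ := by
    funext φ
    simp only [Function.comp, id, ← W.inner_capCentroid]
    field_simp
  rw [hfun]
  refine h2.congr_deriv ?_
  rw [hLv]
  simp only [inner_framePt]
  rw [setIntegral_Icc_moment _ _ _ _ (W.chord θ).lt.le, real_inner_smul_left, len]
  field_simp

lemma height_lt_capCentroid (W : IsWaterFamily K δ h X Y) (θ : ℝ) :
    h θ < ⟪capCentroid K h θ, unitVec θ⟫_ℝ := by
  have hcap := isCompact_cap W.compact θ (h θ)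
  have hint : ∀ {f : Plane → ℝ}, Continuous f → IntegrableOn f (cap K θ (h θ)) :=
    fun hf => hf.continuousOn.integrableOn_compact hcap
  have h1 : 0 < ∫ q in cap K θ (h θ), (⟪q, unitVec θ⟫_ℝ - h θ) := by
    rw [setIntegral_pos_iff_support_of_nonneg_ae]
    · have hsub : cap K θ (h θ) \ lineAt θ (h θ) ⊆
          Function.support (fun q => ⟪q, unitVec θ⟫_ℝ - h θ) ∩ cap K θ (h θ) :=
        fun q hq => ⟨sub_ne_zero.2 hq.2, hq.1⟩
      refine lt_of_lt_of_le ?_ (measure_mono hsub)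
      rw [measure_sdiff_null (volume_lineAt θ (h θ)), W.isWaterLine_iff.2 rfl]
      exact ENNReal.ofReal_pos.2 W.pos
    · filter_upwards [ae_restrict_mem hcap.measurableSet] with q hq
      exact sub_nonneg.2 hq.2
    · exact hint (by fun_prop)
  rw [integral_sub (hint (by fun_prop)) (hint continuous_const), ← W.inner_capCentroid,
    setIntegral_const, smul_eq_mul] at h1
  have h2 : volume.real (cap K θ (h θ)) = δ := W.area θ
  rw [h2, ← mul_sub] at h1
  linarith [pos_of_mul_pos_right h1 W.pos.le]

/-- Among the caps of a given area, the cap with normal `ξ` has the highest centroid. -/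
lemma capCentroid_le (W : IsWaterFamily K δ h X Y) (θ φ : ℝ) :
    ⟪capCentroid K h φ, unitVec θ⟫_ℝ ≤ ⟪capCentroid K h θ, unitVec θ⟫_ℝ := by
  have hint : ∀ (τ : ℝ) {f : Plane → ℝ}, Continuous f → IntegrableOn f (cap K τ (h τ)) :=
    fun τ _ hf => hf.continuousOn.integrableOn_compact (isCompact_cap W.compact τ _)
  have hval : ∀ τ, ∫ q in cap K τ (h τ), (⟪q, unitVec θ⟫_ℝ - h θ)
      = δ * (⟪capCentroid K h τ, unitVec θ⟫_ℝ - h θ) := fun τ => by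
    have h2 : volume.real (cap K τ (h τ)) = δ := W.area τ
    rw [integral_sub (hint τ (by fun_prop)) (hint τ continuous_const), ← W.inner_capCentroid,
      setIntegral_const, smul_eq_mul, h2]
    ring
  -- The positive part of the height above the water line dominates the height on every cap, and its
  -- integral over `K` is attained by the cap in direction `θ`.
  set f : Plane → ℝ := fun q => max (⟪q, unitVec θ⟫_ℝ - h θ) 0 with hf
  have hfc : Continuous f := by fun_prop
  have h1 : ∫ q in cap K φ (h φ), (⟪q, unitVec θ⟫_ℝ - h θ) ≤ ∫ q in cap K φ (h φ), f q :=
    integral_mono (hint φ (by fun_prop)) (hint φ hfc) fun q => le_max_left _ _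
  have h2 : ∫ q in cap K φ (h φ), f q ≤ ∫ q in K, f q :=
    setIntegral_mono_set (hfc.continuousOn.integrableOn_compact W.compact)
      (Filter.Eventually.of_forall fun q => le_max_right _ _)
      (LE.le.eventuallyLE Set.inter_subset_left)
  have hm : MeasurableSet {q : Plane | h θ ≤ ⟪q, unitVec θ⟫_ℝ} :=
    measurableSet_le measurable_const (by fun_prop)
  have h3 : ∫ q in K, f q = ∫ q in cap K θ (h θ), (⟪q, unitVec θ⟫_ℝ - h θ) := by
    rw [cap, ← setIntegral_indicator hm]
    refine integral_congr_ae (Filter.Eventually.of_forall fun q => ?_)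
    by_cases hq : h θ ≤ ⟪q, unitVec θ⟫_ℝ
    · simp only [hf]
      rw [Set.indicator_of_mem (show q ∈ {q : Plane | h θ ≤ ⟪q, unitVec θ⟫_ℝ} from hq),
        max_eq_left (sub_nonneg.2 hq)]
    · simp only [hf]
      rw [Set.indicator_of_notMem (show q ∉ {q : Plane | h θ ≤ ⟪q, unitVec θ⟫_ℝ} from hq),
        max_eq_right (by linarith)]
  have h4 := h1.trans (h2.trans h3.le)
  rw [hval, hval] at h4
  linarith [le_of_mul_le_mul_left h4 W.pos]

/-- The curve of mid points, and the poles of the water lines. -/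
lemma exists_speed (W : IsWaterFamily K δ h X Y) (θ : ℝ) :
    ∃ ρ : ℝ, HasDerivAt (mid X Y) (ρ • unitVecPerp θ) θ ∧
      (∀ p, MemTangentLine K (X θ) p → MemTangentLine K (Y θ) p →
        4 * ρ * (⟪p, unitVec θ⟫_ℝ - h θ) = len X Y θ ^ 2) ∧
      (ρ ≠ 0 → ∃ p, MemTangentLine K (X θ) p ∧ MemTangentLine K (Y θ) p) := by
  obtain ⟨vx, vy, n, m, hvx, hvy, hn, hm, hXn, hYm, h1, h2, h3, h4⟩ := W.exists_hasDerivAt θ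
  have hnt := W.transversal (W.chord θ).left_height hn hXn
  have hmt := W.transversal (W.chord θ).right_height hm hYm
  have hl := W.len_pos θ
  have hlen : ⟪Y θ, unitVecPerp θ⟫_ℝ = ⟪X θ, unitVecPerp θ⟫_ℝ - len X Y θ := by rw [len]; ring
  rw [inner_frame θ, h3] at h1
  rw [inner_frame θ, h4] at h2
  have hinner : ∀ v w : Plane, ⟪v, w⟫_ℝ = ⟪v, unitVec θ⟫_ℝ * ⟪w, unitVec θ⟫_ℝ
      + ⟪v, unitVecPerp θ⟫_ℝ * ⟪w, unitVecPerp θ⟫_ℝ := inner_frame θ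
  have hXh := (W.chord θ).left_height
  have hYh := (W.chord θ).right_height
  set l := len X Y θ
  set a := ⟪vx, unitVecPerp θ⟫_ℝ with ha
  set b := ⟪vy, unitVecPerp θ⟫_ℝ with hb
  refine ⟨(a + b) / 2, ?_, fun p hpX hpY => ?_, fun hρ => ?_⟩
  · have h5 := (hvx.add hvy).const_smul (1 / 2 : ℝ)
    refine h5.congr_deriv (frame_ext θ ?_ ?_)
    · simp only [real_inner_smul_left, inner_add_left, h3, h4, inner_unitVecPerp_unitVec]
      ring
    · simp only [real_inner_smul_left, inner_add_left, ← ha, ← hb, inner_unitVecPerp_self]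
      ring
  · obtain ⟨n', hn', hXn', hp⟩ := hpX
    obtain ⟨m', hm', hYm', hp'⟩ := hpY
    obtain ⟨c, hc, rfl⟩ := W.normals _ (W.chord θ).left_mem n' n hn' hn hXn' hXn
    obtain ⟨d, hd, rfl⟩ := W.normals _ (W.chord θ).right_mem m' m hm' hm hYm' hYm
    rw [hinner p, hinner (X θ), hXh] at hp
    rw [hinner p, hinner (Y θ), hYh, hlen] at hp'
    simp only [real_inner_smul_left] at h1 h2 hnt hmt
    have hnt' := right_ne_zero_of_mul hnt
    have hmt' := right_ne_zero_of_mul hmt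
    -- `p - X` is parallel to the velocity `(-l/2, a)` of `X`, and `p - Y` to the velocity `(l/2,
    -- b)` of `Y`. The difference of the two proportions eliminates the position of `p` along the
    -- line.
    have e1 : (⟪p, unitVecPerp θ⟫_ℝ - ⟪X θ, unitVecPerp θ⟫_ℝ) * (l / 2)
        = -((⟪p, unitVec θ⟫_ℝ - h θ) * a) := by
      apply mul_left_cancel₀ (mul_ne_zero hc.ne' hnt')
      linear_combination c * (l / 2) * hp + (⟪p, unitVec θ⟫_ℝ - h θ) * h1
    have e2 : (⟪p, unitVecPerp θ⟫_ℝ - ⟪X θ, unitVecPerp θ⟫_ℝ + l) * (l / 2)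
        = (⟪p, unitVec θ⟫_ℝ - h θ) * b := by
      apply mul_left_cancel₀ (mul_ne_zero hd.ne' hmt')
      linear_combination d * (l / 2) * hp' - (⟪p, unitVec θ⟫_ℝ - h θ) * h2
    linear_combination (-2) * (e2 - e1)
  · have hab : a + b ≠ 0 := fun h0 => hρ (by rw [h0, zero_div])
    -- Intersection of the line through `X` with direction `(-l/2, a)` and the line through `Y` with
    -- direction `(l/2, b)`.
    refine ⟨framePt θ (h θ + l ^ 2 / (2 * (a + b))) (⟪X θ, unitVecPerp θ⟫_ℝ - a * l / (a + b)),
      ⟨n, hn, hXn, ?_⟩, ⟨m, hm, hYm, ?_⟩⟩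
    · rw [hinner (framePt _ _ _) n, hinner (X θ) n, hXh, inner_framePt_unitVec, inner_framePt_unitVecPerp]
      field_simp
      linear_combination (-2 * l) * h1
    · rw [hinner (framePt _ _ _) m, hinner (Y θ) m, hYh, hlen, inner_framePt_unitVec, inner_framePt_unitVecPerp]
      field_simp
      linear_combination (2 * l) * h2

lemma isPole_iff (W : IsWaterFamily K δ h X Y) {θ : ℝ} {p : Plane} :
    IsPole K (lineAt θ (h θ)) p ↔ MemTangentLine K (X θ) p ∧ MemTangentLine K (Y θ) p := by
  have hfr : ∀ {x}, x ∈ frontier K ↔ x ∈ K ∧ x ∉ interior K := fun {x} => by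
    rw [W.compact.isClosed.frontier_eq]; rfl
  constructor
  · rintro ⟨-, x, ⟨hx, hxf⟩, y, ⟨hy, hyf⟩, hxy, hxp, hyp⟩
    have key : ∀ z, ⟪z, unitVec θ⟫_ℝ = h θ → z ∈ frontier K → z = X θ ∨ z = Y θ := by
      intro z hz hzf
      obtain ⟨hzK, hzi⟩ := hfr.1 hzf
      have h1 := W.mem_left θ hzK hz
      by_contra hcon
      push Not at hcon
      refine hzi ?_
      rw [← framePt_inner θ z, hz]
      refine (W.chord θ).interior _ ⟨lt_of_le_of_ne h1.1 fun e => hcon.2 ?_,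
        lt_of_le_of_ne h1.2 fun e => hcon.1 ?_⟩
      · exact frame_ext θ (hz.trans (W.chord θ).right_height.symm) e.symm
      · exact frame_ext θ (hz.trans (W.chord θ).left_height.symm) e
    rcases key x hx hxf with rfl | rfl <;> rcases key y hy hyf with rfl | rfl
    · exact absurd rfl hxy
    · exact ⟨hxp, hyp⟩
    · exact ⟨hyp, hxp⟩
    · exact absurd rfl hxy
  · rintro ⟨hX, hY⟩
    obtain ⟨z, hz, hzh⟩ := W.exists_interior θ
    refine ⟨⟨z, hzh, hz⟩, X θ, ⟨(W.chord θ).left_height,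
      hfr.2 ⟨(W.chord θ).left_mem, (W.chord θ).left_notMem⟩⟩, Y θ, ⟨(W.chord θ).right_height,
      hfr.2 ⟨(W.chord θ).right_mem, (W.chord θ).right_notMem⟩⟩, fun e => ?_, hX, hY⟩
    have := (W.chord θ).lt
    rw [e] at this
    exact lt_irrefl _ this

lemma isContact_of_pole (W : IsWaterFamily K δ h X Y) {θ : ℝ} {p : Plane}
    (hX : MemTangentLine K (X θ) p) (hY : MemTangentLine K (Y θ) p)
    (hp : h θ < ⟪p, unitVec θ⟫_ℝ) : IsContact K p (X θ) (Y θ) := by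
  refine isContact_of_memTangentLine (W.chord θ).left_mem (W.chord θ).right_mem hX hY ?_
  rw [cross_apex (W.dir θ), (W.chord θ).left_height]
  exact mul_pos (W.len_pos θ) (sub_pos.2 hp)

lemma coneArea_eq (W : IsWaterFamily K δ h X Y) {θ : ℝ} {p : Plane}
    (hc : IsContact K p (X θ) (Y θ)) :
    coneArea K p = len X Y θ / 2 * (⟪p, unitVec θ⟫_ℝ - h θ) - δ := by
  rw [hc.coneArea_eq W.convex W.compact (W.dir θ) (W.len_pos θ), (W.chord θ).left_height]
  congr 1
  exact W.area θ

/-- Duality follows from the existence of poles of the right cone area. -/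
lemma areDual_of_poles (W : IsWaterFamily K δ h X Y) {d : ℝ} (hd : 0 < d)
    (hp : ∀ θ, ∃ p, coneArea K p = d ∧ MemTangentLine K (X θ) p ∧ MemTangentLine K (Y θ) p ∧
      h θ < ⟪p, unitVec θ⟫_ℝ) : AreDual K δ d := by
  constructor
  · intro θ t ht
    obtain ⟨p, h1, h2, h3, -⟩ := hp θ
    exact ⟨p, (mem_illuminationCurve_iff W.compact hd).2 h1,
      W.isWaterLine_iff.1 ht ▸ W.isPole_iff.2 ⟨h2, h3⟩⟩
  · intro q hq
    rw [mem_illuminationCurve_iff W.compact hd] at hq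
    obtain ⟨x, y, hc⟩ := exists_isContact W.convex W.compact W.nonempty
      (notMem_of_coneArea_pos W.convex (hq ▸ hd))
    obtain ⟨θ, l, hl, hdir⟩ := hc.exists_dir
    obtain ⟨p, h1, h2, h3, h4⟩ := hp θ
    have hc' := W.isContact_of_pole h2 h3 h4
    -- Both points are apexes of the same cone area with chords normal to `unitVec θ`; if distinct,
    -- each would be strictly higher than the other.
    have hpq : p = q := by
      by_contra hne
      have e1 := hc.height_lt_of_ne W.normals W.convex W.compact W.nonempty hdir hl
        (h1.trans hq.symm).le hne
      have e2 := hc'.height_lt_of_ne W.normals W.convex W.compact W.nonempty (W.dir θ)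
        (W.len_pos θ) (hq.trans h1.symm).le (Ne.symm hne)
      exact lt_asymm e1 e2
    exact ⟨θ, h θ, W.isWaterLine_iff.2 rfl, W.isPole_iff.2 (hpq ▸ ⟨h2, h3⟩)⟩

end IsWaterFamily
/-! ### Homothety of the curves of flotation and buoyancy -/

namespace IsWaterFamily

variable {K : Set Plane} {δ r : ℝ} {h : ℝ → ℝ} {X Y : ℝ → Plane}

lemma height_periodic (W : IsWaterFamily K δ h X Y) : Function.Periodic h (2 * Real.pi) := by
  intro θ
  rw [← W.isWaterLine_iff, IsWaterLine]
  have : unitVec (θ + 2 * Real.pi) = unitVec θ := by simp [unitVec]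
  have h1 : IsWaterLine K δ (θ + 2 * Real.pi) (h (θ + 2 * Real.pi)) := W.isWaterLine_iff.2 rfl
  rwa [IsWaterLine, cap, this] at h1

lemma mid_periodic (W : IsWaterFamily K δ h X Y) :
    Function.Periodic (mid X Y) (2 * Real.pi) := by
  intro θ
  have h1 : unitVec (θ + 2 * Real.pi) = unitVec θ := by simp [unitVec]
  have h2 : unitVecPerp (θ + 2 * Real.pi) = unitVecPerp θ := by simp [unitVecPerp]
  rw [W.eq_mid_iff]
  constructor
  · rw [← h1, W.mid_height, W.height_periodic]
  · have h3 := (W.hasDerivAt_height' (θ + 2 * Real.pi)).comp_add_const θ (2 * Real.pi)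
    rw [h2] at h3
    exact h3.congr_of_eventuallyEq
      (Filter.Eventually.of_forall fun φ => (W.height_periodic φ).symm)

lemma mid_eq_or_of_sin_eq_zero (W : IsWaterFamily K δ h X Y) {θ τ : ℝ}
    (hs : Real.sin (θ - τ) = 0) :
    mid X Y τ = mid X Y θ ∨ mid X Y τ = mid X Y (θ + Real.pi) := by
  obtain ⟨n, hn⟩ := Real.sin_eq_zero_iff.1 hs
  rcases Int.even_or_odd' n with ⟨k, rfl | rfl⟩
  · left
    rw [← W.mid_periodic.int_mul k τ]
    congr 1
    push_cast at hn
    linarith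
  · right
    rw [← W.mid_periodic.int_mul (k + 1) τ]
    congr 1
    push_cast at hn ⊢
    linarith

lemma continuous_mid (W : IsWaterFamily K δ h X Y) : Continuous (mid X Y) :=
  continuous_iff_continuousAt.2 fun θ => (W.exists_speed θ).choose_spec.1.continuousAt

lemma continuous_capCentroid (W : IsWaterFamily K δ h X Y) : Continuous (capCentroid K h) :=
  continuous_iff_continuousAt.2 fun θ => (W.hasDerivAt_capCentroid θ).continuousAt

/-- If the two curves are homothetic, corresponding points have parallel tangents, away from
the singularities of the curve of flotation. -/
lemma capCentroid_eq_or (W : IsWaterFamily K δ h X Y) (hr : 0 < r) {c : Plane}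
    (hc : AffineMap.homothety c r '' Set.range (mid X Y) = Set.range (capCentroid K h)) (θ : ℝ) :
    capCentroid K h θ = c + r • (mid X Y θ - c) ∨
      capCentroid K h θ = c + r • (mid X Y (θ + Real.pi) - c) := by
  choose ρ hρ using fun τ => (W.exists_speed τ).imp fun _ h => h.1
  have hb := W.continuous_capCentroid
  have hm := W.continuous_mid
  set Z : Set ℝ := {τ | ρ τ = 0} with hZ
  -- corresponding points
  have hcor : ∀ φ, ∃ τ, capCentroid K h φ = c + r • (mid X Y τ - c) ∧
      (τ ∈ Z ∨ Real.sin (φ - τ) = 0) := by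
    intro φ
    have h1 : capCentroid K h φ ∈ Set.range (capCentroid K h) := ⟨φ, rfl⟩
    rw [← hc] at h1
    obtain ⟨_, ⟨τ, rfl⟩, hτ⟩ := h1
    rw [homothety_eq] at hτ
    refine ⟨τ, hτ.symm, ?_⟩
    -- The centroid at `φ` is the highest of all centroids in direction `φ`, so its preimage is the
    -- highest of all midpoints.
    have hmax : IsLocalMax (fun τ => ⟪mid X Y τ, unitVec φ⟫_ℝ) τ := by
      refine Filter.Eventually.of_forall fun σ => ?_
      have h2 : AffineMap.homothety c r (mid X Y σ) ∈ Set.range (capCentroid K h) := by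
        rw [← hc]; exact ⟨_, ⟨σ, rfl⟩, rfl⟩
      obtain ⟨ψ, hψ⟩ := h2
      rw [homothety_eq] at hψ
      have h3 := W.capCentroid_le φ ψ
      rw [hψ, ← hτ] at h3
      simp only [inner_add_left, real_inner_smul_left, inner_sub_left] at h3
      have h4 : r * ⟪mid X Y σ, unitVec φ⟫_ℝ ≤ r * ⟪mid X Y τ, unitVec φ⟫_ℝ := by linarith
      exact le_of_mul_le_mul_left h4 hr
    have hder := (hρ τ).inner ℝ (hasDerivAt_const τ (unitVec φ))
    have h0 := hmax.hasDerivAt_eq_zero hder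
    rw [inner_zero_right, zero_add, real_inner_smul_left, inner_unitVecPerp_unitVec'] at h0
    exact mul_eq_zero.1 h0
  set E : Set ℝ := {φ | capCentroid K h φ = c + r • (mid X Y φ - c) ∨
      capCentroid K h φ = c + r • (mid X Y (φ + Real.pi) - c)} with hE
  have hEc : IsClosed E :=
    (isClosed_eq hb (by fun_prop)).union (isClosed_eq hb (by fun_prop))
  -- On an interval missing `E` all centroids are images of critical midpoints, whose coordinates
  -- along `e` form a null set. But the centroid moves along `e` with nonzero speed at `θ₀`, so
  -- these coordinates fill an interval.
  have hEd : Dense E := by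
    rw [Metric.dense_iff]
    intro θ₀ ε hε
    by_contra hcon
    rw [Set.not_nonempty_iff_eq_empty] at hcon
    have hball : ∀ φ ∈ Metric.ball θ₀ ε, ∃ τ ∈ Z, capCentroid K h φ = c + r • (mid X Y τ - c) := by
      intro φ hφ
      obtain ⟨τ, h1, h2 | h2⟩ := hcor φ
      · exact ⟨τ, h2, h1⟩
      · exfalso
        have : φ ∈ Metric.ball θ₀ ε ∩ E := ⟨hφ, by
          rcases W.mid_eq_or_of_sin_eq_zero h2 with h3 | h3
          · left; rw [h1, h3]
          · right; rw [h1, h3]⟩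
        rw [hcon] at this
        exact this
    set e := unitVecPerp θ₀ with he
    have hnull := volume_image_critical_eq_zero (g := fun τ => ⟪c + r • (mid X Y τ - c), e⟫_ℝ)
      (s := Z) fun τ hτ => by
        have h1 := (((hρ τ).sub_const c).const_smul r).const_add c
        have h2 := h1.inner ℝ (hasDerivAt_const τ e)
        refine h2.congr_deriv ?_
        rw [show ρ τ = 0 from hτ]
        simp
    set f : ℝ → ℝ := fun φ => ⟪capCentroid K h φ, e⟫_ℝ with hf
    have hfc : Continuous f := by fun_prop
    have hsub : f '' Metric.ball θ₀ ε ⊆ (fun τ => ⟪c + r • (mid X Y τ - c), e⟫_ℝ) '' Z := by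
      rintro _ ⟨φ, hφ, rfl⟩
      obtain ⟨τ, hτ, h1⟩ := hball φ hφ
      exact ⟨τ, hτ, by simp only [hf, h1]⟩
    have hfd : HasDerivAt f (len X Y θ₀ ^ 3 / (12 * δ)) θ₀ := by
      have h2 := (W.hasDerivAt_capCentroid θ₀).inner ℝ (hasDerivAt_const θ₀ e)
      refine h2.congr_deriv ?_
      rw [inner_zero_right, zero_add, real_inner_smul_left, he, inner_unitVecPerp_self, mul_one]
    have hpos : len X Y θ₀ ^ 3 / (12 * δ) ≠ 0 :=
      (div_pos (pow_pos (W.len_pos θ₀) 3) (by linarith [W.pos])).ne'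
    have hne := hfd.eventually_ne hpos (c := f θ₀)
    have hmem : ∀ᶠ φ in 𝓝[≠] θ₀, φ ∈ Metric.ball θ₀ ε :=
      nhdsWithin_le_nhds (Metric.ball_mem_nhds θ₀ hε)
    obtain ⟨φ, hφ, hφb⟩ := (hne.and hmem).exists
    have hivt : Set.uIcc (f θ₀) (f φ) ⊆ f '' Metric.ball θ₀ ε := by
      refine (intermediate_value_uIcc hfc.continuousOn).trans (Set.image_mono ?_)
      exact (convex_ball θ₀ ε).ordConnected.uIcc_subset (Metric.mem_ball_self hε) hφb
    have hz := measure_mono_null (hivt.trans hsub) hnull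
    rw [Set.uIcc, Real.volume_Icc, ENNReal.ofReal_eq_zero, max_sub_min_eq_abs] at hz
    exact hφ (sub_eq_zero.1 (abs_nonpos_iff.1 hz))
  have huniv : E = Set.univ := hEc.closure_eq.symm.trans hEd.closure_eq
  exact (Set.eq_univ_iff_forall.1 huniv θ :)

/-- The centroids of the caps cannot be the homothetic images of the mid points of the opposite
chords. -/
lemma exists_ne_opposite (W : IsWaterFamily K δ h X Y) (hδ : δ ≤ volume.real K / 2) (hr : 0 < r)
    (c : Plane) : ∃ θ, capCentroid K h θ ≠ c + r • (mid X Y (θ + Real.pi) - c) := by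
  -- With `S` the sum of the heights of two opposite water lines, adding the inequalities that each
  -- centroid lies beyond its water line gives `S < -r * S`, while `S ≥ 0`.
  by_contra! hcon
  have h1 := W.height_lt_capCentroid 0
  have h2 := W.height_lt_capCentroid (0 + Real.pi)
  have h3 := waterHeight_add_nonneg W.convex W.compact W.nonempty W.pos hδ W.area 0
  have e : ∀ θ q, ⟪q, unitVec θ⟫_ℝ = -⟪q, unitVec (θ + Real.pi)⟫_ℝ := fun θ q => by
    rw [unitVec_add_pi, inner_neg_right, neg_neg]
  rw [hcon] at h1 h2
  simp only [inner_add_left, real_inner_smul_left, inner_sub_left] at h1 h2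
  have e1 := e 0 c
  rw [e 0 (mid X Y _), W.mid_height] at h1
  rw [e (0 + Real.pi) (mid X Y _), W.mid_height,
    show 0 + Real.pi + Real.pi = 0 + 2 * Real.pi by ring, W.height_periodic] at h2
  rw [e1] at h1
  nlinarith

/-- If opposite midpoints coincide once, the two water lines coincide and `δ` is half the area; then
opposite water lines coincide in every direction. -/
lemma mid_add_pi_of_eq (W : IsWaterFamily K δ h X Y) {θ₀ : ℝ}
    (h₀ : mid X Y θ₀ = mid X Y (θ₀ + Real.pi)) (θ : ℝ) :
    mid X Y θ = mid X Y (θ + Real.pi) := by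
  have e1 : h (θ₀ + Real.pi) = -h θ₀ := by
    rw [← W.mid_height, ← W.mid_height θ₀, ← h₀, unitVec_add_pi, inner_neg_right]
  have e2 : volume.real K - δ = δ := by
    rw [← W.area θ₀, ← capArea_add_pi W.compact, ← e1, W.area, W.area]
  have e3 : ∀ φ, h (φ + Real.pi) = -h φ := fun φ => by
    refine capArea_inj W.convex W.compact W.nonempty W.pos W.lt (W.area _) ?_
    rw [capArea_add_pi W.compact, W.area, e2]
  refine (W.eq_mid_iff.2 ⟨?_, ?_⟩).symm
  · have := W.mid_height (θ + Real.pi)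
    rw [unitVec_add_pi, inner_neg_right, e3] at this
    linarith
  · have h3 := (W.hasDerivAt_height' (θ + Real.pi)).comp_add_const θ Real.pi
    rw [unitVecPerp_add_pi, inner_neg_right] at h3
    have h4 := h3.neg
    rw [neg_neg] at h4
    refine h4.congr_of_eventuallyEq (Filter.Eventually.of_forall fun φ => ?_)
    simp [e3]

/-- If the curves of flotation and of buoyancy are homothetic, then the homothety maps the mid
points of the chords to the centroids of the caps. -/
lemma exists_capCentroid_eq (W : IsWaterFamily K δ h X Y) (hδ : δ ≤ volume.real K / 2)
    (hr : 0 < r) (hhom : IsHomotheticWithRatio (flotationCurve K δ) (buoyancyCurve K δ) r) :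
    ∃ c : Plane, ∀ θ, capCentroid K h θ = c + r • (mid X Y θ - c) := by
  obtain ⟨c, hc⟩ := hhom
  rw [W.flotationCurve_eq, W.buoyancyCurve_eq] at hc
  have hb := W.continuous_capCentroid
  have hm := W.continuous_mid
  refine ⟨c, ?_⟩
  by_contra! hcon
  obtain ⟨θ₁, h₁⟩ := hcon
  obtain ⟨θ₂, h₂⟩ := W.exists_ne_opposite hδ hr c
  have hcov := W.capCentroid_eq_or hr hc
  -- Two nonempty closed sets cover the connected line, so they meet. At a common angle opposite
  -- midpoints coincide, hence always, and the two alternatives become the same.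
  obtain ⟨θ₀, -, h3, h4⟩ := isPreconnected_closed_iff.1 (isPreconnected_univ (α := ℝ))
    {θ | capCentroid K h θ = c + r • (mid X Y θ - c)}
    {θ | capCentroid K h θ = c + r • (mid X Y (θ + Real.pi) - c)}
    (isClosed_eq hb (by fun_prop)) (isClosed_eq hb (by fun_prop)) (fun θ _ => hcov θ)
    ⟨θ₂, trivial, (hcov θ₂).resolve_right h₂⟩ ⟨θ₁, trivial, (hcov θ₁).resolve_left h₁⟩
  have h5 : mid X Y θ₀ = mid X Y (θ₀ + Real.pi) := by
    have h6 := (h3 : capCentroid K h θ₀ = _).symm.trans h4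
    exact sub_left_injective (smul_right_injective _ hr.ne' (add_left_cancel h6))
  have h7 := (hcov θ₁).resolve_left h₁
  rw [← W.mid_add_pi_of_eq h5] at h7
  exact h₁ h7

/-- The speed of the curve of mid points is positive if it does not vanish. -/
lemma speed_pos (W : IsWaterFamily K δ h X Y) (hδ : δ ≤ volume.real K / 2) {ρ : ℝ → ℝ}
    (hρ : ∀ θ, HasDerivAt (mid X Y) (ρ θ • unitVecPerp θ) θ) (hne : ∀ θ, ρ θ ≠ 0) (θ : ℝ) :
    0 < ρ θ := by
  have hpi := Real.pi_pos
  -- `θ` is the centre of the half turn from `α` to `α + π`, on which `sin (α - φ) < 0`. A negative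
  -- `ρ` would make the height of the midpoint in direction `α` increase there, that is `h α < -h (α
  -- + π)`.
  set α := θ - Real.pi / 2 with hα
  set g : ℝ → ℝ := fun φ => ⟪mid X Y φ, unitVec α⟫_ℝ with hg
  have hder : ∀ φ, HasDerivAt g (ρ φ * Real.sin (α - φ)) φ := fun φ => by
    refine ((hρ φ).inner ℝ (hasDerivAt_const φ (unitVec α))).congr_deriv ?_
    rw [inner_zero_right, zero_add, real_inner_smul_left, inner_unitVecPerp_unitVec']
  have hsin : ∀ φ ∈ Set.Ioo α (α + Real.pi), Real.sin (α - φ) < 0 := fun φ hφ =>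
    Real.sin_neg_of_neg_of_neg_pi_lt (by linarith [hφ.1]) (by linarith [hφ.2])
  have hθ : θ ∈ Set.Ioo α (α + Real.pi) := ⟨by linarith, by linarith⟩
  -- Darboux's theorem gives a constant sign without continuity of `ρ`.
  rcases hasDerivWithinAt_forall_lt_or_forall_gt_of_forall_ne (convex_Ioo α (α + Real.pi))
    (fun φ _ => (hder φ).hasDerivWithinAt) (m := 0)
    (fun φ hφ => mul_ne_zero (hne φ) (hsin φ hφ).ne) with hlt | hgt
  · have := hlt θ hθ
    nlinarith [hsin θ hθ]
  · exfalso
    have hmono : StrictMonoOn g (Set.Icc α (α + Real.pi)) := by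
      refine strictMonoOn_of_deriv_pos (convex_Icc _ _)
        (fun φ _ => (hder φ).continuousAt.continuousWithinAt) fun φ hφ => ?_
      rw [interior_Icc] at hφ
      rw [(hder φ).deriv]
      exact hgt φ hφ
    have h1 := hmono (Set.left_mem_Icc.2 (by linarith)) (Set.right_mem_Icc.2 (by linarith))
      (by linarith : α < α + Real.pi)
    have h2 := waterHeight_add_nonneg W.convex W.compact W.nonempty W.pos hδ W.area α
    have h3 := W.mid_height (α + Real.pi)
    rw [unitVec_add_pi, inner_neg_right] at h3
    simp only [hg] at h1
    rw [W.mid_height] at h1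
    linarith

lemma lt_of_speed {l ρ s t : ℝ} (hρ : 0 < ρ) (hl : 0 < l) (hu : 4 * ρ * (t - s) = l ^ 2) :
    s < t := by
  have h1 : 0 < 4 * ρ * (t - s) := hu ▸ by positivity
  linarith [pos_of_mul_pos_right h1 (by positivity)]

/-- The area of the triangle formed by a chord and the tangent lines at its end points. -/
lemma area_of_speed {l ρ u : ℝ} (hρ : ρ ≠ 0) (hu : 4 * ρ * u = l ^ 2) :
    l / 2 * u = l ^ 3 / (8 * ρ) := by
  rw [eq_div_iff (by simpa using hρ)]
  linear_combination l * hu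

/-- Differentiating the homothety gives `l³/(12δ) = r ρ`. So `ρ > 0`, the pole exists above the
water line, and its triangle has area `l³/(8ρ) = 3δr/2 = δ + δ'`. -/
lemma areDual_of_homothetic (W : IsWaterFamily K δ h X Y) {δ' : ℝ} (hδ' : 0 < δ') (hr : 0 < r)
    (hT : δ + δ' = 3 * δ * r / 2) {c : Plane}
    (hc : ∀ θ, capCentroid K h θ = c + r • (mid X Y θ - c)) : AreDual K δ δ' := by
  refine W.areDual_of_poles hδ' fun θ => ?_
  obtain ⟨ρ, hρ, hpole, hex⟩ := W.exists_speed θ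
  have hl := W.len_pos θ
  have hδ := W.pos
  have hspeed : len X Y θ ^ 3 / (12 * δ) = r * ρ := by
    have h1 := ((hρ.sub_const c).const_smul r).const_add c
    have h2 := (W.hasDerivAt_capCentroid θ).congr_of_eventuallyEq
      (Filter.Eventually.of_forall fun φ => (hc φ).symm)
    have h3 := congrArg (fun v => ⟪v, unitVecPerp θ⟫_ℝ) (h2.unique h1)
    simpa [real_inner_smul_left] using h3
  have hρ0 : 0 < ρ := by
    have : 0 < r * ρ := hspeed ▸ by positivity
    exact pos_of_mul_pos_right this hr.le
  obtain ⟨p, hX, hY⟩ := hex hρ0.ne'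
  have hu := hpole p hX hY
  have hup := lt_of_speed hρ0 hl hu
  refine ⟨p, ?_, hX, hY, hup⟩
  rw [W.coneArea_eq (W.isContact_of_pole hX hY hup), area_of_speed hρ0.ne' hu]
  have h2 : len X Y θ ^ 3 / (8 * ρ) = 3 * δ * r / 2 := by
    rw [div_eq_iff (by positivity)] at hspeed ⊢
    linear_combination hspeed
  rw [h2, ← hT]
  ring

/-- If the poles of the water lines have constant cone area, then a homothety maps the mid
points of the chords to the centroids of the caps. -/
lemma exists_capCentroid_eq_of_poles (W : IsWaterFamily K δ h X Y) (hδ : δ ≤ volume.real K / 2)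
    {δ' : ℝ} (hT : δ + δ' = 3 * δ * r / 2)
    (hp : ∀ θ, ∃ p, coneArea K p = δ' ∧ MemTangentLine K (X θ) p ∧ MemTangentLine K (Y θ) p) :
    ∃ c : Plane, ∀ θ, capCentroid K h θ = c + r • (mid X Y θ - c) := by
  choose ρ hρ hpole hex using W.exists_speed
  have hδ0 := W.pos
  have hne : ∀ θ, ρ θ ≠ 0 := by
    intro θ h0
    obtain ⟨p, -, hX, hY⟩ := hp θ
    have h1 := hpole θ p hX hY
    rw [h0] at h1
    have := pow_pos (W.len_pos θ) 2
    linarith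
  have hpos := W.speed_pos hδ hρ hne
  have hspeed : ∀ θ, len X Y θ ^ 3 / (12 * δ) = r * ρ θ := by
    intro θ
    obtain ⟨p, hA, hX, hY⟩ := hp θ
    have hl := W.len_pos θ
    have hρ0 := hpos θ
    have hu := hpole θ p hX hY
    have hup := lt_of_speed hρ0 hl hu
    rw [W.coneArea_eq (W.isContact_of_pole hX hY hup), area_of_speed hρ0.ne' hu] at hA
    have h2 : len X Y θ ^ 3 / (8 * ρ θ) = 3 * δ * r / 2 := by linarith
    rw [div_eq_iff (by positivity)] at h2 ⊢
    linear_combination h2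
  -- Constant area of the triangles says that centroid and scaled midpoint have equal velocities;
  -- the constant difference `k` determines the centre `k / (1 - r)`.
  set k : ℝ → Plane := fun θ => capCentroid K h θ - r • mid X Y θ with hk
  have hkd : ∀ θ, HasDerivAt k 0 θ := fun θ => by
    refine ((W.hasDerivAt_capCentroid θ).sub ((hρ θ).const_smul r)).congr_deriv ?_
    rw [hspeed, smul_smul, sub_self]
  have hconst : ∀ θ, k θ = k 0 := fun θ =>
    is_const_of_deriv_eq_zero (fun φ => (hkd φ).differentiableAt) (fun φ => (hkd φ).deriv) θ 0
  -- For `r = 1` the homothety would be a translation by a fixed vector with positive component in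
  -- every direction, as centroids lie beyond their water lines.
  have hr1 : 1 - r ≠ 0 := by
    intro h0
    have hr1 : r = 1 := by linarith
    have h1 : ∀ θ, 0 < ⟪k 0, unitVec θ⟫_ℝ := fun θ => by
      rw [← hconst θ]
      simp only [hk, hr1, one_smul, inner_sub_left, W.mid_height]
      linarith [W.height_lt_capCentroid θ]
    have h2 := h1 0
    have h3 := h1 (0 + Real.pi)
    rw [unitVec_add_pi, inner_neg_right] at h3
    linarith
  refine ⟨(1 - r)⁻¹ • k 0, fun θ => ?_⟩
  have h1 : capCentroid K h θ = k 0 + r • mid X Y θ := by rw [← hconst θ]; simp [hk]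
  have h2 : k 0 = (1 - r) • (1 - r)⁻¹ • k 0 := by rw [smul_smul, mul_inv_cancel₀ hr1, one_smul]
  rw [h1]
  nth_rewrite 1 [h2]
  module

lemma isHomothetic_flotation (W : IsWaterFamily K δ h X Y) {c : Plane}
    (hc : ∀ θ, capCentroid K h θ = c + r • (mid X Y θ - c)) :
    IsHomotheticWithRatio (flotationCurve K δ) (buoyancyCurve K δ) r := by
  refine ⟨c, ?_⟩
  rw [W.flotationCurve_eq, W.buoyancyCurve_eq, ← Set.range_comp]
  congr 1
  funext θ
  rw [Function.comp, homothety_eq, hc]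

/-- The centroid of the silhouette cone of the pole of a water line. -/
lemma coneCentroid_eq_of_contact (W : IsWaterFamily K δ h X Y) {δ' r' : ℝ} (hδ' : 0 < δ')
    (hr : δ * r = 2 * δ' * r') (hT : δ + δ' = 3 * δ' * r') {c : Plane}
    (hc : ∀ θ, capCentroid K h θ = c + r • (mid X Y θ - c)) {θ : ℝ} {p : Plane}
    (hp : coneArea K p = δ') (hpc : IsContact K p (X θ) (Y θ)) :
    coneCentroid K p = c + r' • (p - c) := by
  have hdir := W.dir θ
  have hl := W.len_pos θ
  have hA := hpc.volume_silhouetteCone W.convex W.compact hdir hl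
  rw [(W.chord θ).left_height] at hA
  have hcap : volume.real (cap K θ (h θ)) = δ := W.area θ
  change coneArea K p = _ at hA
  rw [hcap, hp] at hA
  have key : ∀ e, δ' * ⟪coneCentroid K p, e⟫_ℝ = δ' * ⟪c + r' • (p - c), e⟫_ℝ := by
    intro e
    have hi := hpc.integral_silhouetteCone W.convex W.compact hdir hl (f := fun q => ⟪q, e⟫_ℝ)
      (by fun_prop)
    have ht := tri_integral hpc.pos 0 e
    simp only [zero_add] at ht
    rw [(W.chord θ).left_height, ← W.inner_capCentroid, ht, hc] at hi
    rw [inner_coneCentroid W.compact hδ' hp, hi]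
    simp only [mid, inner_add_left, real_inner_smul_left, inner_sub_left]
    -- The midpoint enters with weight `2δ'r'` from the triangle and `-δr` from the cap, which
    -- cancel by `hr`; `hT` balances the terms in `c`.
    have hA' : cross (X θ - p) (Y θ - p) / 2 = 3 * δ' * r' := by linarith
    rw [hA']
    linear_combination (⟪c, e⟫_ℝ - (⟪X θ, e⟫_ℝ + ⟪Y θ, e⟫_ℝ) / 2) * hr - ⟪c, e⟫_ℝ * hT
  exact frame_ext 0 (mul_left_cancel₀ hδ'.ne' (key _)) (mul_left_cancel₀ hδ'.ne' (key _))

/-- Duality from the homothety of the curves of illumination and of centroids. -/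
lemma areDual_of_coneCentroid (W : IsWaterFamily K δ h X Y) {δ' r' : ℝ} (hδ' : 0 < δ')
    (hT : δ + δ' = 3 * δ' * r') {c : Plane}
    (hcen : ∀ p, coneArea K p = δ' → coneCentroid K p = c + r' • (p - c)) : AreDual K δ δ' := by
  refine W.areDual_of_poles hδ' fun θ => ?_
  obtain ⟨p, x, y, l, hp, hxy, hl, hdir, harea⟩ :=
    exists_chord_of_homothety W.normals W.convex W.compact W.nonempty hδ' hcen θ
  have hA := hxy.coneArea_eq W.convex W.compact hdir hl
  -- The triangle has area `3δ'r' = δ + δ'` and the cone `δ'`, so the cap has area `δ` and the chord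
  -- lies on the water line.
  have hcap : capArea K θ ⟪x, unitVec θ⟫_ℝ = δ := by
    rw [capArea]
    linarith
  have hx : ⟪x, unitVec θ⟫_ℝ = h θ :=
    W.isWaterLine_iff.1 ((_root_.isWaterLine_iff W.compact W.pos).2 hcap)
  have hy : ⟪y, unitVec θ⟫_ℝ = h θ := (height_eq_of_dir hdir).trans hx
  have hxp := memTangentLine_left hxy
  have hyp := memTangentLine_right hxy
  have hfr : ∀ {z}, z ∈ K → MemTangentLine K z p → z ∈ frontier K := fun hz hzp => by
    rw [W.compact.isClosed.frontier_eq]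
    exact ⟨hz, hzp.notMem_interior⟩
  obtain ⟨z, hz, hzh⟩ := W.exists_interior θ
  have hne : x ≠ y := by
    rintro rfl
    have := hxy.pos
    rw [cross_same] at this
    exact lt_irrefl _ this
  obtain ⟨hX, hY⟩ := W.isPole_iff.1 ⟨⟨z, hzh, hz⟩, x, ⟨hx, hfr hxy.left_mem hxp⟩, y,
    ⟨hy, hfr hxy.right_mem hyp⟩, hne, hxp, hyp⟩
  exact ⟨p, hp, hX, hY, hx ▸ hxy.height_lt hdir hl⟩

/-- Homothety of the curves of illumination and of centroids from duality. -/
lemma isHomothetic_illumination (W : IsWaterFamily K δ h X Y) (hδ : δ ≤ volume.real K / 2)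
    {δ' r' : ℝ} (hδ' : 0 < δ') (hr : δ * r = 2 * δ' * r') (hT : δ + δ' = 3 * δ' * r')
    (hdual : AreDual K δ δ') {c : Plane}
    (hc : ∀ θ, capCentroid K h θ = c + r • (mid X Y θ - c)) :
    IsHomotheticWithRatio (illuminationCurve K δ') (illuminationCentroidCurve K δ') r' := by
  choose ρ hρ hpole _ using W.exists_speed
  have hpoles : ∀ θ, ∃ p, MemTangentLine K (X θ) p ∧ MemTangentLine K (Y θ) p := fun θ => by
    obtain ⟨p, -, hp⟩ := hdual.1 θ (h θ) (W.isWaterLine_iff.2 rfl)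
    exact ⟨p, W.isPole_iff.1 hp⟩
  have hne : ∀ θ, ρ θ ≠ 0 := by
    intro θ h0
    obtain ⟨p, hX, hY⟩ := hpoles θ
    have h1 := hpole θ p hX hY
    rw [h0] at h1
    have := pow_pos (W.len_pos θ) 2
    linarith
  have hpos := W.speed_pos hδ hρ hne
  have hcen : ∀ p ∈ illuminationCurve K δ', coneCentroid K p = c + r' • (p - c) := by
    intro p hp
    obtain ⟨θ, t, ht, hpt⟩ := hdual.2 p hp
    rw [W.isWaterLine_iff.1 ht, W.isPole_iff] at hpt
    obtain ⟨hX, hY⟩ := hpt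
    have hu := hpole θ p hX hY
    have hl := W.len_pos θ
    have hρ0 := hpos θ
    have hup := lt_of_speed hρ0 hl hu
    exact W.coneCentroid_eq_of_contact hδ' hr hT hc
      ((mem_illuminationCurve_iff W.compact hδ').1 hp) (W.isContact_of_pole hX hY hup)
  refine ⟨c, ?_⟩
  ext s
  constructor
  · rintro ⟨p, hp, rfl⟩
    exact ⟨p, hp, by rw [homothety_eq, ← hcen p hp]; rfl⟩
  · rintro ⟨p, hp, rfl⟩
    exact ⟨p, hp, by rw [homothety_eq, ← hcen p hp]; rfl⟩

end IsWaterFamily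
end

/-! ### The equivalence. -/

theorem mainTheorem7 (K : Set Plane) (hconv : Convex ℝ K) (hcomp : IsCompact K)
    (hint : (interior K).Nonempty) (hC2 : HasC2Boundary K)
    (δ δ' r r' : ℝ) (hδ : 0 < δ) (hδ_half : δ ≤ volume.real K / 2) (hδ' : 0 < δ')
    (hr : 0 < r) (hr' : 0 < r')
    (h₁ : 1 / (δ' * r') = 2 / (δ * r)) (h₂ : 1 / r' + 2 / r = 3) :
    List.TFAE
      [IsHomotheticWithRatio (flotationCurve K δ) (buoyancyCurve K δ) r,
       IsHomotheticWithRatio (illuminationCurve K δ') (illuminationCentroidCurve K δ') r',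
       AreDual K δ δ'] := by
  have hnorm : HasUniqueNormals K := hC2.hasUniqueNormals hcomp.isClosed hint
  have hvol : 0 < volume.real K :=
    ENNReal.toReal_pos (Measure.measure_pos_of_nonempty_interior volume hint).ne' hcomp.measure_lt_top.ne
  obtain ⟨h, X, Y, W⟩ := exists_isWaterFamily hconv hcomp hint hnorm hδ (by linarith)
  have e1 : δ * r = 2 * δ' * r' := by
    rw [div_eq_div_iff (by positivity) (by positivity)] at h₁
    linarith
  have e2 : r + 2 * r' = 3 * r * r' := by
    field_simp at h₂
    linarith
  -- The two parameter relations express the common area `δ + δ'` of the triangles over the water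
  -- lines, once through `r'` and once through `r`.
  have e3 : δ + δ' = 3 * δ' * r' := by
    have : r * (δ + δ') = r * (3 * δ' * r') := by linear_combination e1 + δ' * e2
    exact mul_left_cancel₀ hr.ne' this
  have e4 : δ + δ' = 3 * δ * r / 2 := by linarith
  tfae_have 1 → 3 := fun h1 => by
    obtain ⟨c, hc⟩ := W.exists_capCentroid_eq hδ_half hr h1
    exact W.areDual_of_homothetic hδ' hr e4 hc
  tfae_have 2 → 3 := fun h2 => by
    obtain ⟨c, hc⟩ := coneCentroid_eq_homothety hnorm hconv hcomp hint hδ' hr' h2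
    exact W.areDual_of_coneCentroid hδ' e3 hc
  have hmid : AreDual K δ δ' →
      ∃ c : Plane, ∀ θ, capCentroid K h θ = c + r • (mid X Y θ - c) := fun h3 =>
    W.exists_capCentroid_eq_of_poles hδ_half e4 fun θ => by
      obtain ⟨p, hp, hpole⟩ := h3.1 θ (h θ) (W.isWaterLine_iff.2 rfl)
      exact ⟨p, (mem_illuminationCurve_iff hcomp hδ').1 hp, W.isPole_iff.1 hpole⟩
  tfae_have 3 → 1 := fun h3 => by
    obtain ⟨c, hc⟩ := hmid h3
    exact W.isHomothetic_flotation hc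
  tfae_have 3 → 2 := fun h3 => by
    obtain ⟨c, hc⟩ := hmid h3
    exact W.isHomothetic_illumination hδ_half hδ' e1 e3 h3 hc
  tfae_finish
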